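/- **Setting.** Let $(E,\langle\cdot,\cdot\rangle)$ be a Euclidean space of dimension $r$, with $E^*\simeq E$ via the inner product, $\Phi_0\subset E^*$ an irreducible reduced root system with base $\{\alpha_1,\dots,\alpha_r\}$, highest root $\varphi$, co-roots $\alpha^\vee\in E$ and co-root lattice $Q^\vee$. Put $\Phi=\Phi_0\times\mathbb Z$, where $a=(\alpha,m)\in\Phi$ is viewed as the affine functional $a(y)=\alpha(y)+m$ on $E$ with gradient $\overline a=\alpha$. Let $W=W_0\ltimes\tau(Q^\vee)$ be the affine Weyl group, generated by the reflections $s_a(y)=y-a(y)\overline a^\vee$ ($a\in\Phi$), where $\tau(\lambda)$ is translation by $\lambda$; let $\alpha_0=(-\varphi,1)$, $s_j=s_{\alpha_j}$ for $0\le j\le r$, and $\overline{C_+}=\{y\in E:\alpha_j(y)\ge 0,\ 0\le j\le r\}$. Let $\Phi^{\rm nr}=\Phi\sqcup\{a/2: a\in\Phi,\ \overline a(Q^\vee)=2\mathbb Z\}$. Let $\mathbf F$ be a field of characteristic zero, $q_\varphi\in\mathbf F^\times$, $q^m:=q_\varphi^{m\|\varphi\|^2/2}$ for $m\in\frac{2}{\|\varphi\|^2}\mathbb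 Z$, and let $\mathbf k\colon\Phi^{\rm nr}\to\mathbf F^\times$ be $W$-invariant. Put $k_j=\mathbf k_{\alpha_j}$, and $u_j=\mathbf k_{\alpha_j/2}$ if $\alpha_j/2\in\Phi^{\rm nr}$, $u_j=k_j$ otherwise. Let $\mathbf F[E]=\bigoplus_{y\in E}\mathbf F x^y$ be the group algebra of $E$ and $\mathbf F[Z]=\bigoplus_{y\in Z}\mathbf Fx^y$ for $Z\subseteq E$. Put $x^{\alpha_0^\vee}:=q_\varphi x^{-\varphi^\vee}$ and $x^{m\alpha_j^\vee}:=(x^{\alpha_j^\vee})^m$. The group $W$ acts on $\mathbf F[Q^\vee]$ by $w(x^\mu)=x^{w\mu}$ ($w\in W_0$), $\tau(\lambda)(x^\mu)=q^{-\langle\lambda,\mu\rangle}x^\mu$, and on the torus $\mathbf T=\mathrm{Hom}(Q^\vee,\mathbf F^\times)$, $t\colon\mu\mapsto t^\mu$, by $(wt)^\mu=t^{w^{-1}\mu}$, $(\tau(\lambda)t)^\mu=q^{\langle\lambda,\mu\rangle}t^\mu$. The double affine Hecke algebra $\mathbb H=\mathbb H(\mathbf k;q_\varphi)$ is the unital associative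 $\mathbf F$-algebra with generators $T_j$ ($0\le j\le r$), $x^\mu$ ($\mu\in Q^\vee$) and relations: the braid relations of $(W,\{s_0,\dots,s_r\})$ for the $T_j$; $(T_j-k_j)(T_j+k_j^{-1})=0$; $x^\mu x^\nu=x^{\mu+\nu}$, $x^0=1$; and $$T_jx^\mu-s_j(x^\mu)T_j=\Bigl(\tfrac{k_j-k_j^{-1}+(u_j-u_j^{-1})x^{\alpha_j^\vee}}{1-x^{2\alpha_j^\vee}}\Bigr)(x^\mu-s_j(x^\mu)).$$ $H^X\subset\mathbb H$ is the subalgebra generated by all $x^\mu$ and by $T_1,\dots,T_r$. For a $W$-orbit $\mathcal O\subset E$ let $c^{\mathcal O}$ be the unique point of $\mathcal O\cap\overline{C_+}$ and $$\mathbf T_{\mathcal O}=\{t\in\mathbf T: t^{\alpha_j^\vee}=1\text{ for all }j\in\{0,\dots,r\}\text{ with }\alpha_j(c^{\mathcal O})=0\},\qquad t^{\alpha_0^\vee}:=q_\varphi t^{-\varphi^\vee}.$$ For $y\in E$ let $\mathbf g_y\in W$ be the shortest element with $\mathbf g_y^{-1}y\in\overline{C_+}$. For $t\in\mathbf T_{\mathcal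 O}$ and $y\in\mathcal O$ put $w_tx^y=x^{wy}$ ($w\in W_0$), $\tau(\lambda)_tx^y=(\mathbf g_yt)^{-\lambda}x^y$ ($\lambda\in Q^\vee$), $(\tau(\lambda)w)_t=\tau(\lambda)_tw_t$, and $s_{j,t}=(s_j)_t$. Let $\lfloor\cdot\rfloor_e$, $\lfloor\cdot\rfloor_o$ be the largest even, respectively odd, integer $\le\cdot$; let $\chi_e,\chi_o,\chi_{\mathbb Z}$ be the indicator functions on $\mathbb R$ of the even integers, the odd integers and the integers; and put $$\nabla_j^e(x^y)=\Bigl(\tfrac{1-x^{-\lfloor\overline\alpha_j(y)\rfloor_e\alpha_j^\vee}}{1-x^{2\alpha_j^\vee}}\Bigr)x^y,\qquad \nabla_j^o(x^y)=\Bigl(\tfrac{x^{\alpha_j^\vee}-x^{-\lfloor\overline\alpha_j(y)\rfloor_o\alpha_j^\vee}}{1-x^{2\alpha_j^\vee}}\Bigr)x^y .$$ **Theorem.** (1) Let $\mathcal O$ be a $W$-orbit in $E$ and $t\in\mathbf T_{\mathcal O}$. There is a unique representation $\pi^{\mathcal O}\colon H^X\to\mathrm{End}(\mathbf F[\mathcal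 O])$ with $\pi^{\mathcal O}(x^\lambda)x^y=x^{y+\lambda}$ and $$\pi^{\mathcal O}(T_i)x^y=k_i^{\chi_e(\alpha_i(y))}u_i^{\chi_o(\alpha_i(y))}x^{s_iy}+(k_i-k_i^{-1})\nabla_i^e(x^y)+(u_i-u_i^{-1})\nabla_i^o(x^y)$$ for $\lambda\in Q^\vee$, $1\le i\le r$, $y\in\mathcal O$. There is a unique representation $\pi_t^{\mathcal O}\colon\mathbb H\to\mathrm{End}(\mathbf F[\mathcal O])$ with $\pi_t^{\mathcal O}(x^\lambda)x^y=x^{y+\lambda}$ and $$\pi_t^{\mathcal O}(T_j)x^y=k_j^{\chi_e(\overline\alpha_j(y))}u_j^{\chi_o(\overline\alpha_j(y))}s_{j,t}x^y+(k_j-k_j^{-1})\nabla_j^e(x^y)+(u_j-u_j^{-1})\nabla_j^o(x^y)$$ for $\lambda\in Q^\vee$, $0\le j\le r$, $y\in\mathcal O$. It extends the $H^X$-action: $\pi_t^{\mathcal O}|_{H^X}=\pi^{\mathcal O}$. (2) $Q^\vee$ is a $W$-orbit, $\mathbf T_{Q^\vee}=\{1\}$, and $\pi_1^{Q^\vee}$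 is the basic (polynomial) representation: $x^\lambda$ acts on $\mathbf F[Q^\vee]$ by multiplication, and for $0\le j\le r$ and $\mu\in Q^\vee$ $$\pi_1^{Q^\vee}(T_j)x^\mu=k_js_j(x^\mu)+\bigl(k_j-k_j^{-1}+(u_j-u_j^{-1})x^{\alpha_j^\vee}\bigr)\frac{x^\mu-s_j(x^\mu)}{1-x^{2\alpha_j^\vee}} .$$ (3) (Type $\mathrm C_r$, $r\ge1$.) Suppose that $E$ has an orthonormal basis $\epsilon_1,\dots,\epsilon_r$ with $\Phi_0=\{\pm(\epsilon_i\pm\epsilon_j)\}_{i<j}\cup\{\pm2\epsilon_i\}$, $\alpha_i=\epsilon_i-\epsilon_{i+1}$ ($i<r$) and $\alpha_r=2\epsilon_r$, so that $Q^\vee=\mathbb Z^r$. Write $q^{1/2}=q_\varphi$, $q=q_\varphi^2$, $x_i=x^{\epsilon_i}$, and let $k_0,u_0,k,k_r,u_r\in\mathbf F^\times$ be arbitrary. Sahi's five-parameter double affine Hecke algebra of type $\mathrm C^\vee\mathrm C_r$ is the algebra with generators $T_0,\dots,T_r$, $x^\mu$ ($\mu\in\mathbb Z^r$) and relations: $T_iT_{i+1}T_i=T_{i+1}T_iT_{i+1}$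 ($1\le i<r-1$); $T_0T_1T_0T_1=T_1T_0T_1T_0$ and $T_{r-1}T_rT_{r-1}T_r=T_rT_{r-1}T_rT_{r-1}$ if $r\ge2$; $T_iT_j=T_jT_i$ if $|i-j|>1$; $(T_j-\kappa_j)(T_j+\kappa_j^{-1})=0$; $x^\mu x^\nu=x^{\mu+\nu}$, $x^0=1$; and $$T_jx^\mu-s_j(x^\mu)T_j=\bigl(\kappa_j-\kappa_j^{-1}+(\upsilon_j-\upsilon_j^{-1})z_j\bigr)\frac{x^\mu-s_j(x^\mu)}{1-z_j^2}.$$ Here $(\kappa_0,\upsilon_0)=(k_0,u_0)$, $(\kappa_r,\upsilon_r)=(k_r,u_r)$, $\kappa_i=\upsilon_i=k$ for $1\le i<r$; $z_0=q^{1/2}x_1^{-1}$, $z_i=x_i/x_{i+1}$ ($1\le i<r$), $z_r=x_r$; $s_0(x^\mu)=q^{\mu_1}x^{s_{\epsilon_1}\mu}$ and $s_j(x^\mu)=x^{s_j\mu}$ for $j\ge1$, with $s_i$ ($1\le i<r$) swapping the $i$-th and $(i+1)$-st coordinates, $s_r$ negating the last one and $s_{\epsilon_1}$ the first one. For every $W$-orbit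 $\mathcal O$ and $t\in\mathbf T_{\mathcal O}$ there is a unique representation of this algebra on $\mathbf F[\mathcal O]$ in which $x^\mu$ acts by $x^y\mapsto x^{y+\mu}$ and \begin{align*} T_0x^y&=k_0^{\chi_e(2y_1)}u_0^{\chi_o(2y_1)}(\mathbf g_yt)^{\epsilon_1}x^{s_{\epsilon_1}y}+(k_0-k_0^{-1})\Bigl(\tfrac{1-(q^{-1/2}x_1)^{\lfloor-2y_1\rfloor_e}}{1-qx_1^{-2}}\Bigr)x^y+(u_0-u_0^{-1})\Bigl(\tfrac{q^{1/2}x_1^{-1}-(q^{-1/2}x_1)^{\lfloor-2y_1\rfloor_o}}{1-qx_1^{-2}}\Bigr)x^y,\\ T_ix^y&=k^{\chi_{\mathbb Z}(y_i-y_{i+1})}x^{s_iy}+(k-k^{-1})\Bigl(\tfrac{1-(x_{i+1}/x_i)^{\lfloor y_i-y_{i+1}\rfloor}}{1-x_i/x_{i+1}}\Bigr)x^y\qquad(1\le i<r),\\ T_rx^y&=k_r^{\chi_e(2y_r)}u_r^{\chi_o(2y_r)}x^{s_ry}+(k_r-k_r^{-1})\Bigl(\tfrac{1-x_r^{-\lfloor2y_r\rfloor_e}}{1-x_r^2}\Bigr)x^y+(u_r-u_r^{-1})\Bigl(\tfrac{x_r-x_r^{-\lfloor2y_r\rfloor_o}}{1-x_r^2}\Bigr)x^y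 . \end{align*} For $\mathcal O=Q^\vee=\mathbb Z^r$ and $t=1$ it is the Noumi–Sahi polynomial representation on the Laurent polynomials: $x^\nu$ acts by multiplication and $T_jx^\mu=\kappa_js_j(x^\mu)+\bigl(\kappa_j-\kappa_j^{-1}+(\upsilon_j-\upsilon_j^{-1})z_j\bigr)\dfrac{x^\mu-s_j(x^\mu)}{1-z_j^2}$ for $0\le j\le r$, $\mu\in\mathbb Z^r$. -/

import Mathlib

open scoped RealInnerProductSpace

noncomputable section

namespace QuasiPoly

/-! ## Group algebras, quotients, truncation -/

/-- The quotient `a / d` in a commutative ring: the (unique, when `d` is a non zero divisor)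
element `p` with `d * p = a`. It is only used for divisible pairs in group algebras that are
integral domains; otherwise it has the default value `0`. -/
def exactQuot {A : Type*} [CommRing A] (a d : A) : A :=
  open scoped Classical in if h : ∃ p, d * p = a then h.choose else 0

/-- The (quasi-)monomial `x^y` in the group algebra `F[E]`. -/
def mon (F : Type*) {E : Type*} [Field F] (y : E) : AddMonoidAlgebra F E :=
  AddMonoidAlgebra.single y 1

/-- The subspace `F[Z] = ⨁_{y ∈ Z} F x^y` of `F[E]`. -/
def quasiPol (F : Type*) {E : Type*} [Field F] (Z : Set E) : Submodule F (AddMonoidAlgebra F E) :=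
  Submodule.span F (mon F '' Z)

/-- The basis vector `x^y`, `y ∈ Z`, of `F[Z]`. -/
def qmon (F : Type*) {E : Type*} [Field F] {Z : Set E} (y : E) (hy : y ∈ Z) : quasiPol F Z :=
  ⟨mon F y, Submodule.subset_span (Set.mem_image_of_mem _ hy)⟩

/-- The largest even integer `≤ s`. -/
def floorE (s : ℝ) : ℤ := 2 * ⌊s / 2⌋

/-- The largest odd integer `≤ s`. -/
def floorO (s : ℝ) : ℤ := 2 * ⌊(s + 1) / 2⌋ - 1

/-- Indicator function of the even integers in `ℝ`. -/
def chiE (s : ℝ) : ℕ := open scoped Classical in if ∃ n : ℤ, s = 2 * n then 1 else 0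

/-- Indicator function of the odd integers in `ℝ`. -/
def chiO (s : ℝ) : ℕ := open scoped Classical in if ∃ n : ℤ, s = 2 * n + 1 then 1 else 0

/-- Indicator function of the integers in `ℝ`. -/
def chiZ (s : ℝ) : ℕ := open scoped Classical in if ∃ n : ℤ, s = n then 1 else 0

/-- The alternating product `a * b * a * ⋯` with `m` factors. -/
def altProd {A : Type*} [Monoid A] (a b : A) : ℕ → A
  | 0 => 1
  | m + 1 => a * altProd b a m

/-! ## Finite and affine root systems -/

/-- An irreducible reduced (crystallographic) root system `Φ₀` in a Euclidean space, together with
a base `Δ₀`. The dual `E*` is identified with `E` through the inner product, so that a root `α` is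
the functional `y ↦ ⟪α, y⟫` and its coroot is `α^∨ = 2 α / ‖α‖²`; `highest` is the highest root
with respect to the base. -/
structure EuclideanRoots (ι E : Type*) [NormedAddCommGroup E] [InnerProductSpace ℝ E] where
  P : RootPairing ι ℝ E E
  isRootSystem : P.IsRootSystem
  isCrystallographic : P.IsCrystallographic
  isReduced : P.IsReduced
  isIrreducible : P.IsIrreducible
  toLinearMap_apply : ∀ x y, P.toLinearMap x y = ⟪x, y⟫
  coroot_eq : ∀ i, P.coroot i = (2 / ‖P.root i‖ ^ 2) • P.root i
  base : P.Base
  highest : ι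
  highest_sub_mem : ∀ i, P.root highest - P.root i ∈
    AddSubmonoid.closure (P.root '' (base.support : Set ι))

/-- The value at `y` of the affine linear functional `(v, ξ) ∈ E × ℝ ≃ E* × ℝ`. -/
def ev {E : Type*} [NormedAddCommGroup E] [InnerProductSpace ℝ E] (a : E × ℝ) (y : E) : ℝ :=
  ⟪a.1, y⟫ + a.2

namespace EuclideanRoots

variable {ι E : Type*} [NormedAddCommGroup E] [InnerProductSpace ℝ E] (R : EuclideanRoots ι E)

/-- The orthogonal reflection `s_a`, `a = (α_i, m)`, in the affine hyperplane `a⁻¹(0)`,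
see `refl_apply`. -/
def refl (i : ι) (m : ℤ) : E ≃ᵃ[ℝ] E :=
  (R.P.coreflection i).toAffineEquiv.trans
    (AffineEquiv.constVAdd ℝ E (-((m : ℝ) • R.P.coroot i)))

theorem refl_apply (i : ι) (m : ℤ) (y : E) :
    R.refl i m y = y - ev (R.P.root i, (m : ℝ)) y • R.P.coroot i := by
  simp only [refl, AffineEquiv.trans_apply, LinearEquiv.coe_toAffineEquiv,
    AffineEquiv.constVAdd_apply, RootPairing.coreflection_apply, R.toLinearMap_apply, ev,
    vadd_eq_add]
  module

/-- The affine Weyl group, generated by all the reflections `s_a`, `a ∈ Φ₀ × ℤ`. -/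
def W : Subgroup (E ≃ᵃ[ℝ] E) :=
  Subgroup.closure (Set.range fun p : ι × ℤ => R.refl p.1 p.2)

/-- The coroot lattice `Q^∨`. -/
def Qv : AddSubgroup E := AddSubgroup.closure (Set.range R.P.coroot)

theorem coroot_mem (i : ι) : R.P.coroot i ∈ R.Qv :=
  AddSubgroup.subset_closure (Set.mem_range_self i)

theorem coreflection_mem (i : ι) {v : E} (hv : v ∈ R.Qv) : R.P.coreflection i v ∈ R.Qv := by
  induction hv using AddSubgroup.closure_induction with
  | mem x hx =>
    obtain ⟨j, rfl⟩ := hx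
    rw [← RootPairing.coroot_reflectionPerm]
    exact R.coroot_mem _
  | zero => simp
  | add x y _ _ hx hy => rw [map_add]; exact R.Qv.add_mem hx hy
  | neg x _ hx => rw [map_neg]; exact R.Qv.neg_mem hx

theorem linear_mem_and_apply_zero_mem {g : E ≃ᵃ[ℝ] E} (hg : g ∈ R.W) :
    (∀ v ∈ R.Qv, g.linear v ∈ R.Qv) ∧ g 0 ∈ R.Qv := by
  induction hg using Subgroup.closure_induction_left with
  | one => exact ⟨fun v hv => hv, R.Qv.zero_mem⟩
  | mul_left x hx y _ ih =>
    obtain ⟨⟨i, m⟩, rfl⟩ := hx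
    refine ⟨fun v hv => R.coreflection_mem i (ih.1 v hv), ?_⟩
    have h : (R.refl i m * y) 0 = -((m : ℝ) • R.P.coroot i) + R.P.coreflection i (y 0) := rfl
    rw [h, Int.cast_smul_eq_zsmul]
    exact R.Qv.add_mem (R.Qv.neg_mem (R.Qv.zsmul_mem (R.coroot_mem i) m))
      (R.coreflection_mem i ih.2)
  | inv_mul_cancel x hx y _ ih =>
    obtain ⟨⟨i, m⟩, rfl⟩ := hx
    have hi : (R.refl i m)⁻¹ = R.refl i m := by
      rw [inv_eq_iff_mul_eq_one]
      ext z
      have h : (R.refl i m * R.refl i m) z = R.refl i m (R.refl i m z) := rfl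
      have h2 : ⟪R.P.root i, R.P.coroot i⟫ = (2 : ℝ) := by
        rw [← R.toLinearMap_apply, R.P.root_coroot_two]
      rw [h]
      simp only [refl_apply, ev, inner_sub_right, inner_smul_right, h2]
      change _ = z
      module
    rw [hi]
    refine ⟨fun v hv => R.coreflection_mem i (ih.1 v hv), ?_⟩
    have h : (R.refl i m * y) 0 = -((m : ℝ) • R.P.coroot i) + R.P.coreflection i (y 0) := rfl
    rw [h, Int.cast_smul_eq_zsmul]
    exact R.Qv.add_mem (R.Qv.neg_mem (R.Qv.zsmul_mem (R.coroot_mem i) m))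
      (R.coreflection_mem i ih.2)

/-- The linear part `w ∈ W₀` of `g = τ(λ) w ∈ W`, acting on `Q^∨`. -/
def lin (g : R.W) (μ : R.Qv) : R.Qv :=
  ⟨g.1.linear μ, (R.linear_mem_and_apply_zero_mem g.2).1 _ μ.2⟩

/-- The translation part `λ = g(0) ∈ Q^∨` of `g = τ(λ) w ∈ W`. -/
def trl (g : R.W) : R.Qv := ⟨g.1 0, (R.linear_mem_and_apply_zero_mem g.2).2⟩

/-- Index set `{0, 1, …, r}` of the affine simple roots; `none` plays the role of `0`. -/
abbrev Node : Type _ := Option R.base.support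

/-- The gradients of the affine simple roots `α_0 = (-φ, 1)` and `α_i = (α_i, 0)`. -/
def grad : R.Node → E
  | none => -R.P.root R.highest
  | some i => R.P.root i

/-- The constant terms of the affine simple roots. -/
def cst : R.Node → ℤ
  | none => 1
  | some _ => 0

/-- The affine simple roots. -/
def simpleRoot (j : R.Node) : E × ℝ := (R.grad j, R.cst j)

/-- The coroots of the gradients of the affine simple roots. -/
def cograd : R.Node → R.Qv
  | none => -⟨R.P.coroot R.highest, R.coroot_mem _⟩
  | some i => ⟨R.P.coroot i, R.coroot_mem _⟩

/-- The simple reflections; note that `s_0 = s_{(-φ, 1)} = s_{(φ, -1)}`. -/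
def s : R.Node → R.W
  | none => ⟨R.refl R.highest (-1), Subgroup.subset_closure ⟨(R.highest, -1), rfl⟩⟩
  | some i => ⟨R.refl i 0, Subgroup.subset_closure ⟨(i.1, 0), rfl⟩⟩

/-- The closure of the fundamental alcove. -/
def alcove : Set E := {y | ∀ j, 0 ≤ ev (R.simpleRoot j) y}

/-- The `W`-orbits in `E`. -/
def IsOrbit (O : Set E) : Prop := ∃ y : E, O = Set.range fun g : R.W => g.1 y

/-- The length of `g ∈ W` with respect to the simple reflections. -/
def length (g : R.W) : ℕ :=
  sInf {n | ∃ l : List R.Node, l.length = n ∧ (l.map R.s).prod = g}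

/-- `g` is an element of shortest length in `W` such that `g⁻¹ y` lies in the closed alcove. -/
def IsMinRep (y : E) (g : R.W) : Prop :=
  g⁻¹.1 y ∈ R.alcove ∧ ∀ h : R.W, h⁻¹.1 y ∈ R.alcove → R.length g ≤ R.length h

/-- The element `𝐠_y` of shortest length in `W` such that `𝐠_y⁻¹ y` lies in the closed alcove. -/
def gmin (y : E) : R.W := Classical.epsilon (R.IsMinRep y)

/-! ### Multiplicity functions -/

/-- `α_i(Q^∨) = 2ℤ`. -/
def EvenOnQv (i : ι) : Prop :=
  (fun v : E => (⟪R.P.root i, v⟫ : ℝ)) '' R.Qv = Set.range fun m : ℤ => (2 * m : ℝ)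

/-- The reduced affine root system `Φ = Φ₀ × ℤ`. -/
def affRoots : Set (E × ℝ) := {a | ∃ (i : ι) (m : ℤ), a = (R.P.root i, (m : ℝ))}

/-- The nonreduced extension `Φ^nr` of `Φ`: add `a / 2` for the `a ∈ Φ` whose gradient takes
exactly the even integers as its values on `Q^∨`. -/
def affRootsNr : Set (E × ℝ) :=
  R.affRoots ∪ {a | ∃ (i : ι) (m : ℤ), R.EvenOnQv i ∧
    a = ((1 / 2 : ℝ) • (R.P.root i, (m : ℝ)))}

/-- Multiplicity functions: the `W`-invariant functions `Φ^nr → Fˣ`, for the contragredient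
action `(g a)(y) = a(g⁻¹ y)` of `W` on affine linear functionals. -/
structure Multiplicity (F : Type*) [Field F] where
  toFun : R.affRootsNr → Fˣ
  invariant : ∀ (g : R.W) (a b : R.affRootsNr),
    (∀ y, ev b.1 (g.1 y) = ev a.1 y) → toFun a = toFun b

theorem simpleRoot_mem (j : R.Node) : R.simpleRoot j ∈ R.affRoots := by
  cases j with
  | none =>
    refine ⟨R.P.reflectionPerm R.highest R.highest, 1, ?_⟩
    simp [simpleRoot, grad, cst]
  | some i => exact ⟨i, 0, rfl⟩

variable {F : Type*} [Field F]

/-- `k_j`, the value of the multiplicity function at `α_j`. -/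
def kap (k : R.Multiplicity F) (j : R.Node) : Fˣ :=
  k.toFun ⟨R.simpleRoot j, Or.inl (R.simpleRoot_mem j)⟩

/-- `u_j`, the value of the (extended) multiplicity function at `α_j / 2`; by convention it is the
value at `α_j` if `α_j / 2` is not in `Φ^nr`. -/
def ups (k : R.Multiplicity F) (j : R.Node) : Fˣ :=
  open scoped Classical in
  if h : (1 / 2 : ℝ) • R.simpleRoot j ∈ R.affRootsNr then k.toFun ⟨_, h⟩ else R.kap k j

/-! ### The torus and the `W`-actions -/

/-- `q^m := q_φ^(m ‖φ‖² / 2)`. The exponent is an integer for every `m` in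
`⟨Q^∨, Q^∨⟩ ⊆ (2 / ‖φ‖²) ℤ`, and only such `m` are used. -/
def qpow (q : Fˣ) (m : ℝ) : Fˣ := q ^ ⌊m * ‖R.P.root R.highest‖ ^ 2 / 2⌋

/-- The torus `𝐓 = Hom(Q^∨, Fˣ)`. -/
abbrev Torus (F : Type*) [Field F] : Type _ := Multiplicative R.Qv →* Fˣ

/-- The value `(g t)^μ` of the `W`-action on `𝐓`: for `g = τ(λ) w` it is
`q^⟨λ, μ⟩ t^(w⁻¹ μ)`. -/
def torusAct (q : Fˣ) (g : R.W) (t : R.Torus F) (μ : R.Qv) : Fˣ :=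
  R.qpow q ⟪g.1 0, (μ : E)⟫ * t (Multiplicative.ofAdd (R.lin g⁻¹ μ))

/-- The affine subtorus `𝐓_O`: the `t` with `t^(α_j^∨) = 1` whenever `α_j` vanishes at the point
`c` of `O` in the closed alcove. Here `t^(α_0^∨) = q_φ t^(-φ^∨)`. -/
def torusOf (q : Fˣ) (O : Set E) : Set (R.Torus F) :=
  {t | ∀ c ∈ O ∩ R.alcove, ∀ j, ev (R.simpleRoot j) c = 0 →
    q ^ R.cst j * t (Multiplicative.ofAdd (R.cograd j)) = 1}

/-- The `W`-action on `F[Q^∨]` by reflections and `q`-dilations: for `g = τ(λ) w` one has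
`g(x^μ) = q^(-⟨w μ, λ⟩) x^(w μ)`. -/
def wAct (q : Fˣ) (g : R.W) (μ : R.Qv) : AddMonoidAlgebra F R.Qv :=
  AddMonoidAlgebra.single (R.lin g μ) (R.qpow q (-⟪(R.lin g μ : E), g.1 0⟫) : F)

/-- The `t`-twisted action of `g = τ(λ) w ∈ W` on quasi-monomials, which is determined by
`w_t x^y = x^(w y)` and `τ(λ)_t x^y = (𝐠_y t)^(-λ) x^y`. -/
def twAct (q : Fˣ) (t : R.Torus F) (g : R.W) (y : E) : AddMonoidAlgebra F E :=
  AddMonoidAlgebra.single (g.1.linear y)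
    (R.torusAct q (R.gmin (g.1.linear y)) t (-R.trl g) : F)

/-! ### The double affine Hecke algebra -/

/-- The monomial `x^(α_j^∨)` in `F[Q^∨]`; for `j = 0` it is `q_φ x^(-φ^∨)`. -/
def xSimple (q : Fˣ) (j : R.Node) : AddMonoidAlgebra F R.Qv :=
  AddMonoidAlgebra.single (R.cograd j) (q ^ R.cst j : Fˣ)

/-- The element
`(k_j - k_j⁻¹ + (u_j - u_j⁻¹) x^(α_j^∨)) (x^μ - s_j(x^μ)) / (1 - x^(2 α_j^∨))` of `F[Q^∨]`. -/
def crossTerm (q : Fˣ) (k : R.Multiplicity F) (j : R.Node) (μ : R.Qv) :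
    AddMonoidAlgebra F R.Qv :=
  exactQuot
    ((algebraMap F _ (R.kap k j - (R.kap k j)⁻¹)
        + algebraMap F _ (R.ups k j - (R.ups k j)⁻¹) * R.xSimple q j)
      * (mon F μ - R.wAct q (R.s j) μ))
    (1 - R.xSimple q j ^ 2)

/-- The generators of the double affine Hecke algebra. -/
inductive Gen (R : EuclideanRoots ι E)
  | T (j : R.Node)
  | X (μ : R.Qv)

/-- The free algebra element `∑ d_μ x^μ` attached to `∑ d_μ x^μ ∈ F[Q^∨]`. -/
def toFree (p : AddMonoidAlgebra F R.Qv) : FreeAlgebra F R.Gen :=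
  p.coeff.sum fun μ d => d • FreeAlgebra.ι F (Gen.X μ)

/-- The defining relations of the double affine Hecke algebra. The braid relation for `i ≠ j` has
`m_{ij}` factors on both sides, `m_{ij}` the order of `s_i s_j` in `W`; there is no relation if the
order is infinite (`orderOf` is `0` then). -/
inductive Rel (q : Fˣ) (k : R.Multiplicity F) : FreeAlgebra F R.Gen → FreeAlgebra F R.Gen → Prop
  | braid (i j : R.Node) (hij : i ≠ j) :
      Rel q k
        (altProd (FreeAlgebra.ι F (Gen.T i)) (FreeAlgebra.ι F (Gen.T j))
          (orderOf (R.s i * R.s j)))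
        (altProd (FreeAlgebra.ι F (Gen.T j)) (FreeAlgebra.ι F (Gen.T i))
          (orderOf (R.s i * R.s j)))
  | quadratic (j : R.Node) :
      Rel q k
        ((FreeAlgebra.ι F (Gen.T j) - algebraMap F _ (R.kap k j))
          * (FreeAlgebra.ι F (Gen.T j) + algebraMap F _ (R.kap k j)⁻¹)) 0
  | X_add (μ ν : R.Qv) :
      Rel q k (FreeAlgebra.ι F (Gen.X μ) * FreeAlgebra.ι F (Gen.X ν))
        (FreeAlgebra.ι F (Gen.X (μ + ν)))
  | X_zero : Rel q k (FreeAlgebra.ι F (Gen.X 0)) 1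
  | cross (j : R.Node) (μ : R.Qv) :
      Rel q k
        (FreeAlgebra.ι F (Gen.T j) * FreeAlgebra.ι F (Gen.X μ)
          - R.toFree (R.wAct q (R.s j) μ) * FreeAlgebra.ι F (Gen.T j))
        (R.toFree (R.crossTerm q k j μ))

/-- The double affine Hecke algebra `ℍ(k; q_φ)`. -/
abbrev DAHA (q : Fˣ) (k : R.Multiplicity F) : Type _ := RingQuot (R.Rel q k)

/-- The generator `T_j` of the double affine Hecke algebra. -/
def T (q : Fˣ) (k : R.Multiplicity F) (j : R.Node) : R.DAHA q k :=
  RingQuot.mkAlgHom F (R.Rel q k) (FreeAlgebra.ι F (Gen.T j))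

/-- The generator `x^μ` of the double affine Hecke algebra. -/
def X (q : Fˣ) (k : R.Multiplicity F) (μ : R.Qv) : R.DAHA q k :=
  RingQuot.mkAlgHom F (R.Rel q k) (FreeAlgebra.ι F (Gen.X μ))

/-- The subalgebra `H^X` of the double affine Hecke algebra, generated by the `x^μ` and by the
`T_i` with `1 ≤ i ≤ r`. -/
def HX (q : Fˣ) (k : R.Multiplicity F) : Subalgebra F (R.DAHA q k) :=
  Algebra.adjoin F (Set.range (R.X q k) ∪ Set.range fun i : R.base.support => R.T q k (some i))

theorem X_mem_HX (q : Fˣ) (k : R.Multiplicity F) (μ : R.Qv) : R.X q k μ ∈ R.HX q k :=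
  Algebra.subset_adjoin (Or.inl ⟨μ, rfl⟩)

theorem T_mem_HX (q : Fˣ) (k : R.Multiplicity F) (i : R.base.support) :
    R.T q k (some i) ∈ R.HX q k :=
  Algebra.subset_adjoin (Or.inr ⟨i, rfl⟩)

/-! ### Truncated divided difference operators and the quasi-polynomial representations -/

/-- The monomial `x^(m α_j^∨) = (x^(α_j^∨))^m`, `m ∈ ℤ`, as an element of `F[E]`. -/
def xPow (q : Fˣ) (j : R.Node) (m : ℤ) : AddMonoidAlgebra F E :=
  AddMonoidAlgebra.single (m • (R.cograd j : E)) ((q ^ R.cst j) ^ m : Fˣ)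

/-- The even truncated divided difference operator:
`∇_j^e(x^y) = (1 - x^(-⌊α_j(y)⌋_e α_j^∨)) / (1 - x^(2 α_j^∨)) x^y`, where `α_j` stands for its
gradient in `α_j(y)`. -/
def nablaE (q : Fˣ) (j : R.Node) (y : E) : AddMonoidAlgebra F E :=
  exactQuot (1 - R.xPow q j (-floorE ⟪R.grad j, y⟫)) (1 - R.xPow q j 2) * mon F y

/-- The odd truncated divided difference operator:
`∇_j^o(x^y) = (x^(α_j^∨) - x^(-⌊α_j(y)⌋_o α_j^∨)) / (1 - x^(2 α_j^∨)) x^y`. -/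
def nablaO (q : Fˣ) (j : R.Node) (y : E) : AddMonoidAlgebra F E :=
  exactQuot (R.xPow q j 1 - R.xPow q j (-floorO ⟪R.grad j, y⟫)) (1 - R.xPow q j 2) * mon F y

/-- A truncated Demazure--Lusztig expression with a prescribed leading part: it is
`k_j^(χ_e(α_j(y))) u_j^(χ_o(α_j(y))) lead + (k_j - k_j⁻¹) ∇_j^e(x^y) + (u_j - u_j⁻¹) ∇_j^o(x^y)`. -/
def truncDL (q : Fˣ) (k : R.Multiplicity F) (j : R.Node) (y : E) (lead : AddMonoidAlgebra F E) :
    AddMonoidAlgebra F E :=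
  ((R.kap k j : F) ^ chiE ⟪R.grad j, y⟫ * (R.ups k j : F) ^ chiO ⟪R.grad j, y⟫) • lead
    + ((R.kap k j : F) - (R.kap k j : F)⁻¹) • R.nablaE q j y
    + ((R.ups k j : F) - (R.ups k j : F)⁻¹) • R.nablaO q j y

/-- `π` is the action of `H^X` on `F[O]`: `x^μ` acts by multiplication, and `T_i`, `1 ≤ i ≤ r`, by
the truncated Demazure--Lusztig operator with leading term `x^(s_i y)`. -/
def IsHXRep (q : Fˣ) (k : R.Multiplicity F) (O : Set E)
    (π : R.HX q k →ₐ[F] Module.End F (quasiPol F O)) : Prop :=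
  (∀ (μ : R.Qv) (y : E) (hy : y ∈ O),
    (π ⟨R.X q k μ, R.X_mem_HX q k μ⟩ (qmon F y hy) : AddMonoidAlgebra F E)
      = mon F (y + (μ : E))) ∧
  (∀ (i : R.base.support) (y : E) (hy : y ∈ O),
    (π ⟨R.T q k (some i), R.T_mem_HX q k i⟩ (qmon F y hy) : AddMonoidAlgebra F E)
      = R.truncDL q k (some i) y (mon F ((R.s (some i)).1 y)))

/-- `ρ` is the quasi-polynomial representation `π_t^O`: `x^μ` acts by multiplication, and `T_j`,
`0 ≤ j ≤ r`, by the truncated Demazure--Lusztig operator with leading term `s_{j,t} x^y`. -/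
def IsQuasiPolRep (q : Fˣ) (k : R.Multiplicity F) (O : Set E) (t : R.Torus F)
    (ρ : R.DAHA q k →ₐ[F] Module.End F (quasiPol F O)) : Prop :=
  (∀ (μ : R.Qv) (y : E) (hy : y ∈ O),
    (ρ (R.X q k μ) (qmon F y hy) : AddMonoidAlgebra F E) = mon F (y + (μ : E))) ∧
  (∀ (j : R.Node) (y : E) (hy : y ∈ O),
    (ρ (R.T q k j) (qmon F y hy) : AddMonoidAlgebra F E)
      = R.truncDL q k j y (R.twAct q t (R.s j) y))

/-- The inclusion of `F[Q^∨]` in `F[E]`. -/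
def incl : AddMonoidAlgebra F R.Qv → AddMonoidAlgebra F E :=
  AddMonoidAlgebra.mapDomain fun μ => (μ : E)

/-- `ρ` is the basic (polynomial) representation on `F[Q^∨]`, given by the Demazure--Lusztig
operators `T_j x^μ = k_j s_j(x^μ)
+ (k_j - k_j⁻¹ + (u_j - u_j⁻¹) x^(α_j^∨)) (x^μ - s_j(x^μ)) / (1 - x^(2 α_j^∨))`. -/
def IsPolRep (q : Fˣ) (k : R.Multiplicity F)
    (ρ : R.DAHA q k →ₐ[F] Module.End F (quasiPol F (R.Qv : Set E))) : Prop :=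
  (∀ μ ν : R.Qv,
    (ρ (R.X q k μ) (qmon F (ν : E) ν.2) : AddMonoidAlgebra F E) = R.incl (mon F (ν + μ))) ∧
  (∀ (j : R.Node) (μ : R.Qv),
    (ρ (R.T q k j) (qmon F (μ : E) μ.2) : AddMonoidAlgebra F E)
      = R.incl ((R.kap k j : F) • R.wAct q (R.s j) μ + R.crossTerm q k j μ))

/-! ### The quotients in the definitions are genuine quotients -/

theorem exactQuot_spec {A : Type*} [CommRing A] {a d : A} (h : d ∣ a) : d * exactQuot a d = a := by
  have h' : ∃ p, d * p = a := by obtain ⟨p, hp⟩ := h; exact ⟨p, hp.symm⟩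
  simp only [exactQuot, dif_pos h', h'.choose_spec]

theorem one_sub_dvd {A : Type*} [CommRing A] (f : ℤ → A) (h0 : f 0 = 1)
    (hadd : ∀ a b, f (a + b) = f a * f b) (d n : ℤ) : 1 - f d ∣ 1 - f (d * n) := by
  induction n using Int.induction_on with
  | zero => simp [h0]
  | succ i ih =>
    have : 1 - f (d * (i + 1)) = (1 - f (d * i)) + f (d * i) * (1 - f d) := by
      rw [mul_add, mul_one, hadd]; ring
    rw [this]; exact dvd_add ih (dvd_mul_left _ _)
  | pred i ih =>
    have h : f (d * (-i)) = f (d * (-i - 1)) * f d := by rw [← hadd]; congr 1; ring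
    have : 1 - f (d * (-i - 1)) = (1 - f (d * (-i))) - f (d * (-i - 1)) * (1 - f d) := by
      rw [h]; ring
    rw [this]; exact dvd_sub ih (dvd_mul_left _ _)
theorem xPow_zero (q : Fˣ) (j : R.Node) : R.xPow q j 0 = 1 := by
  simp [xPow, AddMonoidAlgebra.one_def]

theorem xPow_add (q : Fˣ) (j : R.Node) (a b : ℤ) :
    R.xPow q j (a + b) = R.xPow q j a * R.xPow q j b := by
  simp only [xPow, AddMonoidAlgebra.single_mul_single, add_smul, zpow_add, Units.val_mul]

theorem nablaE_spec (q : Fˣ) (j : R.Node) (y : E) :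
    (1 - R.xPow q j 2) * R.nablaE q j y
      = (1 - R.xPow q j (-floorE ⟪R.grad j, y⟫)) * mon F y := by
  rw [nablaE, ← mul_assoc, exactQuot_spec]
  have := one_sub_dvd (R.xPow q j) (R.xPow_zero q j) (R.xPow_add q j) 2 (-⌊⟪R.grad j, y⟫ / 2⌋)
  rwa [mul_neg] at this

theorem nablaO_spec (q : Fˣ) (j : R.Node) (y : E) :
    (1 - R.xPow q j 2) * R.nablaO q j y
      = (R.xPow q j 1 - R.xPow q j (-floorO ⟪R.grad j, y⟫)) * mon F y := by
  rw [nablaO, ← mul_assoc, exactQuot_spec]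
  have := one_sub_dvd (R.xPow q j) (R.xPow_zero q j) (R.xPow_add q j) 2
    (-⌊(⟪R.grad j, y⟫ + 1) / 2⌋)
  have h : R.xPow q j 1 - R.xPow q j (-floorO ⟪R.grad j, y⟫)
      = R.xPow q j 1 * (1 - R.xPow q j (2 * -⌊(⟪R.grad j, y⟫ + 1) / 2⌋)) := by
    rw [mul_sub, mul_one, ← xPow_add, floorO]
    congr 2; ring
  rw [h]
  exact dvd_mul_of_dvd_right this _

theorem grad_int (j : R.Node) (μ : R.Qv) : ∃ m : ℤ, (⟪R.grad j, (μ : E)⟫ : ℝ) = m := by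
  have key : ∀ i, ∀ v ∈ R.Qv, ∃ m : ℤ, (⟪R.P.root i, v⟫ : ℝ) = m := by
    intro i v hv
    induction hv using AddSubgroup.closure_induction with
    | mem x hx =>
      obtain ⟨a, rfl⟩ := hx
      have := R.isCrystallographic
      obtain ⟨z, hz⟩ := R.P.exists_value (S := ℤ) i a
      exact ⟨z, by rw [← R.toLinearMap_apply]; exact hz.symm⟩
    | zero => exact ⟨0, by simp⟩
    | add x y _ _ hx hy =>
      obtain ⟨a, ha⟩ := hx; obtain ⟨b, hb⟩ := hy
      exact ⟨a + b, by rw [inner_add_right, ha, hb]; push_cast; ring⟩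
    | neg x _ hx =>
      obtain ⟨a, ha⟩ := hx
      exact ⟨-a, by rw [inner_neg_right, ha]; push_cast; ring⟩
  cases j with
  | none =>
    obtain ⟨m, hm⟩ := key R.highest μ μ.2
    exact ⟨-m, by rw [grad, inner_neg_left, hm]; push_cast; ring⟩
  | some i => exact key i μ μ.2

/-- `s_j(x^μ) = x^(μ - m α_j^∨)`, with `m` the value of the gradient of `α_j` at `μ`. -/
theorem wAct_simple (q : Fˣ) (j : R.Node) (μ : R.Qv) (m : ℤ)
    (hm : (⟪R.grad j, (μ : E)⟫ : ℝ) = m) :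
    R.wAct q (R.s j) μ = AddMonoidAlgebra.single (μ - m • R.cograd j)
      (((q ^ R.cst j) ^ (-m) : Fˣ) : F) := by
  have hlin : (R.lin (R.s j) μ) = μ - m • R.cograd j := by
    ext
    cases j with
    | none =>
      change R.P.coreflection R.highest μ = _
      rw [RootPairing.coreflection_apply]
      have h1 : (⟪R.P.root R.highest, (μ : E)⟫ : ℝ) = -m := by
        rw [← hm, grad, inner_neg_left, neg_neg]
      simp only [RootPairing.root', R.toLinearMap_apply, h1, cograd, AddSubgroup.coe_sub,
        AddSubgroup.coe_zsmul, AddSubgroup.coe_neg]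
      rw [← Int.cast_smul_eq_zsmul ℝ]
      module
    | some i =>
      change R.P.coreflection i.1 μ = _
      rw [RootPairing.coreflection_apply]
      have h1 : (⟪R.P.root i, (μ : E)⟫ : ℝ) = m := hm
      simp only [RootPairing.root', R.toLinearMap_apply, h1, cograd, AddSubgroup.coe_sub,
        AddSubgroup.coe_zsmul]
      rw [← Int.cast_smul_eq_zsmul ℝ]
  have hq : R.qpow q (-⟪(R.lin (R.s j) μ : E), (R.s j).1 0⟫) = (q ^ R.cst j) ^ (-m) := by
    rw [hlin]
    cases j with
    | none =>
      have h0 : (R.s none).1 0 = R.P.coroot R.highest := by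
        change R.refl R.highest (-1) 0 = _
        rw [refl_apply]; simp [ev]
      have h1 : (⟪(μ : E), R.P.root R.highest⟫ : ℝ) = -m := by
        rw [real_inner_comm, ← hm, grad, inner_neg_left, neg_neg]
      have hne : ‖R.P.root R.highest‖ ≠ 0 := norm_ne_zero_iff.mpr (R.P.ne_zero _)
      have h2 : -(⟪((μ - m • R.cograd none : R.Qv) : E), (R.s none).1 0⟫ : ℝ)
          * ‖R.P.root R.highest‖ ^ 2 / 2 = ((-m : ℤ) : ℝ) := by
        rw [h0]
        simp only [cograd, AddSubgroup.coe_sub, AddSubgroup.coe_zsmul, AddSubgroup.coe_neg,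
          R.coroot_eq]
        rw [← Int.cast_smul_eq_zsmul ℝ]
        simp only [inner_sub_left, inner_smul_left, inner_smul_right, inner_neg_left, h1,
          real_inner_self_eq_norm_sq, RCLike.conj_to_real]
        push_cast
        field_simp
        ring
      rw [qpow, h2, Int.floor_intCast]
      simp [cst]
    | some i =>
      have h0 : (R.s (some i)).1 0 = 0 := by
        change R.refl i 0 0 = _
        rw [refl_apply]; simp [ev]
      rw [h0]; simp [qpow, cst]
  rw [wAct, hq, hlin]

/-- The monomial `x^(m α_j^∨)`, `m ∈ ℤ`, as an element of `F[Q^∨]`. -/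
def xPowQ (q : Fˣ) (j : R.Node) (m : ℤ) : AddMonoidAlgebra F R.Qv :=
  AddMonoidAlgebra.single (m • R.cograd j) ((q ^ R.cst j) ^ m : Fˣ)

theorem xPowQ_zero (q : Fˣ) (j : R.Node) : R.xPowQ q j 0 = 1 := by
  simp [xPowQ, AddMonoidAlgebra.one_def]

theorem xPowQ_one (q : Fˣ) (j : R.Node) : R.xPowQ q j 1 = R.xSimple q j := by
  simp [xPowQ, xSimple]

theorem xPowQ_add (q : Fˣ) (j : R.Node) (a b : ℤ) :
    R.xPowQ q j (a + b) = R.xPowQ q j a * R.xPowQ q j b := by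
  simp only [xPowQ, AddMonoidAlgebra.single_mul_single, add_smul, zpow_add, Units.val_mul]

theorem crossTerm_spec (q : Fˣ) (k : R.Multiplicity F) (j : R.Node) (μ : R.Qv) :
    (1 - R.xSimple q j ^ 2) * R.crossTerm q k j μ =
      (algebraMap F _ (R.kap k j - (R.kap k j)⁻¹)
        + algebraMap F _ (R.ups k j - (R.ups k j)⁻¹) * R.xSimple q j)
      * (mon F μ - R.wAct q (R.s j) μ) := by
  rw [crossTerm, exactQuot_spec]
  obtain ⟨m, hm⟩ := R.grad_int j μ
  have h1 : mon F μ - R.wAct q (R.s j) μ = mon F μ * (1 - R.xPowQ q j (-m)) := by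
    rw [R.wAct_simple q j μ m hm, mul_sub, mul_one, mon, xPowQ, AddMonoidAlgebra.single_mul_single]
    rw [one_mul, neg_smul, sub_eq_add_neg μ]
  have hx2 : R.xSimple q j ^ 2 = R.xPowQ q j 2 := by
    rw [sq, ← xPowQ_one, ← xPowQ_add]; norm_num
  rw [h1]
  by_cases h : (1 / 2 : ℝ) • R.simpleRoot j ∈ R.affRootsNr
  · have hev : ∃ n : ℤ, m = 2 * n := by
      rcases h with ⟨i, l, h⟩ | ⟨i, l, hE, h⟩
      · exfalso
        have := R.isReduced
        have hg : (1/2 : ℝ) • R.grad j = R.P.root i := congrArg Prod.fst h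
        obtain ⟨a, ha⟩ := R.simpleRoot_mem j
        have ha1 : R.grad j = R.P.root a := congrArg Prod.fst ha.choose_spec
        have hh : R.P.root a = (2 : ℝ) • R.P.root i := by rw [← hg, ← ha1, smul_smul]; norm_num
        have hdep : ¬ LinearIndependent ℝ ![R.P.root a, R.P.root i] := by
          intro hl
          have := LinearIndependent.pair_iff.mp hl 1 (-2) (by rw [hh]; module)
          norm_num at this
        have hni := R.P.ne_zero i
        have hne : a ≠ i := by
          rintro rfl
          have : (1 : ℝ) • R.P.root a = 0 := by
            have h3 : (2 : ℝ) • R.P.root a - (1:ℝ) • R.P.root a = (1 : ℝ) • R.P.root a := by module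
            rw [← h3, ← hh]; simp
          exact hni (by simpa using this)
        rcases RootPairing.IsReduced.eq_or_eq_neg (P := R.P) a i hdep with h4 | h4
        · exact hne (R.P.root.injective h4)
        · rw [hh] at h4
          have : (3 : ℝ) • R.P.root i = 0 := by
            have h3 : (3 : ℝ) • R.P.root i = (2 : ℝ) • R.P.root i + R.P.root i := by module
            rw [h3, h4]; simp
          simp [hni] at this
      · have hg : (1/2 : ℝ) • R.grad j = (1/2 : ℝ) • R.P.root i := congrArg Prod.fst h
        have hg' : R.grad j = R.P.root i := smul_right_injective E (by norm_num : (1/2 : ℝ) ≠ 0) hg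
        have : (⟪R.P.root i, (μ : E)⟫ : ℝ) ∈ Set.range fun m : ℤ => (2 * m : ℝ) := by
          rw [← show _ = _ from hE]; exact ⟨μ, μ.2, rfl⟩
        obtain ⟨n, hn⟩ := this
        refine ⟨n, ?_⟩
        rw [← hg', hm] at hn
        have hn' : (2 * n : ℝ) = (m : ℝ) := hn
        exact_mod_cast hn'.symm
    obtain ⟨n, rfl⟩ := hev
    rw [hx2, ← mul_neg]
    exact dvd_mul_of_dvd_right (dvd_mul_of_dvd_right
      (one_sub_dvd (R.xPowQ q j) (R.xPowQ_zero q j) (R.xPowQ_add q j) 2 (-n)) _) _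
  · have hu : R.ups k j = R.kap k j := by rw [ups, dif_neg h]
    rw [hu]
    have h2 := one_sub_dvd (R.xPowQ q j) (R.xPowQ_zero q j) (R.xPowQ_add q j) 1 (-m)
    rw [one_mul, xPowQ_one] at h2
    obtain ⟨c, hc⟩ := h2
    rw [hc]
    exact ⟨algebraMap F _ (R.kap k j - (R.kap k j)⁻¹) * mon F μ * c, by ring⟩

end EuclideanRoots

/-! ## Type `C_r` in coordinates, `r = n + 1 ≥ 1` -/

namespace TypeC

/-- The labels `0`, `1, …, r - 1`, `r` of the affine simple roots of type `C_r`, `r = n + 1`; the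
label `mid i` stands for `i + 1`. -/
inductive Node (n : ℕ)
  | zero
  | mid (i : Fin n)
  | last

/-- The reflections on `n + 1`-tuples: `zero` negates the first entry, `mid i` swaps neighbours and
`last` negates the last entry. -/
def reflTuple {n : ℕ} {M : Type*} [AddCommGroup M] (j : Node n) (v : Fin (n + 1) → M) :
    Fin (n + 1) → M :=
  match j with
  | .zero => Function.update v 0 (-v 0)
  | .mid i => v ∘ Equiv.swap i.castSucc i.succ
  | .last => Function.update v (Fin.last n) (-v (Fin.last n))

variable {E : Type*} [NormedAddCommGroup E] [InnerProductSpace ℝ E] {n : ℕ}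

/-- The simple roots `ε_i - ε_{i+1}`, `1 ≤ i < r`, and `2 ε_r`. -/
def simpleRoots (ε : OrthonormalBasis (Fin (n + 1)) ℝ E) : Set E :=
  {v | (∃ i : Fin n, v = ε i.castSucc - ε i.succ) ∨ v = (2 : ℝ) • ε (Fin.last n)}

/-- The roots `±(ε_i ± ε_j)`, `i < j`, and `±2 ε_i`. -/
def roots (ε : OrthonormalBasis (Fin (n + 1)) ℝ E) : Set E :=
  {v | ∃ i j, i < j ∧ (v = ε i + ε j ∨ v = ε i - ε j ∨ v = -(ε i + ε j) ∨ v = -(ε i - ε j))} ∪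
  {v | ∃ i, v = (2 : ℝ) • ε i ∨ v = -((2 : ℝ) • ε i)}

/-- `R` is the standard realisation of the root system of type `C_r` in the orthonormal
basis `ε`. -/
structure IsRealisation {ι : Type*} (R : EuclideanRoots ι E)
    (ε : OrthonormalBasis (Fin (n + 1)) ℝ E) : Prop where
  roots_eq : Set.range R.P.root = roots ε
  simple_eq : R.P.root '' (R.base.support : Set ι) = simpleRoots ε

theorem IsRealisation.basis_mem {ι : Type*} {R : EuclideanRoots ι E}
    {ε : OrthonormalBasis (Fin (n + 1)) ℝ E} (h : IsRealisation R ε) (i : Fin (n + 1)) :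
    ε i ∈ R.Qv := by
  have h1 : (2 : ℝ) • ε i ∈ Set.range R.P.root := by
    rw [h.roots_eq]
    exact Or.inr ⟨i, Or.inl rfl⟩
  obtain ⟨a, ha⟩ := h1
  have h2 : R.P.coroot a = ε i := by
    rw [R.coroot_eq, ha, norm_smul, ε.norm_eq_one, smul_smul]
    norm_num
  rw [← h2]
  exact R.coroot_mem a

/-- The coordinates `y_i` of `y`. -/
def coord (ε : OrthonormalBasis (Fin (n + 1)) ℝ E) (y : E) (i : Fin (n + 1)) : ℝ := ⟪ε i, y⟫

/-- The vector with the given coordinates. -/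
def vec (ε : OrthonormalBasis (Fin (n + 1)) ℝ E) (v : Fin (n + 1) → ℝ) : E := ∑ i, v i • ε i

/-- The linear reflections `s_{ε_1}`, `s_i`, `s_r` on `E`. -/
def reflVec (ε : OrthonormalBasis (Fin (n + 1)) ℝ E) (j : Node n) (y : E) : E :=
  vec ε (reflTuple j (coord ε y))

variable {F : Type*} [Field F]

/-- The Hecke parameters `k_0, k, k_r` (or `u_0, k, u_r`) attached to the labels. -/
def param (a0 a ar : Fˣ) : Node n → Fˣ
  | .zero => a0
  | .mid _ => a
  | .last => ar

/-- The action of the simple reflections on Laurent monomials `x^μ`, `μ ∈ ℤ^r`, with `qh = q^(1/2)`: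
`s_0 x^μ = q^(μ_1) x^(s_{ε_1} μ)`. -/
def sMon (qh : Fˣ) (j : Node n) (μ : Fin (n + 1) → ℤ) : AddMonoidAlgebra F (Fin (n + 1) → ℤ) :=
  match j with
  | .zero => AddMonoidAlgebra.single (reflTuple .zero μ) ((qh ^ 2) ^ μ 0 : Fˣ)
  | j => AddMonoidAlgebra.single (reflTuple j μ) 1

/-- The Laurent monomials `q^(1/2) x_1⁻¹`, `x_i / x_{i+1}`, `x_r`. -/
def xSimple (qh : Fˣ) (j : Node n) : AddMonoidAlgebra F (Fin (n + 1) → ℤ) :=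
  match j with
  | .zero => AddMonoidAlgebra.single (-Pi.single 0 1) (qh : F)
  | .mid i => AddMonoidAlgebra.single (Pi.single i.castSucc 1 - Pi.single i.succ 1) 1
  | .last => AddMonoidAlgebra.single (Pi.single (Fin.last n) 1) 1

/-- The Laurent polynomial `(κ - κ⁻¹ + (υ - υ⁻¹) z) (x^μ - s_j(x^μ)) / (1 - z ^ 2)`, where `z` is
the monomial attached to `j`, and `κ, υ` are the Hecke parameters attached to `j`. -/
def crossTerm (qh k0 u0 k kr ur : Fˣ) (j : Node n) (μ : Fin (n + 1) → ℤ) :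
    AddMonoidAlgebra F (Fin (n + 1) → ℤ) :=
  exactQuot
    ((algebraMap F _ (param k0 k kr j - (param k0 k kr j)⁻¹)
        + algebraMap F _ (param u0 k ur j - (param u0 k ur j)⁻¹) * xSimple qh j)
      * (mon F μ - sMon qh j μ))
    (1 - xSimple qh j ^ 2)

/-- The generators of Sahi's algebra. -/
inductive Gen (n : ℕ)
  | T (j : Node n)
  | X (μ : Fin (n + 1) → ℤ)

/-- The free algebra element `∑ d_μ x^μ` attached to a Laurent polynomial `∑ d_μ x^μ`. -/
def toFree (p : AddMonoidAlgebra F (Fin (n + 1) → ℤ)) : FreeAlgebra F (Gen n) :=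
  p.coeff.sum fun μ d => d • FreeAlgebra.ι F (Gen.X μ)

/-- The defining relations of Sahi's algebra: the affine type `C_r` braid relations (there are none
if `r = 1`), the quadratic relations, and the relations involving the Laurent monomials. -/
inductive Rel (qh k0 u0 k kr ur : Fˣ) : FreeAlgebra F (Gen n) → FreeAlgebra F (Gen n) → Prop
  | braid3 (i j : Fin n) (hij : (i : ℕ) + 1 = j) :
      Rel qh k0 u0 k kr ur
        (altProd (FreeAlgebra.ι F (Gen.T (.mid i))) (FreeAlgebra.ι F (Gen.T (.mid j))) 3)
        (altProd (FreeAlgebra.ι F (Gen.T (.mid j))) (FreeAlgebra.ι F (Gen.T (.mid i))) 3)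
  | braid_zero (i : Fin n) (hi : (i : ℕ) = 0) :
      Rel qh k0 u0 k kr ur
        (altProd (FreeAlgebra.ι F (Gen.T .zero)) (FreeAlgebra.ι F (Gen.T (.mid i))) 4)
        (altProd (FreeAlgebra.ι F (Gen.T (.mid i))) (FreeAlgebra.ι F (Gen.T .zero)) 4)
  | braid_last (i : Fin n) (hi : (i : ℕ) + 1 = n) :
      Rel qh k0 u0 k kr ur
        (altProd (FreeAlgebra.ι F (Gen.T (.mid i))) (FreeAlgebra.ι F (Gen.T .last)) 4)
        (altProd (FreeAlgebra.ι F (Gen.T .last)) (FreeAlgebra.ι F (Gen.T (.mid i))) 4)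
  | comm_mid (i j : Fin n) (hij : (i : ℕ) + 1 < j) :
      Rel qh k0 u0 k kr ur
        (FreeAlgebra.ι F (Gen.T (.mid i)) * FreeAlgebra.ι F (Gen.T (.mid j)))
        (FreeAlgebra.ι F (Gen.T (.mid j)) * FreeAlgebra.ι F (Gen.T (.mid i)))
  | comm_zero (i : Fin n) (hi : (i : ℕ) ≠ 0) :
      Rel qh k0 u0 k kr ur
        (FreeAlgebra.ι F (Gen.T .zero) * FreeAlgebra.ι F (Gen.T (.mid i)))
        (FreeAlgebra.ι F (Gen.T (.mid i)) * FreeAlgebra.ι F (Gen.T .zero))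
  | comm_last (i : Fin n) (hi : (i : ℕ) + 1 ≠ n) :
      Rel qh k0 u0 k kr ur
        (FreeAlgebra.ι F (Gen.T .last) * FreeAlgebra.ι F (Gen.T (.mid i)))
        (FreeAlgebra.ι F (Gen.T (.mid i)) * FreeAlgebra.ι F (Gen.T .last))
  | comm_zero_last (hn : n ≠ 0) :
      Rel qh k0 u0 k kr ur
        (FreeAlgebra.ι F (Gen.T .zero) * FreeAlgebra.ι F (Gen.T .last))
        (FreeAlgebra.ι F (Gen.T .last) * FreeAlgebra.ι F (Gen.T .zero))
  | quadratic (j : Node n) :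
      Rel qh k0 u0 k kr ur
        ((FreeAlgebra.ι F (Gen.T j) - algebraMap F _ (param k0 k kr j))
          * (FreeAlgebra.ι F (Gen.T j) + algebraMap F _ (param k0 k kr j)⁻¹)) 0
  | X_add (μ ν : Fin (n + 1) → ℤ) :
      Rel qh k0 u0 k kr ur (FreeAlgebra.ι F (Gen.X μ) * FreeAlgebra.ι F (Gen.X ν))
        (FreeAlgebra.ι F (Gen.X (μ + ν)))
  | X_zero : Rel qh k0 u0 k kr ur (FreeAlgebra.ι F (Gen.X 0)) 1
  | cross (j : Node n) (μ : Fin (n + 1) → ℤ) :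
      Rel qh k0 u0 k kr ur
        (FreeAlgebra.ι F (Gen.T j) * FreeAlgebra.ι F (Gen.X μ)
          - toFree (sMon qh j μ) * FreeAlgebra.ι F (Gen.T j))
        (toFree (crossTerm qh k0 u0 k kr ur j μ))

/-- Sahi's five parameter double affine Hecke algebra of type `C^∨C_r`, `r = n + 1`, with
`qh = q^(1/2)`. -/
abbrev SahiDAHA (n : ℕ) (qh k0 u0 k kr ur : Fˣ) : Type _ :=
  RingQuot (Rel (n := n) qh k0 u0 k kr ur)

/-- The generator `T_j` of Sahi's algebra. -/
def T (qh k0 u0 k kr ur : Fˣ) (j : Node n) : SahiDAHA n qh k0 u0 k kr ur :=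
  RingQuot.mkAlgHom F (Rel qh k0 u0 k kr ur) (FreeAlgebra.ι F (Gen.T j))

/-- The generator `x^μ` of Sahi's algebra. -/
def X (qh k0 u0 k kr ur : Fˣ) (μ : Fin (n + 1) → ℤ) : SahiDAHA n qh k0 u0 k kr ur :=
  RingQuot.mkAlgHom F (Rel qh k0 u0 k kr ur) (FreeAlgebra.ι F (Gen.X μ))

/-- The monomial `c^m x^(m v)`, i.e. the `m`-th power of `c x^v`. -/
def cmon (c : Fˣ) (v : E) (m : ℤ) : AddMonoidAlgebra F E :=
  AddMonoidAlgebra.single (m • v) (c ^ m : Fˣ)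

/-- The truncated Demazure--Lusztig operator `T_i`, `1 ≤ i < r`, on `x^y`:
`k^(χ_ℤ(y_i - y_{i+1})) x^(s_i y)
+ (k - k⁻¹) (1 - (x_{i+1} / x_i)^⌊y_i - y_{i+1}⌋) / (1 - x_i / x_{i+1}) x^y`. -/
def opMid (ε : OrthonormalBasis (Fin (n + 1)) ℝ E) (k : Fˣ) (i : Fin n) (y : E) :
    AddMonoidAlgebra F E :=
  (k : F) ^ chiZ (coord ε y i.castSucc - coord ε y i.succ) • mon F (reflVec ε (.mid i) y)
    + ((k : F) - (k : F)⁻¹) •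
      (exactQuot
        (1 - cmon 1 (ε i.succ - ε i.castSucc) ⌊coord ε y i.castSucc - coord ε y i.succ⌋)
        (1 - cmon 1 (ε i.castSucc - ε i.succ) 1) * mon F y)

/-- The truncated Demazure--Lusztig operator `T_r` on `x^y`:
`k_r^(χ_e(2 y_r)) u_r^(χ_o(2 y_r)) x^(s_r y)
+ (k_r - k_r⁻¹) (1 - x_r^(-⌊2 y_r⌋_e)) / (1 - x_r²) x^y
+ (u_r - u_r⁻¹) (x_r - x_r^(-⌊2 y_r⌋_o)) / (1 - x_r²) x^y`. -/
def opLast (ε : OrthonormalBasis (Fin (n + 1)) ℝ E) (kr ur : Fˣ) (y : E) :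
    AddMonoidAlgebra F E :=
  ((kr : F) ^ chiE (2 * coord ε y (Fin.last n)) * (ur : F) ^ chiO (2 * coord ε y (Fin.last n))) •
      mon F (reflVec ε .last y)
    + ((kr : F) - (kr : F)⁻¹) •
      (exactQuot (1 - cmon 1 (ε (Fin.last n)) (-floorE (2 * coord ε y (Fin.last n))))
        (1 - cmon 1 (ε (Fin.last n)) 2) * mon F y)
    + ((ur : F) - (ur : F)⁻¹) •
      (exactQuot (cmon 1 (ε (Fin.last n)) 1
          - cmon 1 (ε (Fin.last n)) (-floorO (2 * coord ε y (Fin.last n))))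
        (1 - cmon 1 (ε (Fin.last n)) 2) * mon F y)

/-- The truncated Demazure--Lusztig operator `T_0` on `x^y`, where `c` is the scalar
`(𝐠_y t)^(ε_1)`:
`k_0^(χ_e(2 y_1)) u_0^(χ_o(2 y_1)) c x^(s_{ε_1} y)
+ (k_0 - k_0⁻¹) (1 - (q^(-1/2) x_1)^⌊-2 y_1⌋_e) / (1 - q x_1^(-2)) x^y
+ (u_0 - u_0⁻¹) (q^(1/2) x_1⁻¹ - (q^(-1/2) x_1)^⌊-2 y_1⌋_o) / (1 - q x_1^(-2)) x^y`. -/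
def opZero (ε : OrthonormalBasis (Fin (n + 1)) ℝ E) (qh k0 u0 c : Fˣ) (y : E) :
    AddMonoidAlgebra F E :=
  ((k0 : F) ^ chiE (2 * coord ε y 0) * (u0 : F) ^ chiO (2 * coord ε y 0) * (c : F)) •
      mon F (reflVec ε .zero y)
    + ((k0 : F) - (k0 : F)⁻¹) •
      (exactQuot (1 - cmon qh⁻¹ (ε 0) (floorE (-(2 * coord ε y 0))))
        (1 - cmon qh (-ε 0) 2) * mon F y)
    + ((u0 : F) - (u0 : F)⁻¹) •
      (exactQuot (cmon qh (-ε 0) 1 - cmon qh⁻¹ (ε 0) (floorO (-(2 * coord ε y 0))))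
        (1 - cmon qh (-ε 0) 2) * mon F y)

/-- The embedding `ℤ^r → E`, `μ ↦ ∑ μ_i ε_i`. -/
def latt (ε : OrthonormalBasis (Fin (n + 1)) ℝ E) (μ : Fin (n + 1) → ℤ) : E :=
  vec ε fun i => (μ i : ℝ)

/-- `ρ` is the quasi-polynomial representation of Sahi's algebra on `F[O]` with parameter `t`. -/
def IsQuasiPolRep {ι : Type*} {R : EuclideanRoots ι E} {ε : OrthonormalBasis (Fin (n + 1)) ℝ E}
    (hε : IsRealisation R ε) (qh k0 u0 k kr ur : Fˣ) (O : Set E) (t : R.Torus F)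
    (ρ : SahiDAHA n qh k0 u0 k kr ur →ₐ[F] Module.End F (quasiPol F O)) : Prop :=
  (∀ (μ : Fin (n + 1) → ℤ) (y : E) (hy : y ∈ O),
    (ρ (X qh k0 u0 k kr ur μ) (qmon F y hy) : AddMonoidAlgebra F E) = mon F (y + latt ε μ)) ∧
  (∀ (y : E) (hy : y ∈ O),
    (ρ (T qh k0 u0 k kr ur .zero) (qmon F y hy) : AddMonoidAlgebra F E)
      = opZero ε qh k0 u0 (R.torusAct qh (R.gmin y) t ⟨ε 0, hε.basis_mem 0⟩) y) ∧
  (∀ (i : Fin n) (y : E) (hy : y ∈ O),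
    (ρ (T qh k0 u0 k kr ur (.mid i)) (qmon F y hy) : AddMonoidAlgebra F E) = opMid ε k i y) ∧
  (∀ (y : E) (hy : y ∈ O),
    (ρ (T qh k0 u0 k kr ur .last) (qmon F y hy) : AddMonoidAlgebra F E) = opLast ε kr ur y)

theorem IsRealisation.latt_mem {ι : Type*} {R : EuclideanRoots ι E}
    {ε : OrthonormalBasis (Fin (n + 1)) ℝ E} (hε : IsRealisation R ε) (μ : Fin (n + 1) → ℤ) :
    latt ε μ ∈ R.Qv := by
  unfold latt vec
  refine R.Qv.sum_mem fun i _ => ?_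
  rw [Int.cast_smul_eq_zsmul]
  exact R.Qv.zsmul_mem (hε.basis_mem i) _

/-- `ρ` is the Noumi--Sahi polynomial representation of Sahi's algebra on the Laurent polynomials,
`T_j x^μ = κ s_j(x^μ) + (κ - κ⁻¹ + (υ - υ⁻¹) z) (x^μ - s_j(x^μ)) / (1 - z ^ 2)`, where `z` is the
monomial and `κ, υ` are the Hecke parameters attached to `j`; a Laurent polynomial is viewed in
`F[Q^∨]` through the identification of `ℤ^r` with `Q^∨`. -/
def IsPolRep {ι : Type*} {R : EuclideanRoots ι E} {ε : OrthonormalBasis (Fin (n + 1)) ℝ E}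
    (hε : IsRealisation R ε) (qh k0 u0 k kr ur : Fˣ)
    (ρ : SahiDAHA n qh k0 u0 k kr ur →ₐ[F] Module.End F (quasiPol F (R.Qv : Set E))) : Prop :=
  (∀ μ ν : Fin (n + 1) → ℤ,
    (ρ (X qh k0 u0 k kr ur ν) (qmon F (latt ε μ) (hε.latt_mem μ)) : AddMonoidAlgebra F E)
      = AddMonoidAlgebra.mapDomain (latt ε) (mon F (μ + ν))) ∧
  (∀ (j : Node n) (μ : Fin (n + 1) → ℤ),
    (ρ (T qh k0 u0 k kr ur j) (qmon F (latt ε μ) (hε.latt_mem μ)) : AddMonoidAlgebra F E)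
      = AddMonoidAlgebra.mapDomain (latt ε)
        ((param k0 k kr j : F) • sMon qh j μ + crossTerm qh k0 u0 k kr ur j μ))

end TypeC

end QuasiPoly

end

open QuasiPoly

open scoped RealInnerProductSpace

noncomputable section

namespace QuasiPoly

namespace EuclideanRoots

variable {ι E : Type*} [NormedAddCommGroup E] [InnerProductSpace ℝ E] (R : EuclideanRoots ι E)

/-! Uniqueness is immediate: the operators are prescribed on the basis of quasi-monomials and the
algebras are generated by the `T_j` and `x^μ`. Existence means checking the defining relations for
the truncated operators on `F[O]`. All of this is done for abstract parameters (`HeckeData`),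
subject to two conditions only: `υ_j = κ_j` unless `α_j` is even on `Q^∨`, and equal parameters at
nodes whose Cartan integers are both `-1`. Multiplicity functions and Sahi's five parameters both
satisfy these conditions.

The twist. Two elements of `W` carrying the alcove point `c` of `O` to `y` differ by an element of
the stabilizer of `c`, which is generated by the simple reflections through `c`; these fix `t` by
the definition of `𝐓_O`. Hence `y ↦ 𝐠_y t` is `W`-equivariant (`tpt_smul`) and the twisted action is
an action (`twc_mul`). Moreover, whenever `α_j` has an integral gradient value `m` at `y`, the
twisted reflection is the naive one, `x^y ↦ x^(-m α_j^∨) x^y` (`twc_s_of_int`, resting on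
`tpt_highest`).

The cross relation (`val_add`, `op_mul_mon`). `F[E]` is a domain, so identities may be checked after
multiplication by `1 - x^(2 α_j^∨)`. Replacing `y` by `y + μ` shifts the two parity floors by `m =
α_j(μ)`. For `m` even everything telescopes; an odd `m` exchanges the two floors, which does no harm
since then `υ_j = κ_j`.

The quadratic and braid relations. The cross relation shows that the vectors satisfying such a
relation form a subspace stable under the operators `T` involved and under multiplication by the
corresponding coroot monomials (`quadKer_stable`, `stable_ker_two` to `stable_ker_six`). By
translation and reflection it suffices to treat `x^y` with `y` dominant for the one or two roots
involved and in the unit strip of all roots of the rank one or two system. There `T_j` merely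
multiplies the reflected quasi-monomial by a scalar depending on the value of `α_j`
(`op_qmon_of_nonneg`). The two sides of a braid relation then collect the same scalars in opposite
orders, in front of the same `w_t x^y`.

The `H^X`-action is the restriction of `π_t^O`. On `Q^∨` one has `T_j x^0 = k_j x^0`, and the cross
relation turns this into the Demazure--Lusztig formula. Type `C` is the same construction written in
coordinates. -/

instance : R.P.IsRootSystem := R.isRootSystem
instance : R.P.IsCrystallographic := R.isCrystallographic
instance : R.P.IsReduced := R.isReduced
instance : R.P.IsIrreducible := R.isIrreducible

/-! ### The finite root system: positive cone, highest root, and integrality of the exponents of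
`q`. -/

theorem pairing_eq_inner (i j : ι) : R.P.pairing i j = ⟪R.P.root i, R.P.coroot j⟫ := by
  rw [← R.toLinearMap_apply]; rfl

theorem inner_coroot_eq_pairingIn (i j : ι) :
    ⟪R.P.root i, R.P.coroot j⟫ = (R.P.pairingIn ℤ i j : ℝ) := by
  rw [← pairing_eq_inner, ← R.P.algebraMap_pairingIn ℤ]; rfl

theorem norm_root_pos (i : ι) : 0 < ‖R.P.root i‖ := norm_pos_iff.mpr (R.P.ne_zero i)

theorem pairing_mul_norm (i j : ι) :
    (R.P.pairingIn ℤ i j : ℝ) * ‖R.P.root j‖ ^ 2 = 2 * ⟪R.P.root i, R.P.root j⟫ := by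
  have := R.norm_root_pos j
  rw [← inner_coroot_eq_pairingIn, R.coroot_eq, inner_smul_right]
  field_simp

theorem pairing_mul_norm_swap (i j : ι) :
    (R.P.pairingIn ℤ i j : ℝ) * ‖R.P.root j‖ ^ 2
      = (R.P.pairingIn ℤ j i : ℝ) * ‖R.P.root i‖ ^ 2 := by
  rw [pairing_mul_norm, pairing_mul_norm, real_inner_comm]

theorem coreflection_apply_inner (i : ι) (y : E) :
    R.P.coreflection i y = y - ⟪R.P.root i, y⟫ • R.P.coroot i := by
  rw [RootPairing.coreflection_apply]
  simp [RootPairing.root', R.toLinearMap_apply]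

theorem inner_root_coreflection (i j : ι) (y : E) :
    ⟪R.P.root j, R.P.coreflection i y⟫ = ⟪R.P.root (R.P.reflectionPerm i j), y⟫ := by
  rw [coreflection_apply_inner, RootPairing.root_reflectionPerm, RootPairing.reflection_apply]
  have : R.P.coroot' i (R.P.root j) = ⟪R.P.root j, R.P.coroot i⟫ := by
    rw [← R.toLinearMap_apply]; rfl
  rw [this, inner_sub_right, inner_smul_right, inner_sub_left, inner_smul_left]
  simp; ring

/-- The cone of nonnegative real combinations of simple roots. -/
def InCone (v : E) : Prop := ∃ f : R.base.support → ℝ, (∀ i, 0 ≤ f i) ∧ v = ∑ i, f i • R.P.root i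

theorem InCone.add {v w : E} (hv : R.InCone v) (hw : R.InCone w) : R.InCone (v + w) := by
  obtain ⟨f, hf, rfl⟩ := hv
  obtain ⟨g, hg, rfl⟩ := hw
  exact ⟨f + g, fun i => add_nonneg (hf i) (hg i), by
    simp [add_smul, Finset.sum_add_distrib]⟩

theorem InCone.smul {v : E} (hv : R.InCone v) {r : ℝ} (hr : 0 ≤ r) : R.InCone (r • v) := by
  obtain ⟨f, hf, rfl⟩ := hv
  exact ⟨r • f, fun i => mul_nonneg hr (hf i), by simp [Finset.smul_sum, smul_smul]⟩

theorem inCone_zero : R.InCone (0 : E) := ⟨0, fun _ => le_rfl, by simp⟩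

theorem inCone_of_mem_closure {v : E}
    (hv : v ∈ AddSubmonoid.closure (R.P.root '' (R.base.support : Set ι))) : R.InCone v := by
  induction hv using AddSubmonoid.closure_induction with
  | mem x hx =>
    obtain ⟨i, hi, rfl⟩ := hx
    classical
    refine ⟨Pi.single ⟨i, hi⟩ 1, fun j => ?_, ?_⟩
    · by_cases h : j = ⟨i, hi⟩
      · subst h; simp
      · simp [h]
    · rw [Finset.sum_eq_single ⟨i, hi⟩] <;> simp +contextual
  | zero => exact R.inCone_zero
  | add x y _ _ hx hy => exact InCone.add R hx hy

theorem inCone_simple (i : R.base.support) : R.InCone (R.P.root i) :=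
  R.inCone_of_mem_closure (AddSubmonoid.subset_closure ⟨i, i.2, rfl⟩)

theorem inCone_root_or_neg (i : ι) : R.InCone (R.P.root i) ∨ R.InCone (-R.P.root i) :=
  (R.base.root_mem_or_neg_mem i).imp R.inCone_of_mem_closure R.inCone_of_mem_closure

theorem inCone_highest_sub (i : ι) : R.InCone (R.P.root R.highest - R.P.root i) :=
  R.inCone_of_mem_closure (R.highest_sub_mem i)

theorem simple_coeff_eq {f g : R.base.support → ℝ}
    (h : ∑ i, f i • R.P.root i = ∑ i, g i • R.P.root i) : f = g := by
  have hl : LinearIndependent ℝ fun i : R.base.support => R.P.root i := R.base.linearIndepOn_root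
  have := Fintype.linearIndependent_iff.mp hl (f - g)
    (by simp only [Pi.sub_apply, sub_smul, Finset.sum_sub_distrib, h, sub_self])
  funext i; simpa [sub_eq_zero] using this i

/-- The cone contains no line because the simple roots are linearly independent. -/
theorem InCone.eq_zero {v : E} (hv : R.InCone v) (hv' : R.InCone (-v)) : v = 0 := by
  obtain ⟨f, hf, rfl⟩ := hv
  obtain ⟨g, hg, h⟩ := hv'
  have : f = -g := R.simple_coeff_eq (by
    simp only [Pi.neg_apply, neg_smul, Finset.sum_neg_distrib, ← h, neg_neg])
  have h0 : f = 0 := by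
    funext i
    have h1 := congrFun this i
    have := hf i; have := hg i
    simp at h1 ⊢; linarith
  simp [h0]

theorem InCone.inner_nonneg {v c : E} (hv : R.InCone v)
    (hc : ∀ i : R.base.support, 0 ≤ ⟪R.P.root i, c⟫) : 0 ≤ ⟪v, c⟫ := by
  obtain ⟨f, hf, rfl⟩ := hv
  rw [sum_inner]
  exact Finset.sum_nonneg fun i _ => by
    rw [inner_smul_left]; exact mul_nonneg (hf i) (hc i)

theorem root_neg (i : ι) : R.P.root (R.P.reflectionPerm i i) = -R.P.root i := by simp

theorem coroot_neg (i : ι) : R.P.coroot (R.P.reflectionPerm i i) = -R.P.coroot i := by simp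

/-- Since `-φ` is a root, `φ - (-φ) = 2φ` lies in the cone. -/
theorem inCone_highest : R.InCone (R.P.root R.highest) := by
  have h := R.inCone_highest_sub (R.P.reflectionPerm R.highest R.highest)
  rw [root_neg, sub_neg_eq_add] at h
  have h2 := InCone.smul R h (r := 1 / 2) (by norm_num)
  convert h2 using 1
  module

theorem inCone_highest_add (i : ι) : R.InCone (R.P.root R.highest + R.P.root i) := by
  have h := R.inCone_highest_sub (R.P.reflectionPerm i i)
  rwa [root_neg, sub_neg_eq_add] at h

theorem root_reflectionPerm_int (i j : ι) :
    R.P.root (R.P.reflectionPerm i j) = R.P.root j - (R.P.pairingIn ℤ j i : ℝ) • R.P.root i := by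
  rw [RootPairing.root_reflectionPerm, RootPairing.reflection_apply,
    RootPairing.root_coroot'_eq_pairing,
    ← R.P.algebraMap_pairingIn ℤ]
  rfl

theorem coroot_reflectionPerm_int (i j : ι) :
    R.P.coroot (R.P.reflectionPerm i j)
      = R.P.coroot j - (R.P.pairingIn ℤ i j : ℝ) • R.P.coroot i := by
  rw [RootPairing.coroot_reflectionPerm, coreflection_apply_inner, inner_coroot_eq_pairingIn]

theorem inner_root_nonneg_of_pairing {i j : ι} (h : 0 ≤ R.P.pairingIn ℤ i j) :
    0 ≤ ⟪R.P.root i, R.P.root j⟫ := by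
  have := R.pairing_mul_norm i j
  have : 0 ≤ (R.P.pairingIn ℤ i j : ℝ) * ‖R.P.root j‖ ^ 2 :=
    mul_nonneg (by exact_mod_cast h) (by positivity)
  linarith

theorem pairing_nonneg_of_inner {i j : ι} (h : 0 ≤ ⟪R.P.root i, R.P.root j⟫) :
    0 ≤ R.P.pairingIn ℤ i j := by
  have h1 := R.pairing_mul_norm i j
  have h2 : 0 < ‖R.P.root j‖ ^ 2 := pow_pos (R.norm_root_pos j) 2
  by_contra! hn
  have : (R.P.pairingIn ℤ i j : ℝ) < 0 := by exact_mod_cast hn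
  nlinarith

/-- If `φ` paired negatively with a simple coroot, the reflected root would be strictly higher than
`φ`. -/
theorem inner_simple_highest_nonneg (i : R.base.support) :
    0 ≤ ⟪R.P.root i, R.P.root R.highest⟫ := by
  rw [real_inner_comm]
  apply inner_root_nonneg_of_pairing
  by_contra! hn
  have hn' : (R.P.pairingIn ℤ R.highest i : ℝ) < 0 := by exact_mod_cast hn
  have h := R.inCone_highest_sub (R.P.reflectionPerm i R.highest)
  rw [root_reflectionPerm_int, sub_sub_cancel] at h
  have h2 : R.InCone (-((R.P.pairingIn ℤ R.highest i : ℝ) • R.P.root i)) := by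
    rw [← neg_smul]; exact InCone.smul R (R.inCone_simple i) (by linarith)
  have := InCone.eq_zero R h h2
  rcases smul_eq_zero.mp this with h3 | h3
  · linarith
  · exact R.P.ne_zero _ h3

theorem pairing_highest_nonneg {i : ι} (hi : R.InCone (R.P.root i)) :
    0 ≤ R.P.pairingIn ℤ i R.highest :=
  R.pairing_nonneg_of_inner (InCone.inner_nonneg R hi R.inner_simple_highest_nonneg)

/-- Write `n` for the pairing of `α` with `φ^∨` and suppose `n ≥ 2`. The cone contains `φ + s_φ α =
φ + α - nφ` and `φ - α`, hence their sum `(2 - n)φ`, and it also contains `(n - 2)φ`. This forces `n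
= 2`; then `α - φ` and `φ - α` both lie in the cone and `α = φ`. -/
theorem pairing_highest_le_one {i : ι} (hi : i ≠ R.highest) :
    R.P.pairingIn ℤ i R.highest ≤ 1 := by
  by_contra! hn
  set n := R.P.pairingIn ℤ i R.highest with hn'
  have h1 := R.inCone_highest_add (R.P.reflectionPerm R.highest i)
  rw [root_reflectionPerm_int, ← hn'] at h1
  have h2 := InCone.add R h1 (R.inCone_highest_sub i)
  have h3 : R.InCone (((n : ℝ) - 2) • R.P.root R.highest) :=
    InCone.smul R R.inCone_highest (by
      have : (2 : ℝ) ≤ n := by exact_mod_cast hn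
      linarith)
  have h4 : ((n : ℝ) - 2) • R.P.root R.highest = 0 := by
    apply InCone.eq_zero R h3
    convert h2 using 1
    module
  have hn2 : (n : ℝ) = 2 := by
    rcases smul_eq_zero.mp h4 with h5 | h5
    · linarith
    · exact absurd h5 (R.P.ne_zero _)
  rw [hn2] at h1
  have h5 : R.P.root R.highest - R.P.root i = 0 := by
    apply InCone.eq_zero R (R.inCone_highest_sub i)
    convert h1 using 1
    module
  exact hi (R.P.root.injective (sub_eq_zero.mp h5)).symm

theorem pairing_neg_left (i j : ι) :
    R.P.pairingIn ℤ (R.P.reflectionPerm i i) j = -R.P.pairingIn ℤ i j := by simp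

theorem neg_one_le_pairing_highest {i : ι} (hi : R.P.reflectionPerm i i ≠ R.highest) :
    -1 ≤ R.P.pairingIn ℤ i R.highest := by
  have := R.pairing_highest_le_one hi
  rw [pairing_neg_left] at this
  linarith

/-- The inner product as an invariant form of the root system. -/
def innerForm : R.P.InvariantForm where
  form := R.P.toLinearMap
  symm := ⟨fun x y => by simp [R.toLinearMap_apply, real_inner_comm]⟩
  ne_zero i := by
    rw [R.toLinearMap_apply]
    exact inner_self_ne_zero.mpr (R.P.ne_zero i)
  isOrthogonal_reflection i x y := by
    have hco : ∀ z, R.P.coroot' i z = 2 / ‖R.P.root i‖ ^ 2 * ⟪R.P.root i, z⟫ := fun z => by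
      have : R.P.coroot' i z = ⟪z, R.P.coroot i⟫ := by rw [← R.toLinearMap_apply]; rfl
      rw [this, R.coroot_eq, inner_smul_right, real_inner_comm]
    have := R.norm_root_pos i
    simp only [R.toLinearMap_apply, RootPairing.reflection_apply, hco,
      inner_sub_left, inner_sub_right, inner_smul_left, inner_smul_right,
      real_inner_self_eq_norm_sq, RCLike.conj_to_real]
    rw [real_inner_comm (R.P.root i) x]
    field_simp
    ring

theorem exists_norm_eq_inner_ne_zero (i j : ι) :
    ∃ k, ‖R.P.root k‖ ^ 2 = ‖R.P.root j‖ ^ 2 ∧ ⟪R.P.root i, R.P.root k⟫ ≠ 0 := by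
  have := R.P.exists_form_eq_form_and_form_ne_zero R.innerForm i j
  simpa only [innerForm, R.toLinearMap_apply, real_inner_self_eq_norm_sq] using this

/-- By irreducibility some root `β` of the same length as `α` is not orthogonal to `φ`; up to sign
`β` is positive. If `β ≠ φ`, its pairing with `φ^∨` is exactly `1`, so the symmetry
`pairing_mul_norm_swap` exhibits the ratio of squared lengths as the other Cartan integer. -/
theorem exists_norm_highest_sq_eq (i : ι) :
    ∃ n : ℕ, 1 ≤ n ∧ ‖R.P.root R.highest‖ ^ 2 = n * ‖R.P.root i‖ ^ 2 := by
  obtain ⟨k, hk, hne⟩ := R.exists_norm_eq_inner_ne_zero R.highest i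
  rw [← hk]
  have hp := R.norm_root_pos k
  have hp' := R.norm_root_pos R.highest
  have key : ∀ k', ⟪R.P.root R.highest, R.P.root k'⟫ ≠ 0 →
      R.InCone (R.P.root k') →
        ∃ n : ℕ, 1 ≤ n ∧ ‖R.P.root R.highest‖ ^ 2 = n * ‖R.P.root k'‖ ^ 2 := by
    intro k' hne hc
    by_cases hk' : k' = R.highest
    · exact ⟨1, le_rfl, by rw [hk']; simp⟩
    · have h1 := R.pairing_highest_le_one hk'
      have h0 := R.pairing_highest_nonneg hc
      have hm := R.pairing_mul_norm k' R.highest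
      have hsw := R.pairing_mul_norm_swap k' R.highest
      have hp' := R.norm_root_pos R.highest
      have hp := R.norm_root_pos k'
      have h2 : R.P.pairingIn ℤ k' R.highest = 1 := by
        rcases (by omega : R.P.pairingIn ℤ k' R.highest = 0 ∨
          R.P.pairingIn ℤ k' R.highest = 1) with h | h
        · rw [h, real_inner_comm] at hm
          exact absurd (by simpa using hm.symm) hne
        · exact h
      rw [h2] at hsw
      have h3 : 0 ≤ R.P.pairingIn ℤ R.highest k' := by
        apply R.pairing_nonneg_of_inner
        rw [real_inner_comm]
        exact R.inner_root_nonneg_of_pairing h0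
      obtain ⟨n, hn⟩ := Int.eq_ofNat_of_zero_le h3
      rw [hn] at hsw
      simp only [Int.cast_one, one_mul, Int.cast_natCast] at hsw
      refine ⟨n, ?_, hsw⟩
      by_contra! hlt
      have : n = 0 := by omega
      rw [this] at hsw
      simp at hsw
      exact R.P.ne_zero _ hsw
  rcases R.inCone_root_or_neg k with h | h
  · exact key k hne h
  · obtain ⟨n, h1, h2⟩ := key (R.P.reflectionPerm k k) (by rw [root_neg, inner_neg_right]; simpa)
      (by rwa [root_neg])
    exact ⟨n, h1, by rwa [root_neg, norm_neg] at h2⟩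

theorem norm_root_le_highest (i : ι) : ‖R.P.root i‖ ≤ ‖R.P.root R.highest‖ := by
  obtain ⟨n, h1, h2⟩ := R.exists_norm_highest_sq_eq i
  have h1' : (1 : ℝ) ≤ n := by exact_mod_cast h1
  apply le_of_sq_le_sq _ (norm_nonneg _) |> fun h => h
  nlinarith [sq_nonneg ‖R.P.root i‖]

theorem inner_root_int (i : ι) (μ : R.Qv) : ∃ m : ℤ, ⟪R.P.root i, (μ : E)⟫ = (m : ℝ) := by
  obtain ⟨v, hv⟩ := μ
  induction hv using AddSubgroup.closure_induction with
  | mem x hx => obtain ⟨a, rfl⟩ := hx; exact ⟨_, R.inner_coroot_eq_pairingIn i a⟩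
  | zero => exact ⟨0, by simp⟩
  | add x y _ _ hx hy =>
    obtain ⟨a, ha⟩ := hx; obtain ⟨b, hb⟩ := hy
    exact ⟨a + b, by simp only at *; rw [inner_add_right, ha, hb]; push_cast; ring⟩
  | neg x _ hx =>
    obtain ⟨a, ha⟩ := hx
    exact ⟨-a, by simp only at *; rw [inner_neg_right, ha]; push_cast; ring⟩

/-- The exponents of `q_φ` occurring in `qpow` are integers, so the floor in its definition never
truncates. -/
theorem inner_Qv_int (lam μ : R.Qv) :
    ∃ m : ℤ, ⟪(lam : E), (μ : E)⟫ * ‖R.P.root R.highest‖ ^ 2 / 2 = m := by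
  obtain ⟨v, hv⟩ := lam
  induction hv using AddSubgroup.closure_induction with
  | mem x hx =>
    obtain ⟨a, rfl⟩ := hx
    obtain ⟨n, -, hn⟩ := R.exists_norm_highest_sq_eq a
    obtain ⟨m, hm⟩ := R.inner_root_int a μ
    refine ⟨n * m, ?_⟩
    have := R.norm_root_pos a
    simp only [R.coroot_eq, inner_smul_left, hm, hn, RCLike.conj_to_real]
    push_cast
    field_simp
  | zero => exact ⟨0, by simp⟩
  | add x y _ _ hx hy =>
    obtain ⟨a, ha⟩ := hx; obtain ⟨b, hb⟩ := hy
    exact ⟨a + b, by simp only at *; push_cast; rw [inner_add_left, ← ha, ← hb]; ring⟩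
  | neg x _ hx =>
    obtain ⟨a, ha⟩ := hx
    exact ⟨-a, by simp only at *; push_cast; rw [inner_neg_left, ← ha]; ring⟩

section qpow

variable {F : Type*} [Field F] (q : Fˣ)

theorem qpow_add_inner (lam lam' μ μ' : R.Qv) :
    R.qpow q (⟪(lam : E), (μ : E)⟫ + ⟪(lam' : E), (μ' : E)⟫)
      = R.qpow q ⟪(lam : E), (μ : E)⟫ * R.qpow q ⟪(lam' : E), (μ' : E)⟫ := by
  obtain ⟨m, hm⟩ := R.inner_Qv_int lam μ
  obtain ⟨n, hn⟩ := R.inner_Qv_int lam' μ'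
  have : (⟪(lam : E), (μ : E)⟫ + ⟪(lam' : E), (μ' : E)⟫) * ‖R.P.root R.highest‖ ^ 2 / 2
      = ((m + n : ℤ) : ℝ) := by push_cast; rw [← hm, ← hn]; ring
  simp only [qpow, this, hm, hn, Int.floor_intCast, zpow_add]

theorem qpow_zero : R.qpow q 0 = 1 := by simp [qpow]

theorem qpow_inner_coroot_highest (lam : E) (m : ℤ) (h : ⟪R.P.root R.highest, lam⟫ = m) :
    R.qpow q ⟪lam, R.P.coroot R.highest⟫ = q ^ m := by
  have hp := R.norm_root_pos R.highest
  have : ⟪lam, R.P.coroot R.highest⟫ * ‖R.P.root R.highest‖ ^ 2 / 2 = m := by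
    rw [R.coroot_eq, inner_smul_right, real_inner_comm, h]
    field_simp
  rw [qpow, this, Int.floor_intCast]

end qpow

theorem coroot_mem_simple_span (lam : R.Qv) :
    ∃ n : R.base.support → ℤ, lam = ∑ i, n i • R.cograd (some i) := by
  obtain ⟨v, hv⟩ := lam
  have key : v ∈ Submodule.span ℤ (Set.range fun i : R.base.support => R.P.coroot i) := by
    induction hv using AddSubgroup.closure_induction with
    | mem x hx =>
      obtain ⟨a, rfl⟩ := hx
      have := R.base.coroot_mem_span_int a
      rwa [Set.image_eq_range] at this
    | zero => exact Submodule.zero_mem _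
    | add x y _ _ hx hy => exact Submodule.add_mem _ hx hy
    | neg x _ hx => exact Submodule.neg_mem _ hx
  obtain ⟨n, hn⟩ := (Submodule.mem_span_range_iff_exists_fun ℤ).mp key
  refine ⟨n, Subtype.ext (hn.symm.trans ?_)⟩
  simp [cograd]

theorem eq_zero_of_inner_simple_eq_zero {y : E} (h : ∀ i : R.base.support, ⟪R.P.root i, y⟫ = 0) :
    y = 0 := by
  have hspan : y ∈ Submodule.span ℝ (R.P.root '' (R.base.support : Set ι)) := by
    rw [R.base.span_root_support, show R.P.rootSpan ℝ = ⊤ from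
      RootPairing.IsRootSystem.span_root_eq_top]
    trivial
  have : ∀ v ∈ Submodule.span ℝ (R.P.root '' (R.base.support : Set ι)), ⟪v, y⟫ = 0 := by
    intro v hv
    induction hv using Submodule.span_induction with
    | mem x hx => obtain ⟨i, hi, rfl⟩ := hx; exact h ⟨i, hi⟩
    | zero => simp
    | add x z _ _ hx hz => rw [inner_add_left, hx, hz, add_zero]
    | smul a x _ hx => rw [inner_smul_left, hx, mul_zero]
  exact inner_self_eq_zero.mp (this y hspan)

/-- A point in the interior of the fundamental alcove. -/
theorem exists_interior : ∃ p : E, ∀ j, 0 < ev (R.simpleRoot j) p := by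
  obtain ⟨f, hf⟩ : ∃ f : Module.Dual ℝ E, ∀ i : R.base.support, f (R.P.root i) = 1 := by
    refine ⟨R.base.toWeightBasis.constr ℝ fun _ => (1 : ℝ), fun i => ?_⟩
    rw [← R.base.toWeightBasis_apply, Module.Basis.constr_basis]
  obtain ⟨y, hy⟩ := R.P.toLinearMap.flip.toPerfPair.surjective f
  have hyf : ∀ v, ⟪v, y⟫ = f v := fun v => by
    rw [← hy, ← R.toLinearMap_apply]; rfl
  have h0 : 0 ≤ ⟪R.P.root R.highest, y⟫ :=
    InCone.inner_nonneg R R.inCone_highest fun i => by rw [hyf, hf]; norm_num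
  set c := ⟪R.P.root R.highest, y⟫ with hc
  -- All simple roots equal `1` at `y`. After this rescaling every affine simple root, including `1
  -- - φ`, takes the value `1 / (c + 1)`.
  refine ⟨(1 / (c + 1)) • y, fun j => ?_⟩
  cases j with
  | none =>
    simp only [simpleRoot, grad, cst, ev, inner_smul_right, inner_neg_left, ← hc]
    push_cast
    have : 1 / (c + 1) * -c + 1 = 1 / (c + 1) := by field_simp; ring
    rw [this]; positivity
  | some i =>
    simp only [simpleRoot, grad, cst, ev, inner_smul_right, hyf, hf]
    push_cast
    positivity

end EuclideanRoots

/-! ### The affine Weyl group as a group of affine isometries. -/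

namespace EuclideanRoots

variable {ι E : Type*} [NormedAddCommGroup E] [InnerProductSpace ℝ E] (R : EuclideanRoots ι E)

/-- The reflection `s_a`, `a = (α_i, m)`, as an element of the affine Weyl group. -/
def reflW (i : ι) (m : ℤ) : R.W := ⟨R.refl i m, Subgroup.subset_closure ⟨(i, m), rfl⟩⟩

theorem reflW_apply (i : ι) (m : ℤ) (y : E) :
    (R.reflW i m).1 y = y - (⟪R.P.root i, y⟫ + m) • R.P.coroot i := R.refl_apply i m y

theorem W_ext {g h : R.W} (H : ∀ y, g.1 y = h.1 y) : g = h :=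
  Subtype.ext (AffineEquiv.ext H)

theorem W_mul_apply (g h : R.W) (y : E) : (g * h).1 y = g.1 (h.1 y) := rfl

theorem W_inv_apply_self (g : R.W) (y : E) : g⁻¹.1 (g.1 y) = y := by
  rw [← W_mul_apply, inv_mul_cancel]; rfl

theorem W_apply_inv_self (g : R.W) (y : E) : g.1 (g⁻¹.1 y) = y := by
  rw [← W_mul_apply, mul_inv_cancel]; rfl

theorem W_apply (g : R.W) (y : E) : g.1 y = g.1.linear y + g.1 0 := by
  have := g.1.map_vadd 0 y
  simpa using this

theorem W_mul_linear (g h : R.W) (v : E) : (g * h).1.linear v = g.1.linear (h.1.linear v) := rfl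

theorem inner_root_coroot_self (i : ι) : ⟪R.P.root i, R.P.coroot i⟫ = (2 : ℝ) := by
  rw [← R.toLinearMap_apply, R.P.root_coroot_two]

theorem reflW_mul_self (i : ι) (m : ℤ) : R.reflW i m * R.reflW i m = 1 := by
  apply R.W_ext
  intro y
  rw [W_mul_apply]
  simp only [reflW_apply, inner_sub_right, inner_smul_right, inner_root_coroot_self]
  change _ = y
  module

theorem reflW_inv (i : ι) (m : ℤ) : (R.reflW i m)⁻¹ = R.reflW i m :=
  inv_eq_of_mul_eq_one_right (R.reflW_mul_self i m)

theorem W_induction {p : R.W → Prop} (one : p 1)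
    (mul : ∀ i m g, p g → p (R.reflW i m * g)) (g : R.W) : p g := by
  obtain ⟨g, hg⟩ := g
  induction hg using Subgroup.closure_induction_left with
  | one => exact one
  | mul_left x hx y hy ih =>
    obtain ⟨⟨i, m⟩, rfl⟩ := hx
    exact mul i m ⟨y, hy⟩ ih
  | inv_mul_cancel x hx y hy ih =>
    obtain ⟨⟨i, m⟩, rfl⟩ := hx
    have := mul i m ⟨y, hy⟩ ih
    rwa [← reflW_inv] at this

theorem reflW_linear (i : ι) (m : ℤ) (v : E) :
    (R.reflW i m).1.linear v = v - ⟪R.P.root i, v⟫ • R.P.coroot i := by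
  have h := R.W_apply (R.reflW i m) v
  rw [reflW_apply, reflW_apply] at h
  have h2 := eq_sub_of_add_eq h.symm
  rw [h2, inner_zero_right]
  module

theorem linear_inner (g : R.W) (v w : E) : ⟪g.1.linear v, g.1.linear w⟫ = ⟪v, w⟫ := by
  induction g using R.W_induction with
  | one => rfl
  | mul i m g ih =>
    rw [W_mul_linear, W_mul_linear, ← ih]
    generalize g.1.linear v = v
    generalize g.1.linear w = w
    have := R.norm_root_pos i
    simp only [reflW_linear, R.coroot_eq, inner_sub_left, inner_sub_right, inner_smul_left,
      inner_smul_right, real_inner_self_eq_norm_sq, RCLike.conj_to_real,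
      real_inner_comm (R.P.root i) v]
    field_simp
    ring

theorem linear_coroot (g : R.W) (i : ι) : ∃ j, g.1.linear (R.P.root i) = R.P.root j ∧
    g.1.linear (R.P.coroot i) = R.P.coroot j := by
  induction g using R.W_induction with
  | one => exact ⟨i, rfl, rfl⟩
  | mul k m g ih =>
    obtain ⟨j, h1, h2⟩ := ih
    refine ⟨R.P.reflectionPerm k j, ?_, ?_⟩
    · rw [W_mul_linear, h1, reflW_linear, root_reflectionPerm_int]
      congr 1
      have := R.norm_root_pos k
      rw [R.coroot_eq k, smul_smul]
      congr 1
      rw [real_inner_comm]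
      have := R.pairing_mul_norm j k
      field_simp
      linarith
    · rw [W_mul_linear, h2, reflW_linear, coroot_reflectionPerm_int, inner_coroot_eq_pairingIn]

theorem inv_linear_apply (g : R.W) (v : E) : g⁻¹.1.linear (g.1.linear v) = v := by
  rw [← W_mul_linear, inv_mul_cancel]; rfl

theorem linear_inv_apply (g : R.W) (v : E) : g.1.linear (g⁻¹.1.linear v) = v := by
  rw [← W_mul_linear, mul_inv_cancel]; rfl

theorem inner_linear_eq (g : R.W) (v w : E) : ⟪g.1.linear v, w⟫ = ⟪v, g⁻¹.1.linear w⟫ := by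
  rw [← R.linear_inner g v, linear_inv_apply]

/-- `W` permutes the affine roots. -/
theorem exists_affine_root (g : R.W) (i : ι) (m : ℤ) : ∃ (i' : ι) (m' : ℤ),
    ∀ y, ⟪R.P.root i, g.1 y⟫ + m = ⟪R.P.root i', y⟫ + (m' : ℝ) := by
  obtain ⟨i', h1, -⟩ := R.linear_coroot g⁻¹ i
  obtain ⟨n, hn⟩ := R.inner_root_int i (R.trl g)
  refine ⟨i', n + m, fun y => ?_⟩
  have hn' : ⟪R.P.root i, g.1 0⟫ = (n : ℝ) := hn
  rw [W_apply, inner_add_right, ← h1, inner_linear_eq, inv_inv, hn']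
  push_cast; ring

/-! ### Generation by simple reflections -/

theorem s_some (i : R.base.support) : R.s (some i) = R.reflW i 0 := rfl

theorem s_none : R.s none = R.reflW R.highest (-1) := rfl

theorem s_apply (j : R.Node) (y : E) :
    (R.s j).1 y = y - ev (R.simpleRoot j) y • (R.cograd j : E) := by
  cases j with
  | none =>
    rw [s_none, reflW_apply]
    simp only [ev, simpleRoot, grad, cst, cograd, inner_neg_left, AddSubgroup.coe_neg]
    push_cast
    module
  | some i =>
    rw [s_some, reflW_apply]
    simp only [ev, simpleRoot, grad, cst, cograd]

theorem s_linear (j : R.Node) (v : E) :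
    (R.s j).1.linear v = v - ⟪R.grad j, v⟫ • (R.cograd j : E) := by
  have h := R.W_apply (R.s j) v
  rw [s_apply, s_apply] at h
  rw [eq_sub_of_add_eq h.symm]
  simp only [ev, simpleRoot, inner_zero_right]
  module

theorem inner_grad_cograd (j : R.Node) : ⟪R.grad j, (R.cograd j : E)⟫ = 2 := by
  cases j with
  | none => simp [grad, cograd, inner_root_coroot_self]
  | some i => exact R.inner_root_coroot_self i

theorem s_mul_self (j : R.Node) : R.s j * R.s j = 1 := by
  cases j <;> exact R.reflW_mul_self _ _

theorem s_inv (j : R.Node) : (R.s j)⁻¹ = R.s j := inv_eq_of_mul_eq_one_right (R.s_mul_self j)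

theorem ev_s (j : R.Node) (y : E) :
    ev (R.simpleRoot j) ((R.s j).1 y) = -ev (R.simpleRoot j) y := by
  rw [s_apply]
  have := R.inner_grad_cograd j
  simp only [ev, simpleRoot, inner_sub_right, inner_smul_right, this]
  ring

theorem reflW_neg (i : ι) : R.reflW (R.P.reflectionPerm i i) 0 = R.reflW i 0 := by
  apply R.W_ext
  intro y
  rw [reflW_apply, reflW_apply, root_neg, coroot_neg, inner_neg_left]
  push_cast
  module

theorem reflW_conj (j i : ι) :
    R.reflW (R.P.reflectionPerm j i) 0 = R.reflW j 0 * R.reflW i 0 * R.reflW j 0 := by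
  apply R.W_ext
  intro y
  rw [W_mul_apply, W_mul_apply, reflW_apply R (R.P.reflectionPerm j i), ← inner_root_coreflection,
    RootPairing.coroot_reflectionPerm]
  simp only [reflW_apply, coreflection_apply_inner, inner_sub_right, inner_smul_right,
    inner_root_coroot_self]
  push_cast
  module

variable [Finite ι]

/-- The linear reflections are products of `s_1, …, s_r`, so the issue is to produce all
translations by coroots. The one by `φ^∨` is `s_0 s_φ`. Conjugation by linear reflections and
irreducibility give, for any root `α`, a root `β` as long as `φ`, not orthogonal to `α`, with
translation by `β^∨` available. As `β` is at least as long as `α`, either `α = ±β` or `s_α(β^∨) =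
β^∨ ∓ α^∨`, and translation by `α^∨` is obtained as a difference. -/
theorem simple_closure_eq_top : Subgroup.closure (Set.range R.s) = ⊤ := by
  set H := Subgroup.closure (Set.range R.s) with hH
  have hs : ∀ j, R.s j ∈ H := fun j => Subgroup.subset_closure ⟨j, rfl⟩
  have h0 : ∀ i, R.reflW i 0 ∈ H := fun i => by
    refine R.base.induction_reflect i (p := fun i => R.reflW i 0 ∈ H) ?_ ?_ ?_
    · intro i hi; rwa [reflW_neg]
    · intro i hi; exact hs (some ⟨i, hi⟩)
    · intro i j hi hj
      rw [reflW_conj]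
      exact H.mul_mem (H.mul_mem (hs (some ⟨j, hj⟩)) hi) (hs (some ⟨j, hj⟩))
  -- The vectors whose translations lie in `H`.
  let L : AddSubgroup E :=
    { carrier := {lam | ∃ g ∈ H, ∀ y, g.1 y = y + lam}
      zero_mem' := ⟨1, H.one_mem, fun y => (add_zero y).symm⟩
      add_mem' := by
        rintro a b ⟨g, hg, h1⟩ ⟨g', hg', h2⟩
        refine ⟨g * g', H.mul_mem hg hg', fun y => ?_⟩
        rw [W_mul_apply, h1, h2]; abel
      neg_mem' := by
        rintro a ⟨g, hg, h1⟩
        refine ⟨g⁻¹, H.inv_mem hg, fun y => ?_⟩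
        have : y = g.1 (y + -a) := by rw [h1]; abel
        conv_lhs => rw [this, W_inv_apply_self] }
  have hLφ : R.P.coroot R.highest ∈ L := by
    refine ⟨R.s none * R.reflW R.highest 0, H.mul_mem (hs none) (h0 _), fun y => ?_⟩
    rw [W_mul_apply, s_none]
    simp only [reflW_apply, inner_sub_right, inner_smul_right, inner_root_coroot_self]
    push_cast
    module
  have hLco : ∀ i, ∀ lam ∈ L, R.P.coreflection i lam ∈ L := by
    rintro i lam ⟨g, hg, h1⟩
    refine ⟨R.reflW i 0 * g * R.reflW i 0, H.mul_mem (H.mul_mem (h0 i) hg) (h0 i), fun y => ?_⟩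
    rw [W_mul_apply, W_mul_apply]
    simp only [reflW_apply, h1, coreflection_apply_inner, inner_sub_right, inner_smul_right,
      inner_root_coroot_self, inner_add_right]
    push_cast
    module
  have hLall : ∀ i, R.P.coroot i ∈ L := by
    intro i
    let S : Set E := {v | ∃ k, v = R.P.root k ∧ R.P.coroot k ∈ L ∧
      ‖R.P.root k‖ = ‖R.P.root R.highest‖}
    -- The span of `S` is stable under all reflections and contains `φ`, so irreducibility makes it
    -- the whole space; no root is orthogonal to all of `S`.
    have htop : Submodule.span ℝ S = ⊤ := by
      apply RootPairing.IsIrreducible.eq_top_of_invtSubmodule_reflection (P := R.P)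
      · intro j
        rw [Module.End.mem_invtSubmodule, Submodule.span_le]
        rintro v ⟨k, rfl, hk, hn⟩
        refine Submodule.subset_span ⟨R.P.reflectionPerm j k, ?_, ?_, ?_⟩
        · rw [RootPairing.root_reflectionPerm]; rfl
        · rw [RootPairing.coroot_reflectionPerm]; exact hLco _ _ hk
        · rw [← hn]
          have h1 := R.linear_inner (R.reflW j 0) (R.P.root k) (R.P.root k)
          rw [real_inner_self_eq_norm_sq, real_inner_self_eq_norm_sq] at h1
          have h2 : (R.reflW j 0).1.linear (R.P.root k) = R.P.root (R.P.reflectionPerm j k) := by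
            rw [reflW_linear, root_reflectionPerm_int]
            congr 1
            have := R.norm_root_pos j
            rw [R.coroot_eq j, smul_smul]
            congr 1
            rw [real_inner_comm]
            have := R.pairing_mul_norm k j
            field_simp
            linarith
          rw [h2] at h1
          exact (sq_eq_sq₀ (norm_nonneg _) (norm_nonneg _)).mp h1
      · intro hbot
        have : R.P.root R.highest ∈ Submodule.span ℝ S :=
          Submodule.subset_span ⟨R.highest, rfl, hLφ, rfl⟩
        rw [hbot, Submodule.mem_bot] at this
        exact R.P.ne_zero _ this
    obtain ⟨k, hk, hn, hne⟩ : ∃ k, R.P.coroot k ∈ L ∧ ‖R.P.root k‖ = ‖R.P.root R.highest‖ ∧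
        ⟪R.P.root i, R.P.root k⟫ ≠ 0 := by
      by_contra! hcon
      have : ∀ v ∈ Submodule.span ℝ S, ⟪R.P.root i, v⟫ = 0 := by
        intro v hv
        induction hv using Submodule.span_induction with
        | mem x hx => obtain ⟨k, rfl, h1, h2⟩ := hx; exact hcon k h1 h2
        | zero => simp
        | add x z _ _ hx hz => rw [inner_add_right, hx, hz, add_zero]
        | smul a x _ hx => rw [inner_smul_right, hx, mul_zero]
      exact R.P.ne_zero i (inner_self_eq_zero.mp (this (R.P.root i) (htop ▸ trivial)))
    have hle := R.norm_root_le_highest i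
    rw [← hn] at hle
    have hpi := R.norm_root_pos i
    have hpk := R.norm_root_pos k
    have hsw := R.pairing_mul_norm_swap i k
    have hmn := R.pairing_mul_norm i k
    have hle2 : ‖R.P.root i‖ ^ 2 ≤ ‖R.P.root k‖ ^ 2 := by gcongr
    have hpi2 : 0 < ‖R.P.root i‖ ^ 2 := by positivity
    have hco := hLco i _ hk
    rw [coreflection_apply_inner, inner_coroot_eq_pairingIn] at hco
    have hset := R.P.pairingIn_pairingIn_mem_set_of_isCrystal_of_isRed i k
    -- Among the finitely many pairs of Cartan integers of a reduced system, a pairing with absolute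
    -- value above `1` would make root `i` longer than root `k`, except for the pairs `±(2, 2)`,
    -- where the two roots agree up to sign.
    have hpm : R.P.pairingIn ℤ i k = 1 ∨ R.P.pairingIn ℤ i k = -1 ∨
        R.P.coroot i = R.P.coroot k ∨ R.P.coroot i = -R.P.coroot k := by
      simp only [Set.mem_insert_iff, Set.mem_singleton_iff, Prod.mk.injEq] at hset
      rcases hset with h | h | h | h | h | h | h | h | h | h | h | h | h <;>
        obtain ⟨ha, hb⟩ := h <;> rw [ha, hb] at hsw <;> rw [ha] at hmn <;> push_cast at hsw hmn
      · exfalso; apply hne; linarith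
      · exact Or.inl ha
      · exact Or.inr (Or.inl ha)
      · exact Or.inl ha
      · exfalso; linarith
      · exact Or.inr (Or.inl ha)
      · exfalso; linarith
      · exact Or.inl ha
      · exfalso; linarith
      · exact Or.inr (Or.inl ha)
      · exfalso; linarith
      · right; right; left
        have : R.P.root i = R.P.root k := by
          rw [← sub_eq_zero, ← norm_eq_zero, ← sq_eq_zero_iff, norm_sub_sq_real]
          linarith
        rw [R.coroot_eq, R.coroot_eq, this]
      · right; right; right
        have : R.P.root i = -R.P.root k := by
          rw [← sub_eq_zero, sub_neg_eq_add, ← norm_eq_zero, ← sq_eq_zero_iff, norm_add_sq_real]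
          linarith
        rw [R.coroot_eq, R.coroot_eq, this, norm_neg, smul_neg]
    rcases hpm with h | h | h | h
    · rw [h] at hco
      have := L.sub_mem hk hco
      simpa using this
    · rw [h] at hco
      have := L.sub_mem hco hk
      simpa using this
    · rw [h]; exact hk
    · rw [h]; exact L.neg_mem hk
  rw [eq_top_iff]
  intro g _
  induction g using R.W_induction with
  | one => exact H.one_mem
  | mul i m g ih =>
    refine H.mul_mem ?_ (ih trivial)
    obtain ⟨t, ht, h1⟩ := L.zsmul_mem (hLall i) (-m)
    have : R.reflW i m = t * R.reflW i 0 := by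
      apply R.W_ext
      intro y
      rw [W_mul_apply, h1, reflW_apply, reflW_apply, ← Int.cast_smul_eq_zsmul ℝ]
      push_cast
      module
    rw [this]
    exact H.mul_mem ht (h0 i)

theorem exists_word (g : R.W) : ∃ l : List R.Node, (l.map R.s).prod = g := by
  have hg : g ∈ Subgroup.closure (Set.range R.s) := by rw [simple_closure_eq_top]; trivial
  induction hg using Subgroup.closure_induction_left with
  | one => exact ⟨[], rfl⟩
  | mul_left x hx y hy ih =>
    obtain ⟨j, rfl⟩ := hx
    obtain ⟨l, rfl⟩ := ih
    exact ⟨j :: l, by simp⟩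
  | inv_mul_cancel x hx y hy ih =>
    obtain ⟨j, rfl⟩ := hx
    obtain ⟨l, rfl⟩ := ih
    exact ⟨j :: l, by simp [s_inv]⟩

end EuclideanRoots

namespace EuclideanRoots

variable {ι E : Type*} [NormedAddCommGroup E] [InnerProductSpace ℝ E] (R : EuclideanRoots ι E)

/-! ### Positive affine roots and the fundamental alcove -/

/-- Positivity of the affine root `(α_i, m)`. -/
def PosAff (i : ι) (m : ℤ) : Prop := 0 < m ∨ (m = 0 ∧ R.InCone (R.P.root i))

theorem alcove_simple {z : E} (hz : z ∈ R.alcove) (i : R.base.support) :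
    0 ≤ ⟪R.P.root i, z⟫ := by
  have := hz (some i)
  simpa [ev, simpleRoot, grad, cst] using this

theorem alcove_highest {z : E} (hz : z ∈ R.alcove) : ⟪R.P.root R.highest, z⟫ ≤ 1 := by
  have := hz none
  simp only [ev, simpleRoot, grad, cst, inner_neg_left] at this
  push_cast at this
  linarith

/-- Both `φ + α` and `φ - α` lie in the positive cone, and `φ ≤ 1` on the alcove. -/
theorem abs_inner_le_one {z : E} (hz : z ∈ R.alcove) (i : ι) : |⟪R.P.root i, z⟫| ≤ 1 := by
  have h1 := InCone.inner_nonneg R (R.inCone_highest_add i) (R.alcove_simple hz)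
  have h2 := InCone.inner_nonneg R (R.inCone_highest_sub i) (R.alcove_simple hz)
  rw [inner_add_left] at h1
  rw [inner_sub_left] at h2
  have := R.alcove_highest hz
  rw [abs_le]
  constructor <;> linarith

theorem PosAff.nonneg {i : ι} {m : ℤ} (h : R.PosAff i m) {z : E} (hz : z ∈ R.alcove) :
    0 ≤ ⟪R.P.root i, z⟫ + m := by
  rcases h with h | ⟨rfl, h⟩
  · have h1 : (1 : ℝ) ≤ m := by exact_mod_cast h
    have := (abs_le.mp (R.abs_inner_le_one hz i)).1
    linarith
  · simpa using InCone.inner_nonneg R h (R.alcove_simple hz)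

variable [Finite ι]

theorem eq_of_root_eq_smul_simple {i : ι} {k : R.base.support} {c : ℝ} (hc : 0 ≤ c)
    (h : R.P.root i = c • R.P.root k) : R.P.root i = R.P.root k := by
  have : IsAddTorsionFree E := .of_isTorsionFree ℝ E
  have := R.base.eq_one_or_neg_one_of_mem_support_of_smul_mem k k.2 c ⟨i, h⟩
  rcases this with h1 | h1
  · rw [h, h1, one_smul]
  · linarith

/-- A simple reflection makes only one positive affine root negative. -/
theorem PosAff.simple_reflection {i : ι} {m : ℤ} (h : R.PosAff i m) (j : R.Node) :
    (∃ i' m', R.PosAff i' m' ∧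
      ∀ y, ⟪R.P.root i, (R.s j).1 y⟫ + m = ⟪R.P.root i', y⟫ + (m' : ℝ)) ∨
    (R.P.root i, (m : ℝ)) = R.simpleRoot j := by
  cases j with
  | none =>
    set n := R.P.pairingIn ℤ i R.highest with hn
    have hact : ∀ y, ⟪R.P.root i, (R.s none).1 y⟫ + m
        = ⟪R.P.root (R.P.reflectionPerm R.highest i), y⟫ + ((m + n : ℤ) : ℝ) := by
      intro y
      rw [s_none, reflW_apply, inner_sub_right, inner_smul_right, inner_coroot_eq_pairingIn, ← hn,
        root_reflectionPerm_int, ← hn, inner_sub_left, inner_smul_left]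
      push_cast
      simp only [conj_trivial]
      ring
    -- The image root is `(s_φ α, m + n)`. If `α ≠ -φ` then `n ≥ -1`, so for `m > 0` the constant
    -- can only drop to `0` when `n = -1`, and the gradient is then `α + φ`, which is in the cone.
    -- For `α = -φ` one has `n = -2`: `m = 1` is `α_0` itself and `m = 2` is sent to `(φ, 0)`.
    by_cases hm : 0 < m
    · by_cases hi : R.P.reflectionPerm i i = R.highest
      · have hroot : R.P.root i = -R.P.root R.highest := by
          rw [← hi, root_neg, neg_neg]
        have hn2 : n = -2 := by
          have : (n : ℝ) = -2 := by
            rw [hn, ← inner_coroot_eq_pairingIn, hroot, inner_neg_left, inner_root_coroot_self]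
          exact_mod_cast this
        by_cases hm1 : m = 1
        · right
          rw [hroot, hm1]; rfl
        · left
          refine ⟨_, _, ?_, hact⟩
          by_cases hm2 : m = 2
          · right
            refine ⟨by omega, ?_⟩
            rw [root_reflectionPerm_int, ← hn, hn2, hroot]
            convert R.inCone_highest using 1
            push_cast
            module
          · left; omega
      · have := R.neg_one_le_pairing_highest hi
        left
        refine ⟨_, _, ?_, hact⟩
        by_cases h0 : 0 < m + n
        · exact Or.inl h0
        · right
          refine ⟨by omega, ?_⟩
          have hn1 : n = -1 := by omega
          rw [root_reflectionPerm_int, ← hn, hn1]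
          convert R.inCone_highest_add i using 1
          push_cast
          module
    · left
      refine ⟨_, _, ?_, hact⟩
      rcases h with h | ⟨rfl, h⟩
      · exact absurd h hm
      · have h0 := R.pairing_highest_nonneg h
        rcases h0.lt_or_eq with h1 | h1
        · left; omega
        · right
          refine ⟨by omega, ?_⟩
          rw [root_reflectionPerm_int, ← h1]
          simpa using h
  | some k =>
    have hact : ∀ y, ⟪R.P.root i, (R.s (some k)).1 y⟫ + m
        = ⟪R.P.root (R.P.reflectionPerm k i), y⟫ + (m : ℝ) := by
      intro y
      rw [s_some, reflW_apply, ← inner_root_coreflection, coreflection_apply_inner]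
      simp
    by_cases hm : 0 < m
    · exact Or.inl ⟨_, _, Or.inl hm, hact⟩
    · rcases h with h | ⟨rfl, h⟩
      · exact absurd h hm
      rcases R.inCone_root_or_neg (R.P.reflectionPerm k i) with h1 | h1
      · exact Or.inl ⟨_, _, Or.inr ⟨rfl, h1⟩, hact⟩
      · right
        obtain ⟨f, hf, hfi⟩ := h
        obtain ⟨g, hg, hgi⟩ := h1
        classical
        set n : ℝ := (R.P.pairingIn ℤ i k : ℝ) with hn
        -- The reflection changes only the coefficient at `k`. If the root is positive and its image
        -- negative, all other coefficients vanish, so the root is proportional to the simple root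
        -- `k`.
        have hfg : f = -g + Pi.single k n := by
          apply R.simple_coeff_eq
          rw [← hfi]
          simp only [Pi.add_apply, Pi.neg_apply, add_smul, neg_smul, Finset.sum_add_distrib,
            Finset.sum_neg_distrib, ← hgi]
          rw [Finset.sum_eq_single k (fun b _ hb => by simp [hb]) (by simp),
            root_reflectionPerm_int, ← hn]
          simp
        have hf0 : ∀ l, l ≠ k → f l = 0 := by
          intro l hl
          have h2 := congrFun hfg l
          simp only [Pi.add_apply, Pi.neg_apply, Pi.single_eq_of_ne hl] at h2
          have := hf l; have := hg l
          linarith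
        have hroot : R.P.root i = f k • R.P.root k := by
          rw [hfi, Finset.sum_eq_single k (fun b _ hb => by simp [hf0 b hb]) (by simp)]
        rw [R.eq_of_root_eq_smul_simple (hf k) hroot]
        rfl

omit [Finite ι] in
theorem posAff_simple (j : R.Node) : ∃ i m, R.PosAff i m ∧ (R.P.root i, (m : ℝ)) = R.simpleRoot j
    := by
  cases j with
  | none =>
    exact ⟨R.P.reflectionPerm R.highest R.highest, 1, Or.inl one_pos, by
      rw [root_neg]; rfl⟩
  | some i => exact ⟨i, 0, Or.inr ⟨rfl, R.inCone_simple i⟩, rfl⟩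

/-- This is the exchange condition. Letters are moved one at a time into the affine root, which
stays positive until a letter's own simple root is met. This must happen, since a positive affine
root that survived the whole word would be nonnegative on the alcove. -/
theorem exists_split_of_neg (l : List R.Node) : ∀ {i : ι} {m : ℤ}, R.PosAff i m →
    ∀ {z : E}, z ∈ R.alcove → ⟪R.P.root i, (l.map R.s).prod.1 z⟫ + m < 0 →
    ∃ l1 k l2, l = l1 ++ k :: l2 ∧
      ∀ y, ⟪R.P.root i, (l1.map R.s).prod.1 y⟫ + m = ev (R.simpleRoot k) y := by
  induction l with
  | nil =>
    intro i m h z hz hneg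
    have := h.nonneg R hz
    have h1 : ((([] : List R.Node).map R.s).prod).1 z = z := rfl
    rw [h1] at hneg
    linarith
  | cons k l ih =>
    intro i m h z hz hneg
    rcases h.simple_reflection R k with ⟨i', m', h', hact⟩ | hsimple
    · rw [List.map_cons, List.prod_cons, W_mul_apply, hact] at hneg
      obtain ⟨l1, k', l2, rfl, hk⟩ := ih h' hz hneg
      refine ⟨k :: l1, k', l2, rfl, fun y => ?_⟩
      rw [List.map_cons, List.prod_cons, W_mul_apply, hact, hk]
    · refine ⟨[], k, l, rfl, fun y => ?_⟩
      rw [← hsimple]; rfl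

omit [Finite ι] in
theorem cograd_eq (j : R.Node) : (R.cograd j : E) = (2 / ‖R.grad j‖ ^ 2) • R.grad j := by
  cases j with
  | none => simp [cograd, grad, R.coroot_eq]
  | some i => simp [cograd, grad, R.coroot_eq]

omit [Finite ι] in
-- The linear part of `h` is an isometry matching the gradients, hence also the coroots, so `h`
-- conjugates one reflection into the other.
theorem conj_simple {h : R.W} {j k : R.Node}
    (H : ∀ y, ev (R.simpleRoot j) (h.1 y) = ev (R.simpleRoot k) y) : R.s j * h = h * R.s k := by
  have hg : h.1.linear (R.grad k) = R.grad j := by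
    apply ext_inner_right ℝ
    intro v
    have h1 := H (h⁻¹.1.linear v)
    have h2 := H 0
    rw [W_apply, linear_inv_apply] at h1
    simp only [ev, simpleRoot, inner_add_right, inner_zero_right] at h1 h2
    rw [inner_linear_eq]
    linarith
  have hc : h.1.linear (R.cograd k) = R.cograd j := by
    have hn : ‖R.grad k‖ ^ 2 = ‖R.grad j‖ ^ 2 := by
      rw [← real_inner_self_eq_norm_sq, ← real_inner_self_eq_norm_sq, ← hg, linear_inner]
    rw [cograd_eq, cograd_eq, map_smul, hg, hn]
  apply R.W_ext
  intro y
  rw [W_mul_apply, W_mul_apply, s_apply, H, s_apply, R.W_apply h (y - _), map_sub, map_smul, hc,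
    R.W_apply h y]
  abel

/-- The stabilizer of a point of the alcove is generated by simple reflections, and the alcove
meets each orbit at most once. -/
theorem exists_word_of_mem_alcove : ∀ (n : ℕ) (l : List R.Node), l.length = n → ∀ {c : E},
    c ∈ R.alcove → (l.map R.s).prod.1 c ∈ R.alcove →
    ∃ l' : List R.Node, (∀ j ∈ l', ev (R.simpleRoot j) c = 0) ∧
      (l'.map R.s).prod = (l.map R.s).prod := by
  intro n
  induction n using Nat.strong_induction_on with
  | _ n ih =>
  intro l hl c hc hlc
  cases l with
  | nil => exact ⟨[], by simp, rfl⟩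
  | cons j l =>
    -- If `α_j` is negative at the image of `c` under the remaining letters, the exchange condition
    -- cancels `s_j` against one of them and the word shortens by two. Otherwise `α_j` is
    -- nonnegative both before and after applying `s_j`, hence zero: `s_j` fixes the image point,
    -- and the rest of the word is shorter.
    by_cases hneg : ev (R.simpleRoot j) ((l.map R.s).prod.1 c) < 0
    · obtain ⟨i, m, hpos, him⟩ := R.posAff_simple j
      have hneg' : ⟪R.P.root i, (l.map R.s).prod.1 c⟫ + (m : ℝ) < 0 := by
        rw [← him] at hneg; exact hneg
      obtain ⟨l1, k, l2, rfl, hk⟩ := R.exists_split_of_neg l hpos hc hneg'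
      have hconj : R.s j * (l1.map R.s).prod = (l1.map R.s).prod * R.s k :=
        R.conj_simple fun y => by rw [← hk, ← him]; rfl
      have hprod : ((j :: (l1 ++ k :: l2)).map R.s).prod = ((l1 ++ l2).map R.s).prod := by
        simp only [List.map_cons, List.map_append, List.prod_cons, List.prod_append]
        rw [← mul_assoc, hconj, mul_assoc, ← mul_assoc (R.s k), s_mul_self, one_mul]
      rw [hprod] at hlc ⊢
      refine ih _ ?_ (l1 ++ l2) rfl hc hlc
      rw [← hl]
      simp
    · push Not at hneg
      have h1 := hlc j
      rw [List.map_cons, List.prod_cons, W_mul_apply, ev_s] at h1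
      have h0 : ev (R.simpleRoot j) ((l.map R.s).prod.1 c) = 0 := by linarith
      rw [List.map_cons, List.prod_cons, W_mul_apply, s_apply, h0, zero_smul, sub_zero] at hlc
      obtain ⟨l', hl', hp⟩ := ih l.length (by rw [← hl]; simp) l rfl hc hlc
      have hfix : ∀ l' : List R.Node, (∀ j ∈ l', ev (R.simpleRoot j) c = 0) →
          (l'.map R.s).prod.1 c = c := by
        intro l'
        induction l' with
        | nil => intro _; rfl
        | cons a l' ih' =>
          intro h
          rw [List.map_cons, List.prod_cons, W_mul_apply,
            ih' fun j hj => h j (List.mem_cons_of_mem _ hj), s_apply, h a List.mem_cons_self]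
          simp
      refine ⟨j :: l', ?_, by simp [hp]⟩
      intro a ha
      rcases List.mem_cons.mp ha with rfl | ha
      · rw [← hp, hfix l' hl'] at h0; exact h0
      · exact hl' a ha

/-- A simple root takes at points of the orbit only values `α(y) + m` with `α` one of finitely many
roots and `m` an integer. On a ball these values are bounded, and the simple roots separate points.
-/
theorem orbit_inter_ball_finite (y : E) (C : ℝ) :
    {z : E | (∃ g : R.W, z = g.1 y) ∧ ‖z‖ ≤ C}.Finite := by
  have := Fintype.ofFinite ι
  set B : ℝ := ∑ k, ‖R.P.root k‖ with hB
  have hle : ∀ k, ‖R.P.root k‖ ≤ B := fun k =>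
    Finset.single_le_sum (f := fun k => ‖R.P.root k‖) (fun _ _ => norm_nonneg _) (Finset.mem_univ k)
  let S : Set ℝ := ⋃ k : ι, (fun m : ℤ => ⟪R.P.root k, y⟫ + (m : ℝ)) ''
    {m | |⟪R.P.root k, y⟫ + (m : ℝ)| ≤ B * C}
  have hS : S.Finite := by
    apply Set.finite_iUnion
    intro k
    apply Set.Finite.image
    apply (Set.finite_Icc ⌊-(B * C) - ⟪R.P.root k, y⟫⌋ ⌈B * C - ⟪R.P.root k, y⟫⌉).subset
    intro m hm
    rw [Set.mem_ofPred_eq, abs_le] at hm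
    constructor
    · rw [← Int.cast_le (R := ℝ)]
      exact (Int.floor_le _).trans (by linarith)
    · rw [← Int.cast_le (R := ℝ)]
      exact le_trans (by linarith) (Int.le_ceil _)
  have hfin : (Set.pi Set.univ fun _ : R.base.support => S).Finite :=
    Set.Finite.pi fun _ => hS
  apply Set.Finite.of_finite_image (f := fun z => fun i : R.base.support => ⟪R.P.root i, z⟫)
  · apply hfin.subset
    rintro - ⟨z, ⟨⟨g, rfl⟩, hz⟩, rfl⟩
    intro i _
    obtain ⟨k, m, hk⟩ := R.exists_affine_root g i 0
    have hk' := hk y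
    simp only [Int.cast_zero, add_zero] at hk'
    refine Set.mem_iUnion.mpr ⟨k, m, ?_, hk'.symm⟩
    rw [Set.mem_ofPred_eq, ← hk']
    refine (abs_real_inner_le_norm _ _).trans ?_
    exact mul_le_mul (hle _) hz (norm_nonneg _) ((norm_nonneg _).trans (hle i))
  · intro z _ w _ h
    rw [← sub_eq_zero]
    apply R.eq_zero_of_inner_simple_eq_zero
    intro i
    rw [inner_sub_right, sub_eq_zero]
    exact congrFun h i

omit [Finite ι] in
-- Reflecting `z` brings it closer to `p` exactly when `z` and `p` lie strictly on opposite sides of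
-- the hyperplane.
theorem norm_sub_reflection (j : R.Node) (z p : E) :
    ‖(R.s j).1 z - p‖ ^ 2 = ‖z - p‖ ^ 2
      + 4 / ‖R.grad j‖ ^ 2 * ev (R.simpleRoot j) z * ev (R.simpleRoot j) p := by
  have hg : 0 < ‖R.grad j‖ := by
    cases j with
    | none => rw [grad, norm_neg]; exact R.norm_root_pos _
    | some i => exact R.norm_root_pos _
  rw [s_apply, cograd_eq]
  set a := ev (R.simpleRoot j) z with ha
  have h1 : ev (R.simpleRoot j) p = a - ⟪R.grad j, z - p⟫ := by
    rw [ha]; simp only [ev, simpleRoot, inner_sub_right]; ring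
  have h2 : z - a • (2 / ‖R.grad j‖ ^ 2) • R.grad j - p
      = (z - p) - (a * (2 / ‖R.grad j‖ ^ 2)) • R.grad j := by
    rw [smul_smul]; abel
  rw [h1, h2, norm_sub_sq_real, norm_smul, inner_smul_right, real_inner_comm, mul_pow,
    Real.norm_eq_abs, sq_abs]
  field_simp
  ring

/-- A point of the orbit nearest to an interior point of the alcove lies in the alcove, by
`norm_sub_reflection`. -/
theorem exists_mem_alcove (y : E) : ∃ g : R.W, g.1 y ∈ R.alcove := by
  obtain ⟨p, hp⟩ := R.exists_interior
  set S := {z : E | (∃ g : R.W, z = g.1 y) ∧ ‖z - p‖ ≤ ‖y - p‖} with hS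
  have hfin : S.Finite := by
    apply (R.orbit_inter_ball_finite y (‖y - p‖ + ‖p‖)).subset
    rintro z ⟨hz, hz'⟩
    refine ⟨hz, ?_⟩
    calc ‖z‖ = ‖(z - p) + p‖ := by rw [sub_add_cancel]
      _ ≤ _ := (norm_add_le _ _).trans (by linarith)
  obtain ⟨z, ⟨⟨g, rfl⟩, hz⟩, hmin⟩ := Set.exists_min_image S (fun z => ‖z - p‖) hfin
    ⟨y, ⟨1, rfl⟩, le_rfl⟩
  refine ⟨g, fun j => ?_⟩
  by_contra! hneg
  have h1 := R.norm_sub_reflection j (g.1 y) p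
  have hg : 0 < ‖R.grad j‖ := by
    cases j with
    | none => rw [grad, norm_neg]; exact R.norm_root_pos _
    | some i => exact R.norm_root_pos _
  have h2 : 4 / ‖R.grad j‖ ^ 2 * ev (R.simpleRoot j) (g.1 y) * ev (R.simpleRoot j) p < 0 :=
    mul_neg_of_neg_of_pos (mul_neg_of_pos_of_neg (by positivity) hneg) (hp j)
  have h3 : ‖(R.s j).1 (g.1 y) - p‖ < ‖g.1 y - p‖ :=
    lt_of_pow_lt_pow_left₀ 2 (norm_nonneg _) (by linarith)
  have h4 := hmin ((R.s j).1 (g.1 y)) ⟨⟨R.s j * g, rfl⟩, (h3.le.trans hz)⟩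
  linarith

/-- The choice in `gmin` is a genuine one. What is used later is only that `𝐠_y⁻¹ y` lies in the
alcove: for `t ∈ 𝐓_O` and `y ∈ O` the element `𝐠_y t` does not depend on which representative is
taken. -/
theorem isMinRep_gmin (y : E) : R.IsMinRep y (R.gmin y) := by
  apply Classical.epsilon_spec (p := R.IsMinRep y)
  obtain ⟨g, hg⟩ := R.exists_mem_alcove y
  have hne : (R.length '' {h : R.W | h⁻¹.1 y ∈ R.alcove}).Nonempty :=
    ⟨_, g⁻¹, by rw [Set.mem_ofPred_eq, inv_inv]; exact hg, rfl⟩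
  obtain ⟨h, hh, hl⟩ := Nat.sInf_mem hne
  exact ⟨h, hh, fun h' hh' => by rw [hl]; exact Nat.sInf_le ⟨h', hh', rfl⟩⟩

theorem gmin_mem (y : E) : (R.gmin y)⁻¹.1 y ∈ R.alcove := (R.isMinRep_gmin y).1

end EuclideanRoots

namespace EuclideanRoots

variable {ι E : Type*} [NormedAddCommGroup E] [InnerProductSpace ℝ E] (R : EuclideanRoots ι E)
variable {F : Type*} [Field F] (q : Fˣ)

/-! ### The action of the affine Weyl group on the torus -/

theorem lin_mul (g h : R.W) (μ : R.Qv) : R.lin (g * h) μ = R.lin g (R.lin h μ) := rfl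

theorem lin_add (g : R.W) (μ ν : R.Qv) : R.lin g (μ + ν) = R.lin g μ + R.lin g ν :=
  Subtype.ext (map_add g.1.linear (μ : E) ν)

theorem lin_inv_lin (g : R.W) (μ : R.Qv) : R.lin g⁻¹ (R.lin g μ) = μ :=
  Subtype.ext (R.inv_linear_apply g μ)

/-- The action of `g ∈ W` on the torus. -/
def actT (g : R.W) (t : R.Torus F) : R.Torus F :=
  MonoidHom.mk' (fun μ => R.torusAct q g t μ.toAdd) fun μ ν => by
    have hq : R.qpow q ⟪g.1 0, ((μ.toAdd + ν.toAdd : R.Qv) : E)⟫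
        = R.qpow q ⟪g.1 0, (μ.toAdd : E)⟫ * R.qpow q ⟪g.1 0, (ν.toAdd : E)⟫ := by
      rw [AddSubgroup.coe_add, inner_add_right]
      exact R.qpow_add_inner q (R.trl g) (R.trl g) _ _
    simp only [torusAct, toAdd_mul, hq, lin_add, ofAdd_add, map_mul]
    exact mul_mul_mul_comm _ _ _ _

theorem actT_apply (g : R.W) (t : R.Torus F) (μ : R.Qv) :
    R.actT q g t (Multiplicative.ofAdd μ) = R.torusAct q g t μ := rfl

theorem actT_mul (g h : R.W) (t : R.Torus F) : R.actT q (g * h) t = R.actT q g (R.actT q h t) := by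
  refine MonoidHom.ext fun μ => ?_
  induction μ using Multiplicative.rec with | _ μ =>
  rw [actT_apply, actT_apply, torusAct, torusAct, actT_apply, torusAct, mul_inv_rev, lin_mul,
    ← mul_assoc]
  congr 1
  have h0 : (g * h).1 0 = g.1.linear (h.1 0) + g.1 0 := by rw [W_mul_apply, W_apply]
  have h1 : ⟪g.1.linear (h.1 0), (μ : E)⟫ = ⟪h.1 0, (R.lin g⁻¹ μ : E)⟫ := R.inner_linear_eq g _ _
  rw [h0, inner_add_left, h1, add_comm]
  exact R.qpow_add_inner q (R.trl g) (R.trl h) μ (R.lin g⁻¹ μ)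

theorem actT_one (t : R.Torus F) : R.actT q 1 t = t := by
  refine MonoidHom.ext fun μ => ?_
  induction μ using Multiplicative.rec with | _ μ =>
  rw [actT_apply, torusAct]
  have h0 : (1 : R.W).1 0 = 0 := rfl
  rw [h0, inner_zero_left, qpow_zero, one_mul, inv_one]
  rfl

theorem lin_s (j : R.Node) (μ : R.Qv) (m : ℤ) (hm : ⟪R.grad j, (μ : E)⟫ = (m : ℝ)) :
    R.lin (R.s j) μ = μ - m • R.cograd j := by
  apply Subtype.ext
  rw [AddSubgroup.coe_sub, AddSubgroup.coe_zsmul, ← Int.cast_smul_eq_zsmul ℝ, ← hm]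
  exact R.s_linear j μ

theorem qpow_s (j : R.Node) (μ : E) (m : ℤ) (hm : ⟪R.grad j, μ⟫ = (m : ℝ)) :
    R.qpow q ⟪(R.s j).1 0, μ⟫ = (q ^ R.cst j) ^ (-m) := by
  cases j with
  | none =>
    have h0 : (R.s none).1 0 = R.P.coroot R.highest := by
      rw [s_none, reflW_apply]; simp
    rw [h0, real_inner_comm, R.qpow_inner_coroot_highest q μ (-m)]
    · simp [cst]
    · rw [grad, inner_neg_left] at hm
      push_cast; linarith
  | some i =>
    have h0 : (R.s (some i)).1 0 = 0 := by
      rw [s_some, reflW_apply]; simp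
    rw [h0, inner_zero_left, qpow_zero]
    simp [cst]

theorem torusAct_s (j : R.Node) (t : R.Torus F) (μ : R.Qv) (m : ℤ)
    (hm : ⟪R.grad j, (μ : E)⟫ = (m : ℝ)) :
    R.torusAct q (R.s j) t μ = (q ^ R.cst j * t (Multiplicative.ofAdd (R.cograd j))) ^ (-m)
      * t (Multiplicative.ofAdd μ) := by
  rw [torusAct, R.qpow_s q j μ m hm, s_inv, R.lin_s j μ m hm, sub_eq_add_neg, ofAdd_add, map_mul,
    ← neg_smul, ofAdd_zsmul, map_zpow, mul_zpow]
  rw [mul_assoc, mul_comm (t (Multiplicative.ofAdd μ))]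

/-- `s_j` changes `t^μ` by a power of `t^(α_j^∨)`; the equations defining `𝐓_O` thus say that simple
reflections through `c` fix `t`. -/
theorem actT_s_eq_self (j : R.Node) (t : R.Torus F)
    (h : q ^ R.cst j * t (Multiplicative.ofAdd (R.cograd j)) = 1) : R.actT q (R.s j) t = t := by
  refine MonoidHom.ext fun μ => ?_
  induction μ using Multiplicative.rec with | _ μ =>
  obtain ⟨m, hm⟩ := R.grad_int j μ
  rw [actT_apply, R.torusAct_s q j t μ m hm, h, one_zpow, one_mul]

variable [Finite ι]

/-- Such a `g` is a product of simple reflections whose roots vanish at `c`, and each of them fixes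
both `c` and `t`. -/
theorem actT_eq_of_mem_alcove {O : Set E} {t : R.Torus F} (ht : t ∈ R.torusOf q O) {c : E}
    (hcO : c ∈ O) (hc : c ∈ R.alcove) (g : R.W) (hg : g.1 c ∈ R.alcove) :
    R.actT q g t = t ∧ g.1 c = c := by
  obtain ⟨l, rfl⟩ := R.exists_word g
  obtain ⟨l', hl', hp⟩ := R.exists_word_of_mem_alcove _ l rfl hc hg
  rw [← hp]
  clear hp hg
  induction l' with
  | nil => exact ⟨R.actT_one q t, rfl⟩
  | cons j l' ih =>
    obtain ⟨h1, h2⟩ := ih fun a ha => hl' a (List.mem_cons_of_mem _ ha)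
    have hj := hl' j List.mem_cons_self
    rw [List.map_cons, List.prod_cons, actT_mul, W_mul_apply, h1, h2]
    refine ⟨R.actT_s_eq_self q j t (ht c ⟨hcO, hc⟩ j hj), ?_⟩
    rw [s_apply, hj, zero_smul, sub_zero]

/-- The torus element `𝐠_y t`. -/
def tpt (t : R.Torus F) (y : E) : R.Torus F := R.actT q (R.gmin y) t

/-- The element `𝐠_(gy)⁻¹ g 𝐠_y` maps the alcove point of `O` into the alcove, so it fixes `t`. -/
theorem tpt_smul {O : Set E} (hO : R.IsOrbit O) {t : R.Torus F} (ht : t ∈ R.torusOf q O) {y : E}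
    (hy : y ∈ O) (g : R.W) : R.tpt q t (g.1 y) = R.actT q g (R.tpt q t y) := by
  have hc := R.gmin_mem y
  have hcO : (R.gmin y)⁻¹.1 y ∈ O := by
    obtain ⟨y0, rfl⟩ := hO
    obtain ⟨h, rfl⟩ := hy
    exact ⟨(R.gmin (h.1 y0))⁻¹ * h, rfl⟩
  have h1 := (R.actT_eq_of_mem_alcove q ht hcO hc ((R.gmin (g.1 y))⁻¹ * g * R.gmin y) (by
    rw [W_mul_apply, W_apply_inv_self, W_mul_apply]
    exact R.gmin_mem _)).1
  rw [tpt, tpt, ← actT_mul]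
  conv_lhs => rw [← h1, ← actT_mul]
  congr 1
  group

omit [Finite ι] in
/-- A torus element killing the simple coroots that vanish at `c` kills every element of the cone
of simple roots that vanishes at `c`. -/
theorem torus_eq_one_of_inCone {t : R.Torus F} {c : E}
    (hc : ∀ i : R.base.support, 0 ≤ ⟪R.P.root i, c⟫)
    (ht : ∀ i : R.base.support, ⟪R.P.root i, c⟫ = 0 →
      t (Multiplicative.ofAdd (R.cograd (some i))) = 1)
    (lam : R.Qv) (hlam : R.InCone (lam : E)) (h0 : ⟪(lam : E), c⟫ = 0) :
    t (Multiplicative.ofAdd lam) = 1 := by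
  obtain ⟨n, rfl⟩ := R.coroot_mem_simple_span lam
  obtain ⟨f, hf, hfe⟩ := hlam
  have hz : ∀ i, f i = 0 ∨ ⟪R.P.root i, c⟫ = 0 := by
    rw [hfe, sum_inner] at h0
    have := (Finset.sum_eq_zero_iff_of_nonneg (fun i _ => by
      rw [inner_smul_left]; exact mul_nonneg (hf i) (hc i))).mp h0
    intro i
    have h1 := this i (Finset.mem_univ i)
    rw [inner_smul_left] at h1
    exact mul_eq_zero.mp h1
  have hn : (fun i => (n i : ℝ) * (2 / ‖R.P.root i‖ ^ 2)) = f := by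
    apply R.simple_coeff_eq
    rw [← hfe]
    push_cast
    refine Finset.sum_congr rfl fun i _ => ?_
    rw [← Int.cast_smul_eq_zsmul ℝ]
    simp only [cograd]
    rw [R.coroot_eq, smul_smul]
  rw [ofAdd_sum, map_prod]
  apply Finset.prod_eq_one
  intro i _
  rw [ofAdd_zsmul, map_zpow]
  rcases hz i with h | h
  · rw [← hn] at h
    have hp := R.norm_root_pos i
    have : n i = 0 := by
      rcases mul_eq_zero.mp h with h1 | h1
      · exact_mod_cast h1
      · exact absurd h1 (by positivity)
    rw [this, zpow_zero]
  · rw [ht i h, one_zpow]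

omit [Finite ι] in
-- Since `|α| ≤ 1` on the alcove, `m` is `0` or `±1`. For `m = 0`, up to sign `α^∨` lies in the cone
-- and vanishes at `c`. For `m = 1`, `α(c) = -1` forces `φ(c) = 1`, so the condition at `α_0`
-- applies, and it remains to kill `φ^∨ + α^∨`. Because `α` and `φ` have equal length this is a
-- positive multiple of `φ + α`, again in the cone and vanishing at `c`. The case `m = -1` follows
-- by passing to `-α`.
theorem torus_long_root {O : Set E} {t : R.Torus F} (ht : t ∈ R.torusOf q O) {c : E}
    (hcO : c ∈ O) (hc : c ∈ R.alcove) (i : ι) (hi : ‖R.P.root i‖ = ‖R.P.root R.highest‖) (m : ℤ)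
    (h0 : ⟪R.P.root i, c⟫ + (m : ℝ) = 0) :
    q ^ m * t (Multiplicative.ofAdd ⟨R.P.coroot i, R.coroot_mem i⟩) = 1 := by
  have hs := R.alcove_simple hc
  have hk : ∀ i : R.base.support, ⟪R.P.root i, c⟫ = 0 →
      t (Multiplicative.ofAdd (R.cograd (some i))) = 1 := by
    intro i h
    have := ht c ⟨hcO, hc⟩ (some i) (by simpa [ev, simpleRoot, grad, cst] using h)
    simpa [cst] using this
  have hp := R.norm_root_pos R.highest
  have hco : ∀ i, ‖R.P.root i‖ = ‖R.P.root R.highest‖ →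
      R.P.coroot i = (2 / ‖R.P.root R.highest‖ ^ 2) • R.P.root i := fun i hi => by
    rw [R.coroot_eq, hi]
  have hr : 0 ≤ 2 / ‖R.P.root R.highest‖ ^ 2 := by positivity
  have habs := R.abs_inner_le_one hc i
  have key : ∀ i, ‖R.P.root i‖ = ‖R.P.root R.highest‖ → R.InCone (R.P.root i) →
      ⟪R.P.root i, c⟫ = 0 → t (Multiplicative.ofAdd ⟨R.P.coroot i, R.coroot_mem i⟩) = 1 := by
    intro i hi hcone h
    apply R.torus_eq_one_of_inCone hs hk
    · change R.InCone (R.P.coroot i)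
      rw [hco i hi]; exact InCone.smul R hcone hr
    · simp only [hco i hi, inner_smul_left, h, mul_zero]
  have key1 : ∀ i, ‖R.P.root i‖ = ‖R.P.root R.highest‖ → ⟪R.P.root i, c⟫ = -1 →
      q * t (Multiplicative.ofAdd ⟨R.P.coroot i, R.coroot_mem i⟩) = 1 := by
    intro i hi h
    have h1 := InCone.inner_nonneg R (R.inCone_highest_add i) hs
    rw [inner_add_left, h] at h1
    have h2 := R.alcove_highest hc
    have h3 : ⟪R.P.root R.highest, c⟫ = 1 := by linarith
    have h4 := ht c ⟨hcO, hc⟩ none (by simp [ev, simpleRoot, grad, cst, h3])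
    have h5 : t (Multiplicative.ofAdd
        (⟨R.P.coroot R.highest, R.coroot_mem _⟩ + ⟨R.P.coroot i, R.coroot_mem i⟩ : R.Qv)) = 1 := by
      apply R.torus_eq_one_of_inCone hs hk
      · rw [AddSubgroup.coe_add]
        simp only [hco i hi, hco _ rfl, ← smul_add]
        exact InCone.smul R (R.inCone_highest_add i) hr
      · rw [AddSubgroup.coe_add]
        simp only [hco i hi, hco _ rfl, ← smul_add, inner_smul_left, inner_add_left, h, h3]
        simp
    rw [ofAdd_add, map_mul] at h5
    have h6 : R.cograd none = -⟨R.P.coroot R.highest, R.coroot_mem _⟩ := rfl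
    rw [h6, ofAdd_neg, map_inv] at h4
    have hc1 : R.cst none = 1 := rfl
    rw [hc1, zpow_one] at h4
    rw [mul_inv_eq_one.mp h4, h5]
  have hm : m = 0 ∨ m = 1 ∨ m = -1 := by
    have h1 : ⟪R.P.root i, c⟫ = -(m : ℝ) := by linarith
    rw [h1, abs_neg] at habs
    have : |m| ≤ 1 := by exact_mod_cast habs
    rw [abs_le] at this
    omega
  have hneg : (⟨R.P.coroot (R.P.reflectionPerm i i), R.coroot_mem _⟩ : R.Qv)
      = -⟨R.P.coroot i, R.coroot_mem i⟩ := Subtype.ext (R.coroot_neg i)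
  have hneg' : ‖R.P.root (R.P.reflectionPerm i i)‖ = ‖R.P.root R.highest‖ := by
    rw [root_neg, norm_neg, hi]
  rcases hm with rfl | rfl | rfl
  · rw [zpow_zero, one_mul]
    have h0' : ⟪R.P.root i, c⟫ = 0 := by simpa using h0
    rcases R.inCone_root_or_neg i with h | h
    · exact key i hi h h0'
    · have := key (R.P.reflectionPerm i i) hneg' (by rwa [root_neg])
        (by rw [root_neg, inner_neg_left, h0', neg_zero])
      rw [hneg, ofAdd_neg, map_inv, inv_eq_one] at this
      exact this
  · rw [zpow_one]
    exact key1 i hi (by push_cast at h0; linarith)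
  · have := key1 (R.P.reflectionPerm i i) hneg' (by
      rw [root_neg, inner_neg_left]; push_cast at h0; linarith)
    rw [hneg, ofAdd_neg, map_inv, mul_inv_eq_one] at this
    rw [zpow_neg, zpow_one, this, inv_mul_cancel]

/-- If `φ` takes an integer value `n` at `y ∈ O`, then `(𝐠_y t)^(φ^∨) = q_φ^n`. -/
theorem tpt_highest {O : Set E} (hO : R.IsOrbit O) {t : R.Torus F} (ht : t ∈ R.torusOf q O) {y : E}
    (hy : y ∈ O) (n : ℤ) (hn : ⟪R.P.root R.highest, y⟫ = (n : ℝ)) :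
    R.tpt q t y (Multiplicative.ofAdd ⟨R.P.coroot R.highest, R.coroot_mem _⟩) = q ^ n := by
  set g := R.gmin y with hg
  have hc := R.gmin_mem y
  have hcO : (R.gmin y)⁻¹.1 y ∈ O := by
    obtain ⟨y0, rfl⟩ := hO
    obtain ⟨h, rfl⟩ := hy
    exact ⟨(R.gmin (h.1 y0))⁻¹ * h, rfl⟩
  rw [← hg] at hc hcO
  obtain ⟨i, hi1, hi2⟩ := R.linear_coroot g⁻¹ R.highest
  obtain ⟨l, hl⟩ := R.inner_root_int R.highest (R.trl g)
  have hl' : ⟪R.P.root R.highest, g.1 0⟫ = (l : ℝ) := hl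
  have hnorm : ‖R.P.root i‖ = ‖R.P.root R.highest‖ := by
    have := R.linear_inner g⁻¹ (R.P.root R.highest) (R.P.root R.highest)
    rw [hi1, real_inner_self_eq_norm_sq, real_inner_self_eq_norm_sq] at this
    exact (sq_eq_sq₀ (norm_nonneg _) (norm_nonneg _)).mp this
  -- The affine root `φ - n` vanishes at `y`; its pullback by `𝐠_y` is an affine root of the same
  -- length vanishing at the alcove point.
  have h0 : ⟪R.P.root i, g⁻¹.1 y⟫ + ((l - n : ℤ) : ℝ) = 0 := by
    have h1 : y = g.1.linear (g⁻¹.1 y) + g.1 0 := by rw [← W_apply, W_apply_inv_self]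
    have h2 := hn
    rw [h1, inner_add_right, hl'] at h2
    rw [← hi1, inner_linear_eq, inv_inv, Int.cast_sub]
    linarith
  have h1 := R.torus_long_root q ht hcO hc i hnorm (l - n) h0
  rw [tpt, ← hg, actT_apply, torusAct]
  have h2 : R.lin g⁻¹ ⟨R.P.coroot R.highest, R.coroot_mem _⟩ = ⟨R.P.coroot i, R.coroot_mem i⟩ :=
    Subtype.ext hi2
  rw [h2, R.qpow_inner_coroot_highest q _ l hl']
  have h3 : q ^ l = q ^ n * q ^ (l - n) := by rw [← zpow_add]; congr 1; ring
  rw [h3, mul_assoc, h1, mul_one]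

/-! ### The orbit of the origin -/

omit [Finite ι] in
theorem exists_translation (μ : R.Qv) : ∃ g : R.W, ∀ y, g.1 y = y + (μ : E) := by
  obtain ⟨v, hv⟩ := μ
  induction hv using AddSubgroup.closure_induction with
  | mem x hx =>
    obtain ⟨i, rfl⟩ := hx
    refine ⟨R.reflW i (-1) * R.reflW i 0, fun y => ?_⟩
    rw [W_mul_apply]
    simp only [reflW_apply, inner_sub_right, inner_smul_right, inner_root_coroot_self]
    push_cast
    module
  | zero => exact ⟨1, fun y => (add_zero y).symm⟩
  | add x y _ _ hx hy =>
    obtain ⟨g, hg⟩ := hx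
    obtain ⟨h, hh⟩ := hy
    refine ⟨g * h, fun z => ?_⟩
    rw [W_mul_apply, hg, hh]
    simp only
    abel
  | neg x _ hx =>
    obtain ⟨g, hg⟩ := hx
    refine ⟨g⁻¹, fun y => ?_⟩
    have : y = g.1 (y + -x) := by rw [hg]; simp
    conv_lhs => rw [this, W_inv_apply_self]

omit [Finite ι] in
theorem IsOrbit.smul_mem {O : Set E} (hO : R.IsOrbit O) {y : E} (hy : y ∈ O) (g : R.W) :
    g.1 y ∈ O := by
  obtain ⟨y0, rfl⟩ := hO
  obtain ⟨h, rfl⟩ := hy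
  exact ⟨g * h, rfl⟩

omit [Finite ι] in
theorem IsOrbit.add_mem {O : Set E} (hO : R.IsOrbit O) {y : E} (hy : y ∈ O) (μ : R.Qv) :
    y + (μ : E) ∈ O := by
  obtain ⟨g, hg⟩ := R.exists_translation μ
  rw [← hg]
  exact IsOrbit.smul_mem R hO hy g

omit [Finite ι] in
theorem Qv_isOrbit : R.IsOrbit (R.Qv : Set E) := by
  refine ⟨0, ?_⟩
  ext v
  constructor
  · intro hv
    obtain ⟨g, hg⟩ := R.exists_translation ⟨v, hv⟩
    exact ⟨g, by simp [hg]⟩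
  · rintro ⟨g, rfl⟩
    exact (R.trl g).2

omit [Finite ι] in
theorem zero_mem_alcove : (0 : E) ∈ R.alcove := by
  intro j
  cases j <;> simp [ev, simpleRoot, cst]

/-- The alcove meets `Q^∨` only in `0`, where exactly the nodes `1, …, r` vanish, and their coroots
generate `Q^∨`. -/
theorem torusOf_Qv : R.torusOf (F := F) q (R.Qv : Set E) = {1} := by
  ext t
  rw [Set.mem_singleton_iff]
  constructor
  · intro ht
    refine MonoidHom.ext fun μ => ?_
    induction μ using Multiplicative.rec with | _ μ =>
    obtain ⟨n, rfl⟩ := R.coroot_mem_simple_span μ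
    rw [ofAdd_sum, map_prod]
    apply Finset.prod_eq_one
    intro i _
    have := ht 0 ⟨R.Qv.zero_mem, R.zero_mem_alcove⟩ (some i) (by
      simp [ev, simpleRoot, cst])
    simp only [cst, zpow_zero, one_mul] at this
    rw [ofAdd_zsmul, map_zpow, this, one_zpow]
  · rintro rfl c ⟨hcQ, hc⟩ j hj
    obtain ⟨g, hg⟩ := R.exists_translation ⟨c, hcQ⟩
    have h0 : c = g.1 0 := by simp [hg]
    obtain ⟨l, rfl⟩ := R.exists_word g
    obtain ⟨l', hl', hp⟩ := R.exists_word_of_mem_alcove _ l rfl R.zero_mem_alcove (h0 ▸ hc)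
    have hfix : ∀ l' : List R.Node, (∀ j ∈ l', ev (R.simpleRoot j) 0 = 0) →
        (l'.map R.s).prod.1 0 = 0 := by
      intro l'
      induction l' with
      | nil => intro _; rfl
      | cons a l' ih =>
        intro h
        rw [List.map_cons, List.prod_cons, W_mul_apply,
          ih fun j hj => h j (List.mem_cons_of_mem _ hj), s_apply, h a List.mem_cons_self]
        simp
    rw [← hp, hfix l' hl'] at h0
    subst h0
    cases j with
    | none => simp [ev, simpleRoot, cst] at hj
    | some i => simp [cst]

end EuclideanRoots

/-! ### Parity floors and indicator functions -/

theorem floorE_add_even (s : ℝ) (n : ℤ) : floorE (s + (2 * n : ℤ)) = floorE s + 2 * n := by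
  have : (s + (2 * n : ℤ)) / 2 = s / 2 + n := by push_cast; ring
  rw [floorE, floorE, this, Int.floor_add_intCast]; ring

theorem floorO_add_even (s : ℝ) (n : ℤ) : floorO (s + (2 * n : ℤ)) = floorO s + 2 * n := by
  have : (s + (2 * n : ℤ) + 1) / 2 = (s + 1) / 2 + n := by push_cast; ring
  rw [floorO, floorO, this, Int.floor_add_intCast]; ring

/-- An odd shift exchanges the two parity floors, and below also `χ_e` with `χ_o`; the even and odd
truncated operators then trade places. -/
theorem floorE_add_odd (s : ℝ) (n : ℤ) :
    floorE (s + (2 * n + 1 : ℤ)) = floorO s + (2 * n + 1) := by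
  have : (s + (2 * n + 1 : ℤ)) / 2 = (s + 1) / 2 + n := by push_cast; ring
  rw [floorE, floorO, this, Int.floor_add_intCast]; ring

theorem floorO_add_odd (s : ℝ) (n : ℤ) :
    floorO (s + (2 * n + 1 : ℤ)) = floorE s + (2 * n + 1) := by
  have : (s + (2 * n + 1 : ℤ) + 1) / 2 = s / 2 + (n + 1 : ℤ) := by push_cast; ring
  rw [floorE, floorO, this, Int.floor_add_intCast]; ring

theorem chiE_of_even {s : ℝ} (n : ℤ) (h : s = 2 * n) : chiE s = 1 := if_pos ⟨n, h⟩

theorem chiO_of_odd {s : ℝ} (n : ℤ) (h : s = 2 * n + 1) : chiO s = 1 := if_pos ⟨n, h⟩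

theorem chiE_of_odd {s : ℝ} (n : ℤ) (h : s = 2 * n + 1) : chiE s = 0 := by
  apply if_neg
  rintro ⟨m, hm⟩
  rw [h] at hm
  have : 2 * n + 1 = 2 * m := by exact_mod_cast hm
  omega

theorem chiO_of_even {s : ℝ} (n : ℤ) (h : s = 2 * n) : chiO s = 0 := by
  apply if_neg
  rintro ⟨m, hm⟩
  rw [h] at hm
  have : 2 * n = 2 * m + 1 := by exact_mod_cast hm
  omega

theorem chiE_of_not_int {s : ℝ} (h : ∀ n : ℤ, s ≠ n) : chiE s = 0 := by
  apply if_neg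
  rintro ⟨m, hm⟩
  exact h (2 * m) (by push_cast; exact hm)

theorem chiO_of_not_int {s : ℝ} (h : ∀ n : ℤ, s ≠ n) : chiO s = 0 := by
  apply if_neg
  rintro ⟨m, hm⟩
  exact h (2 * m + 1) (by push_cast; exact hm)

theorem chiE_add_even (s : ℝ) (n : ℤ) : chiE (s + (2 * n : ℤ)) = chiE s := by
  have : (∃ m : ℤ, s + (2 * n : ℤ) = 2 * m) ↔ ∃ m : ℤ, s = 2 * m :=
    ⟨fun ⟨m, h⟩ => ⟨m - n, by push_cast at *; linarith⟩,
      fun ⟨m, h⟩ => ⟨m + n, by push_cast at *; linarith⟩⟩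
  classical exact if_congr this rfl rfl

theorem chiO_add_even (s : ℝ) (n : ℤ) : chiO (s + (2 * n : ℤ)) = chiO s := by
  have : (∃ m : ℤ, s + (2 * n : ℤ) = 2 * m + 1) ↔ ∃ m : ℤ, s = 2 * m + 1 :=
    ⟨fun ⟨m, h⟩ => ⟨m - n, by push_cast at *; linarith⟩,
      fun ⟨m, h⟩ => ⟨m + n, by push_cast at *; linarith⟩⟩
  classical exact if_congr this rfl rfl

theorem chiE_add_odd (s : ℝ) (n : ℤ) : chiE (s + (2 * n + 1 : ℤ)) = chiO s := by
  have : (∃ m : ℤ, s + (2 * n + 1 : ℤ) = 2 * m) ↔ ∃ m : ℤ, s = 2 * m + 1 :=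
    ⟨fun ⟨m, h⟩ => ⟨m - n - 1, by push_cast at *; linarith⟩,
      fun ⟨m, h⟩ => ⟨m + n + 1, by push_cast at *; linarith⟩⟩
  classical exact if_congr this rfl rfl

theorem chiO_add_odd (s : ℝ) (n : ℤ) : chiO (s + (2 * n + 1 : ℤ)) = chiE s := by
  have : (∃ m : ℤ, s + (2 * n + 1 : ℤ) = 2 * m + 1) ↔ ∃ m : ℤ, s = 2 * m :=
    ⟨fun ⟨m, h⟩ => ⟨m - n, by push_cast at *; linarith⟩,
      fun ⟨m, h⟩ => ⟨m + n, by push_cast at *; linarith⟩⟩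
  classical exact if_congr this rfl rfl

theorem floorE_of_mem_Ico {s : ℝ} (h0 : 0 ≤ s) (h1 : s < 2) : floorE s = 0 := by
  have : ⌊s / 2⌋ = 0 := by rw [Int.floor_eq_iff]; constructor <;> push_cast <;> linarith
  rw [floorE, this]; rfl

theorem floorE_of_neg {s : ℝ} (h0 : -2 ≤ s) (h1 : s < 0) : floorE s = -2 := by
  have : ⌊s / 2⌋ = -1 := by rw [Int.floor_eq_iff]; constructor <;> push_cast <;> linarith
  rw [floorE, this]; rfl

theorem floorO_of_mem_Ico {s : ℝ} (h0 : -1 ≤ s) (h1 : s < 1) : floorO s = -1 := by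
  have : ⌊(s + 1) / 2⌋ = 0 := by rw [Int.floor_eq_iff]; constructor <;> push_cast <;> linarith
  rw [floorO, this]; rfl

theorem floorO_one : floorO 1 = 1 := by norm_num [floorO]

/-! ### The group algebra as a domain -/

/-- A real vector space is a rational one, hence has unique sums, which makes its group algebra a
domain. This allows cancelling `1 - x^(2 α_j^∨)` throughout. -/
theorem noZeroDivisors_groupAlgebra (F E : Type*) [Field F] [AddCommGroup E] [Module ℝ E] :
    NoZeroDivisors (AddMonoidAlgebra F E) := by
  have : Module ℚ E := Module.compHom E (algebraMap ℚ ℝ)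
  infer_instance

theorem mon_mul_mon {F E : Type*} [Field F] [AddCommGroup E] (x y : E) :
    mon F x * mon F y = mon F (x + y) := by
  simp [mon, AddMonoidAlgebra.single_mul_single]

namespace EuclideanRoots

variable {ι E : Type*} [NormedAddCommGroup E] [InnerProductSpace ℝ E] (R : EuclideanRoots ι E)
variable {F : Type*} [Field F] (q : Fˣ)

theorem grad_ne_zero (j : R.Node) : R.grad j ≠ 0 := by
  intro h
  have := R.inner_grad_cograd j
  rw [h, inner_zero_left] at this
  norm_num at this

theorem cograd_ne_zero (j : R.Node) : (R.cograd j : E) ≠ 0 := by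
  intro h
  have := R.inner_grad_cograd j
  rw [h, inner_zero_right] at this
  norm_num at this

theorem one_sub_xPow_two_ne_zero (j : R.Node) : 1 - R.xPow q j 2 ≠ 0 := by
  rw [sub_ne_zero, AddMonoidAlgebra.one_def, xPow]
  intro h
  have h1 := congrArg (fun p => p.coeff 0) h
  have h2 : (2 : ℤ) • (R.cograd j : E) ≠ 0 := by
    rw [← Int.cast_smul_eq_zsmul ℝ]
    exact smul_ne_zero (by norm_num) (R.cograd_ne_zero j)
  simp [h2] at h1

theorem cancel_one_sub {j : R.Node} {a b : AddMonoidAlgebra F E}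
    (h : (1 - R.xPow q j 2) * a = (1 - R.xPow q j 2) * b) : a = b := by
  have := noZeroDivisors_groupAlgebra F E
  exact mul_left_cancel₀ (R.one_sub_xPow_two_ne_zero q j) h

/-! ### The twisted action -/

/-- Since `W` contains the translations by `Q^∨`, the linear part of an element of `W` is again in
`W`. Orbits are therefore stable under linear parts, as `twAct` requires. -/
theorem exists_linear_mem (g : R.W) : ∃ w : R.W, ∀ y, w.1 y = g.1.linear y := by
  obtain ⟨h, hh⟩ := R.exists_translation (-R.trl g)
  refine ⟨h * g, fun y => ?_⟩
  rw [W_mul_apply, hh, W_apply]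
  change _ + g.1 0 + -(g.1 0) = _
  abel

theorem IsOrbit.linear_mem {O : Set E} (hO : R.IsOrbit O) {y : E} (hy : y ∈ O) (g : R.W) :
    g.1.linear y ∈ O := by
  obtain ⟨w, hw⟩ := R.exists_linear_mem g
  rw [← hw]
  exact IsOrbit.smul_mem R hO hy w

/-- The scalar in `g_t x^y`. -/
def twc (t : R.Torus F) (g : R.W) (y : E) : Fˣ :=
  R.torusAct q (R.gmin (g.1.linear y)) t (-R.trl g)

theorem twAct_eq (t : R.Torus F) (g : R.W) (y : E) :
    R.twAct q t g y = AddMonoidAlgebra.single (g.1.linear y) (R.twc q t g y : F) := rfl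

theorem twc_eq (t : R.Torus F) (g : R.W) (y : E) :
    R.twc q t g y = R.tpt q t (g.1.linear y) (Multiplicative.ofAdd (-R.trl g)) := rfl

variable [Finite ι] {O : Set E} (hO : R.IsOrbit O) {t : R.Torus F} (ht : t ∈ R.torusOf q O)

include hO ht

theorem tpt_linear {y : E} (hy : y ∈ O) (g : R.W) (ν : R.Qv) :
    R.tpt q t (g.1.linear y) (Multiplicative.ofAdd (R.lin g ν))
      = R.tpt q t y (Multiplicative.ofAdd ν) := by
  obtain ⟨w, hw⟩ := R.exists_linear_mem g
  have h0 : w.1 0 = 0 := by rw [hw, map_zero]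
  have hlin : R.lin w ν = R.lin g ν := Subtype.ext (by
    have := R.W_apply w ν
    rw [h0, add_zero, hw] at this
    exact this.symm)
  rw [← hw, R.tpt_smul q hO ht hy, actT_apply, torusAct, h0, inner_zero_left, qpow_zero, one_mul,
    ← hlin, lin_inv_lin]

theorem tpt_add {y : E} (hy : y ∈ O) (μ ν : R.Qv) :
    R.tpt q t (y + μ) (Multiplicative.ofAdd ν)
      = R.qpow q ⟪(μ : E), (ν : E)⟫ * R.tpt q t y (Multiplicative.ofAdd ν) := by
  obtain ⟨w, hw⟩ := R.exists_translation μ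
  have hlin : ∀ ν, R.lin w ν = ν := fun ν => Subtype.ext (by
    have := R.W_apply w ν
    rw [hw, hw, zero_add] at this
    exact (add_right_cancel this).symm)
  rw [← hw, R.tpt_smul q hO ht hy, actT_apply, torusAct, hw, zero_add]
  congr 3
  conv_lhs => rw [← hlin ν]
  rw [lin_inv_lin]

/-- This cocycle identity makes the twisted action an action. The translation part of `gh` is that
of `g` plus the `g`-image of that of `h`, and equivariance of `y ↦ 𝐠_y t` moves the latter back to
the point where `h` acts. -/
theorem twc_mul (g h : R.W) {y : E} (hy : y ∈ O) :
    R.twc q t (g * h) y = R.twc q t g (h.1.linear y) * R.twc q t h y := by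
  have htr : -R.trl (g * h) = -R.trl g + R.lin g (-R.trl h) := by
    have : R.trl (g * h) = R.lin g (R.trl h) + R.trl g := Subtype.ext (by
      change (g * h).1 0 = _
      rw [W_mul_apply, W_apply]; rfl)
    rw [this, neg_add_rev]
    congr 1
    exact Subtype.ext (map_neg g.1.linear _).symm
  rw [twc_eq, twc_eq, twc_eq, htr, ofAdd_add, map_mul, W_mul_linear,
    R.tpt_linear q hO ht (IsOrbit.linear_mem R hO hy h)]

/-- On integral walls the twist is invisible. For `j = 0` this is the value `(𝐠_y t)^(φ^∨) = q_φ^n`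
from `tpt_highest`; for `j ≥ 1` there is no translation part. -/
theorem twc_s_of_int (j : R.Node) {y : E} (hy : y ∈ O) (m : ℤ) (hm : ⟪R.grad j, y⟫ = (m : ℝ)) :
    R.twc q t (R.s j) y = (q ^ R.cst j) ^ (-m) := by
  cases j with
  | none =>
    have h0 : -R.trl (R.s none) = -⟨R.P.coroot R.highest, R.coroot_mem _⟩ := by
      congr 1
      apply Subtype.ext
      change (R.s none).1 0 = _
      rw [s_none, reflW_apply]; simp
    rw [twc_eq, h0, ofAdd_neg, map_inv,
      R.tpt_highest q hO ht (IsOrbit.linear_mem R hO hy _) m]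
    · simp [cst]
    · rw [s_linear, inner_sub_right, inner_smul_right]
      have h2 := R.inner_root_coroot_self R.highest
      simp only [grad, cograd, AddSubgroup.coe_neg, inner_neg_left, inner_neg_right] at hm ⊢
      rw [h2]; linarith
  | some i =>
    have h0 : -R.trl (R.s (some i)) = 0 := by
      rw [neg_eq_zero]
      apply Subtype.ext
      change (R.s (some i)).1 0 = _
      rw [s_some, reflW_apply]; simp
    rw [twc_eq, h0, ofAdd_zero, map_one]
    simp [cst]

theorem twc_s_add (j : R.Node) {y : E} (hy : y ∈ O) (μ : R.Qv) (m : ℤ)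
    (hm : ⟪R.grad j, (μ : E)⟫ = (m : ℝ)) :
    R.twc q t (R.s j) (y + μ) = (q ^ R.cst j) ^ (-m) * R.twc q t (R.s j) y := by
  rw [twc_eq, twc_eq, map_add]
  have h1 : (R.s j).1.linear (μ : E) = (R.lin (R.s j) μ : E) := rfl
  rw [h1, R.tpt_add q hO ht (IsOrbit.linear_mem R hO hy _)]
  congr 1
  have h2 : ⟪(R.lin (R.s j) μ : E), ((-R.trl (R.s j) : R.Qv) : E)⟫
      = ⟪(R.s j).1 0, (μ : E)⟫ := by
    change ⟪(R.s j).1.linear (μ : E), -((R.s j).1 0)⟫ = _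
    rw [inner_linear_eq, s_inv]
    have : (R.s j).1.linear ((R.s j).1 0) + (R.s j).1 0 = 0 := by
      rw [← W_apply, ← W_mul_apply, s_mul_self]; rfl
    rw [map_neg, eq_neg_of_add_eq_zero_left this, neg_neg, real_inner_comm]
  rw [h2]
  exact R.qpow_s q j μ m hm

theorem twc_s_s (j : R.Node) {y : E} (hy : y ∈ O) :
    R.twc q t (R.s j) ((R.s j).1.linear y) * R.twc q t (R.s j) y = 1 := by
  rw [← R.twc_mul q hO ht _ _ hy, s_mul_self, twc_eq]
  have : -R.trl (1 : R.W) = 0 := by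
    rw [neg_eq_zero]; rfl
  rw [this, ofAdd_zero, map_one]

theorem twAct_s_of_int (j : R.Node) {y : E} (hy : y ∈ O) (m : ℤ) (hm : ⟪R.grad j, y⟫ = (m : ℝ)) :
    R.twAct q t (R.s j) y = R.xPow q j (-m) * mon F y := by
  rw [twAct_eq, R.twc_s_of_int q hO ht j hy m hm, s_linear, hm, xPow, mon,
    AddMonoidAlgebra.single_mul_single, mul_one, neg_smul, Int.cast_smul_eq_zsmul, sub_eq_neg_add]

theorem twAct_s_add (j : R.Node) {y : E} (hy : y ∈ O) (μ : R.Qv) (m : ℤ)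
    (hm : ⟪R.grad j, (μ : E)⟫ = (m : ℝ)) :
    R.twAct q t (R.s j) (y + μ) = R.xPow q j (-m) * mon F (μ : E) * R.twAct q t (R.s j) y := by
  rw [twAct_eq, twAct_eq, R.twc_s_add q hO ht j hy μ m hm, s_linear, s_linear, inner_add_right, hm,
    xPow, mon, AddMonoidAlgebra.single_mul_single, mul_one, AddMonoidAlgebra.single_mul_single,
    Units.val_mul]
  congr 1
  rw [neg_smul, ← Int.cast_smul_eq_zsmul ℝ]
  module

end EuclideanRoots

/-! ### Quasi-polynomials -/

section QuasiPol

variable {F E : Type*} [Field F]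

theorem mon_mem {Z : Set E} {y : E} (hy : y ∈ Z) : mon F y ∈ quasiPol F Z :=
  Submodule.subset_span (Set.mem_image_of_mem _ hy)

theorem single_eq_smul_mon (y : E) (c : F) : AddMonoidAlgebra.single y c = c • mon F y := by
  simp [mon]

theorem single_mem {Z : Set E} {y : E} (hy : y ∈ Z) (c : F) :
    AddMonoidAlgebra.single y c ∈ quasiPol F Z := by
  rw [single_eq_smul_mon]
  exact Submodule.smul_mem _ _ (mon_mem hy)

theorem qmon_induction {Z : Set E} {K : Submodule F (quasiPol F Z)}
    (h : ∀ y (hy : y ∈ Z), qmon F y hy ∈ K) (v : quasiPol F Z) : v ∈ K := by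
  obtain ⟨v, hv⟩ := v
  induction hv using Submodule.span_induction with
  | mem x hx => obtain ⟨y, hy, rfl⟩ := hx; exact h y hy
  | zero => exact K.zero_mem
  | add x y _ _ hx hy => exact K.add_mem hx hy
  | smul c x _ hx => exact K.smul_mem c hx

theorem end_ext {Z : Set E} {f g : Module.End F (quasiPol F Z)}
    (h : ∀ y (hy : y ∈ Z), f (qmon F y hy) = g (qmon F y hy)) : f = g := by
  refine LinearMap.ext fun v => ?_
  exact qmon_induction (K := LinearMap.ker (f - g))
    (fun y hy => by rw [LinearMap.mem_ker, LinearMap.sub_apply, h, sub_self]) v |>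
    fun hv => sub_eq_zero.mp hv

end QuasiPol

/-! ### Multiplication by `F[Q^∨]`, truncated divided differences under translation, and the
operators on `F[O]`. -/

namespace EuclideanRoots

variable {ι E : Type*} [NormedAddCommGroup E] [InnerProductSpace ℝ E] (R : EuclideanRoots ι E)
variable {F : Type*} [Field F] (q : Fˣ)

/-- The inclusion of `F[Q^∨]` in `F[E]` as an algebra homomorphism. -/
def inclHom : AddMonoidAlgebra F R.Qv →ₐ[F] AddMonoidAlgebra F E :=
  AddMonoidAlgebra.mapDomainAlgHom F F R.Qv.subtype

theorem inclHom_apply (p : AddMonoidAlgebra F R.Qv) : R.inclHom p = R.incl p := rfl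

theorem inclHom_single (μ : R.Qv) (c : F) :
    R.inclHom (AddMonoidAlgebra.single μ c) = AddMonoidAlgebra.single (μ : E) c := by
  rw [inclHom_apply, incl, AddMonoidAlgebra.mapDomain_single]

theorem inclHom_mon (μ : R.Qv) : R.inclHom (mon F μ) = mon F (μ : E) := R.inclHom_single μ 1

theorem inclHom_xPowQ (j : R.Node) (m : ℤ) : R.inclHom (R.xPowQ q j m) = R.xPow q j m := by
  rw [xPowQ, inclHom_single]; rfl

theorem inclHom_xSimple (j : R.Node) : R.inclHom (R.xSimple q j) = R.xPow q j 1 := by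
  rw [← xPowQ_one, inclHom_xPowQ]

theorem xPow_two (j : R.Node) : R.xPow q j 2 = R.xPow q j 1 ^ 2 := by
  rw [sq, ← xPow_add]; norm_num

theorem inclHom_mul_mem {O : Set E} (hO : R.IsOrbit O) (p : AddMonoidAlgebra F R.Qv)
    {v : AddMonoidAlgebra F E} (hv : v ∈ quasiPol F O) : R.inclHom p * v ∈ quasiPol F O := by
  induction hv using Submodule.span_induction with
  | mem x hx =>
    obtain ⟨y, hy, rfl⟩ := hx
    induction p using AddMonoidAlgebra.induction_linear with
    | zero => simp
    | add p p' hp hp' => rw [map_add, add_mul]; exact Submodule.add_mem _ hp hp'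
    | single μ c =>
      rw [inclHom_single, mon, AddMonoidAlgebra.single_mul_single, mul_one, add_comm]
      exact single_mem (IsOrbit.add_mem R hO hy μ) c
  | zero => simp
  | add x y _ _ hx hy => rw [mul_add]; exact Submodule.add_mem _ hx hy
  | smul c x _ hx => rw [mul_smul_comm]; exact Submodule.smul_mem _ _ hx

/-- The quotient already exists in `F[Q^∨]`, so the truncated operators preserve `F[O]`. -/
theorem exists_nablaE_eq (j : R.Node) (y : E) :
    ∃ p : AddMonoidAlgebra F R.Qv, R.nablaE q j y = R.inclHom p * mon F y := by
  obtain ⟨p, hp⟩ := one_sub_dvd (R.xPowQ q j) (R.xPowQ_zero q j) (R.xPowQ_add q j) 2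
    (-⌊⟪R.grad j, y⟫ / 2⌋)
  refine ⟨p, R.cancel_one_sub q (j := j) ?_⟩
  have hp' := congrArg R.inclHom hp
  simp only [map_mul, map_sub, map_one, inclHom_xPowQ] at hp'
  rw [nablaE_spec, ← mul_assoc, ← hp', floorE, mul_neg]

theorem exists_nablaO_eq (j : R.Node) (y : E) :
    ∃ p : AddMonoidAlgebra F R.Qv, R.nablaO q j y = R.inclHom p * mon F y := by
  obtain ⟨p, hp⟩ := one_sub_dvd (R.xPowQ q j) (R.xPowQ_zero q j) (R.xPowQ_add q j) 2
    (-⌊(⟪R.grad j, y⟫ + 1) / 2⌋)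
  refine ⟨R.xPowQ q j 1 * p, R.cancel_one_sub q (j := j) ?_⟩
  have hp' := congrArg R.inclHom hp
  simp only [map_mul, map_sub, map_one, inclHom_xPowQ] at hp'
  rw [nablaO_spec, map_mul, inclHom_xPowQ, mul_assoc, mul_left_comm, ← mul_assoc (1 - _), ← hp',
    ← mul_assoc, mul_sub, mul_one, ← xPow_add, floorO]
  congr 4
  ring

theorem nablaE_add_even (j : R.Node) (y : E) (μ : R.Qv) (n : ℤ)
    (hm : ⟪R.grad j, (μ : E)⟫ = ((2 * n : ℤ) : ℝ)) :
    (1 - R.xPow q j 2) * R.nablaE q j (y + μ)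
      = (1 - R.xPow q j (-(2 * n)) * R.xPow q j (-floorE ⟪R.grad j, y⟫))
        * (mon F (μ : E) * mon F y) := by
  rw [nablaE_spec, inner_add_right, hm, floorE_add_even, mon_mul_mon, ← xPow_add, add_comm y]
  congr 3; ring_nf

theorem nablaO_add_even (j : R.Node) (y : E) (μ : R.Qv) (n : ℤ)
    (hm : ⟪R.grad j, (μ : E)⟫ = ((2 * n : ℤ) : ℝ)) :
    (1 - R.xPow q j 2) * R.nablaO q j (y + μ)
      = (R.xPow q j 1 - R.xPow q j (-(2 * n)) * R.xPow q j (-floorO ⟪R.grad j, y⟫))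
        * (mon F (μ : E) * mon F y) := by
  rw [nablaO_spec, inner_add_right, hm, floorO_add_even, mon_mul_mon, ← xPow_add, add_comm y]
  congr 3; ring_nf

theorem nablaE_add_odd (j : R.Node) (y : E) (μ : R.Qv) (n : ℤ)
    (hm : ⟪R.grad j, (μ : E)⟫ = ((2 * n + 1 : ℤ) : ℝ)) :
    (1 - R.xPow q j 2) * R.nablaE q j (y + μ)
      = (1 - R.xPow q j (-(2 * n + 1)) * R.xPow q j (-floorO ⟪R.grad j, y⟫))
        * (mon F (μ : E) * mon F y) := by
  rw [nablaE_spec, inner_add_right, hm, floorE_add_odd, mon_mul_mon, ← xPow_add, add_comm y]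
  congr 3; ring_nf

theorem nablaO_add_odd (j : R.Node) (y : E) (μ : R.Qv) (n : ℤ)
    (hm : ⟪R.grad j, (μ : E)⟫ = ((2 * n + 1 : ℤ) : ℝ)) :
    (1 - R.xPow q j 2) * R.nablaO q j (y + μ)
      = (R.xPow q j 1 - R.xPow q j (-(2 * n + 1)) * R.xPow q j (-floorE ⟪R.grad j, y⟫))
        * (mon F (μ : E) * mon F y) := by
  rw [nablaO_spec, inner_add_right, hm, floorO_add_odd, mon_mul_mon, ← xPow_add, add_comm y]
  congr 3; ring_nf

/-! ### Truncated Demazure--Lusztig operators with general parameters -/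

/-- An orbit, a point `t` of the corresponding torus, and Hecke parameters at the nodes satisfying
the two compatibility conditions used below. -/
structure HeckeData (O : Set E) where
  κ : R.Node → Fˣ
  υ : R.Node → Fˣ
  t : R.Torus F
  orbit : R.IsOrbit O
  mem : t ∈ R.torusOf q O
  even : ∀ j, υ j = κ j ∨ ∀ μ : R.Qv, ∃ n : ℤ, ⟪R.grad j, (μ : E)⟫ = ((2 * n : ℤ) : ℝ)
  conj : ∀ i j, ⟪R.grad i, (R.cograd j : E)⟫ = -1 → ⟪R.grad j, (R.cograd i : E)⟫ = -1 →
    κ i = κ j ∧ υ i = υ j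

/-- The truncated Demazure--Lusztig expression with parameters `a, b` and leading part `lead`. -/
def dl (a b : Fˣ) (j : R.Node) (y : E) (lead : AddMonoidAlgebra F E) : AddMonoidAlgebra F E :=
  ((a : F) ^ chiE ⟪R.grad j, y⟫ * (b : F) ^ chiO ⟪R.grad j, y⟫) • lead
    + ((a : F) - (a : F)⁻¹) • R.nablaE q j y
    + ((b : F) - (b : F)⁻¹) • R.nablaO q j y

namespace HeckeData

variable {R q} {O : Set E} (D : R.HeckeData q O)

/-- The image of `x^y` under `T_j`. -/
def val (j : R.Node) (y : E) : AddMonoidAlgebra F E :=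
  R.dl q (D.κ j) (D.υ j) j y (R.twAct q D.t (R.s j) y)

theorem val_mem (j : R.Node) {y : E} (hy : y ∈ O) : D.val j y ∈ quasiPol F O := by
  obtain ⟨p, hp⟩ := R.exists_nablaE_eq q j y
  obtain ⟨p', hp'⟩ := R.exists_nablaO_eq q j y
  rw [val, dl, hp, hp']
  exact Submodule.add_mem _ (Submodule.add_mem _
    (Submodule.smul_mem _ _ (single_mem (IsOrbit.linear_mem R D.orbit hy _) _))
    (Submodule.smul_mem _ _ (R.inclHom_mul_mem D.orbit p (mon_mem hy))))
    (Submodule.smul_mem _ _ (R.inclHom_mul_mem D.orbit p' (mon_mem hy)))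

/-- The extension of `T_j` to `F[E]`. -/
def opE (j : R.Node) : AddMonoidAlgebra F E →ₗ[F] AddMonoidAlgebra F E :=
  (AddMonoidAlgebra.basis E F).constr F (D.val j)

theorem opE_mon (j : R.Node) (y : E) : D.opE j (mon F y) = D.val j y := by
  have : mon F y = AddMonoidAlgebra.basis E F y := rfl
  rw [opE, this, Module.Basis.constr_basis]

/-- The truncated Demazure--Lusztig operator `T_j` on `F[O]`. -/
def op (j : R.Node) : Module.End F (quasiPol F O) :=
  (D.opE j).restrict fun v hv => by
    induction hv using Submodule.span_induction with
    | mem x hx =>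
      obtain ⟨y, hy, rfl⟩ := hx
      rw [opE_mon]
      exact D.val_mem j hy
    | zero => simp
    | add x y _ _ hx hy => rw [map_add]; exact Submodule.add_mem _ hx hy
    | smul c x _ hx => rw [map_smul]; exact Submodule.smul_mem _ _ hx

theorem op_qmon (j : R.Node) {y : E} (hy : y ∈ O) :
    (D.op j (qmon F y hy) : AddMonoidAlgebra F E) = D.val j y := D.opE_mon j y

/-- Multiplication by elements of `F[Q^∨]` on `F[O]`. -/
def mul : AddMonoidAlgebra F R.Qv →ₐ[F] Module.End F (quasiPol F O) :=
  AlgHom.ofLinearMap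
    { toFun := fun p => (LinearMap.mulLeft F (R.inclHom p)).restrict
        fun _ hv => R.inclHom_mul_mem D.orbit p hv
      map_add' := fun p p' => LinearMap.ext fun v => Subtype.ext (by
        change R.inclHom (p + p') * _ = R.inclHom p * _ + R.inclHom p' * _
        rw [map_add, add_mul])
      map_smul' := fun c p => LinearMap.ext fun v => Subtype.ext (by
        change R.inclHom (c • p) * _ = c • (R.inclHom p * _)
        rw [map_smul, smul_mul_assoc]) }
    (LinearMap.ext fun v => Subtype.ext (by
        change R.inclHom 1 * _ = _
        rw [map_one, one_mul]; rfl))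
    fun p p' => LinearMap.ext fun v => Subtype.ext (by
        change R.inclHom (p * p') * _ = R.inclHom p * (R.inclHom p' * _)
        rw [map_mul, mul_assoc])

theorem mul_apply (p : AddMonoidAlgebra F R.Qv) (v : quasiPol F O) :
    (D.mul p v : AddMonoidAlgebra F E) = R.inclHom p * v := rfl

theorem mul_mon_qmon (μ : R.Qv) {y : E} (hy : y ∈ O) :
    D.mul (mon F μ) (qmon F y hy) = qmon F (y + μ) (IsOrbit.add_mem R D.orbit hy μ) := by
  apply Subtype.ext
  rw [mul_apply, inclHom_mon]
  change mon F (μ : E) * mon F y = mon F (y + μ)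
  rw [mon_mul_mon, add_comm]

variable [Finite ι]

/-- The quotient-free form of the commutation relation between `T_j` and `x^μ`. -/
theorem val_add (j : R.Node) {y : E} (hy : y ∈ O) (μ : R.Qv) (m : ℤ)
    (hm : ⟪R.grad j, (μ : E)⟫ = (m : ℝ)) :
    (1 - R.xPow q j 2) * (D.val j (y + μ)
      - R.xPow q j (-m) * mon F (μ : E) * D.val j y)
    = (((D.κ j : F) - (D.κ j : F)⁻¹) • 1 + ((D.υ j : F) - (D.υ j : F)⁻¹) • R.xPow q j 1)
      * ((1 - R.xPow q j (-m)) * mon F (μ : E) * mon F y) := by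
  have hE := R.nablaE_spec q j y
  have hO := R.nablaO_spec q j y
  have hS := R.twAct_s_add q D.orbit D.mem j hy μ m hm
  set S := R.twAct q D.t (R.s j) y
  have hev : (∃ n, m = 2 * n) ∨ D.υ j = D.κ j := by
    rcases D.even j with h | h
    · exact Or.inr h
    · obtain ⟨n, hn⟩ := h μ
      exact Or.inl ⟨n, by rw [hm] at hn; exact_mod_cast hn⟩
  -- The leading terms cancel in both cases. For even `m` each truncated operator at `y + μ` is
  -- compared with itself at `y`; for odd `m` the even one is compared with the odd one, which is
  -- possible because the two parameters then coincide.
  rcases Int.even_or_odd' m with ⟨n, rfl | rfl⟩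
  · have hE' := R.nablaE_add_even (F := F) q j y μ n hm
    have hO' := R.nablaO_add_even (F := F) q j y μ n hm
    rw [val, val, dl, dl, hS, inner_add_right, hm, chiE_add_even, chiO_add_even]
    simp only [Algebra.smul_def, map_mul, map_pow]
    linear_combination algebraMap F _ ((D.κ j : F) - (D.κ j : F)⁻¹) * hE'
      + algebraMap F _ ((D.υ j : F) - (D.υ j : F)⁻¹) * hO'
      - algebraMap F _ ((D.κ j : F) - (D.κ j : F)⁻¹)
        * R.xPow q j (-(2 * n)) * mon F (μ : E) * hE
      - algebraMap F _ ((D.υ j : F) - (D.υ j : F)⁻¹)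
        * R.xPow q j (-(2 * n)) * mon F (μ : E) * hO
  · have hk : D.υ j = D.κ j := by
      rcases hev with ⟨l, hl⟩ | h
      · omega
      · exact h
    have hE' := R.nablaE_add_odd (F := F) q j y μ n hm
    have hO' := R.nablaO_add_odd (F := F) q j y μ n hm
    rw [val, val, dl, dl, hS, inner_add_right, hm, chiE_add_odd, chiO_add_odd, hk]
    simp only [Algebra.smul_def, map_mul, map_pow]
    linear_combination algebraMap F _ ((D.κ j : F) - (D.κ j : F)⁻¹) * hE'
      + algebraMap F _ ((D.κ j : F) - (D.κ j : F)⁻¹) * hO'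
      - algebraMap F _ ((D.κ j : F) - (D.κ j : F)⁻¹)
        * R.xPow q j (-(2 * n + 1)) * mon F (μ : E) * hE
      - algebraMap F _ ((D.κ j : F) - (D.κ j : F)⁻¹)
        * R.xPow q j (-(2 * n + 1)) * mon F (μ : E) * hO

/-- Any `p` satisfying the multiplied-out equation is admitted, so that the cross terms of both
algebras, and explicit quotients, can be inserted. -/
theorem op_mul_mon (j : R.Node) (μ : R.Qv) (p : AddMonoidAlgebra F R.Qv)
    (hp : (1 - R.xSimple q j ^ 2) * p
      = (algebraMap F _ ((D.κ j : F) - (D.κ j : F)⁻¹)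
        + algebraMap F _ ((D.υ j : F) - (D.υ j : F)⁻¹) * R.xSimple q j)
        * (mon F μ - R.wAct q (R.s j) μ)) :
    D.op j * D.mul (mon F μ) = D.mul (R.wAct q (R.s j) μ) * D.op j + D.mul p := by
  obtain ⟨m, hm⟩ := R.grad_int j μ
  have hw : R.wAct q (R.s j) μ = R.xPowQ q j (-m) * mon F μ := by
    rw [R.wAct_simple q j μ m hm, xPowQ, mon, AddMonoidAlgebra.single_mul_single, mul_one,
      neg_smul, sub_eq_neg_add]
  apply end_ext
  intro y hy
  apply Subtype.ext
  have hp' := congrArg R.inclHom hp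
  rw [hw] at hp' ⊢
  simp only [map_mul, map_sub, map_add, map_one, map_pow, inclHom_xPowQ, inclHom_xSimple,
    inclHom_mon, AlgHom.commutes, ← xPow_two] at hp'
  rw [Module.End.mul_apply, mul_mon_qmon, op_qmon, LinearMap.add_apply, Submodule.coe_add,
    Module.End.mul_apply, mul_apply, op_qmon, mul_apply, map_mul, inclHom_xPowQ, inclHom_mon]
  apply R.cancel_one_sub q (j := j)
  have h := D.val_add j hy μ m hm
  change _ = (1 - R.xPow q j 2) * (_ + R.inclHom p * mon F y)
  simp only [Algebra.smul_def, map_sub] at *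
  linear_combination h - hp' * mon F y

end HeckeData
end EuclideanRoots

/-! ### Quotient-free special cases of the cross relation. -/

namespace EuclideanRoots

variable {ι E : Type*} [NormedAddCommGroup E] [InnerProductSpace ℝ E] {R : EuclideanRoots ι E}
variable {F : Type*} [Field F] {q : Fˣ}

theorem end_mul_sub_algebraMap {E F : Type*} [Field F] {Z : Set E}
    (a b : Module.End F (quasiPol F Z)) (c : F) :
    a * (b - algebraMap F _ c) = a * b - c • a := by
  refine (mul_sub a b _).trans ?_
  rw [← Algebra.commutes, ← Algebra.smul_def]

namespace HeckeData

variable {O : Set E} (D : R.HeckeData q O)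

/-- The scalar `k_j - k_j⁻¹`. -/
def kp (j : R.Node) : F := (D.κ j : F) - (D.κ j : F)⁻¹

/-- The scalar `u_j - u_j⁻¹`. -/
def up (j : R.Node) : F := (D.υ j : F) - (D.υ j : F)⁻¹

theorem υ_eq_of_odd {j : R.Node} {μ : R.Qv} (n : ℤ)
    (hm : ⟪R.grad j, (μ : E)⟫ = ((2 * n + 1 : ℤ) : ℝ)) : D.υ j = D.κ j := by
  rcases D.even j with h | h
  · exact h
  · obtain ⟨m, h⟩ := h μ
    rw [hm] at h
    have : 2 * n + 1 = 2 * m := by exact_mod_cast h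
    omega

theorem wAct_eq (j : R.Node) (μ : R.Qv) (m : ℤ) (hm : ⟪R.grad j, (μ : E)⟫ = (m : ℝ)) :
    R.wAct q (R.s j) μ = R.xPowQ q j (-m) * mon F μ := by
  rw [R.wAct_simple q j μ m hm, xPowQ, mon, AddMonoidAlgebra.single_mul_single, mul_one,
    neg_smul, sub_eq_neg_add]

theorem xPowQ_neg_one_mul (j : R.Node) : R.xPowQ q j (-1) * R.xSimple q j = 1 := by
  rw [← xPowQ_one, ← xPowQ_add]; exact R.xPowQ_zero q j

theorem xPowQ_eq_smul (j : R.Node) (n : ℤ) :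
    R.xPowQ q j n = (((q ^ R.cst j) ^ n : Fˣ) : F) • mon F (n • R.cograd j) := by
  rw [xPowQ, single_eq_smul_mon]

variable [Finite ι]

theorem op_mul_mon_of_zero (j : R.Node) {μ : R.Qv} (hm : ⟪R.grad j, (μ : E)⟫ = 0) :
    D.op j * D.mul (mon F μ) = D.mul (mon F μ) * D.op j := by
  have hw := wAct_eq (q := q) (R := R) j μ 0 (by simpa using hm)
  rw [neg_zero, xPowQ_zero, one_mul] at hw
  have := D.op_mul_mon j μ 0 (by rw [hw]; simp)
  rwa [hw, map_zero, add_zero] at this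

/-- In view of the quadratic relation, `T_j - (κ_j - κ_j⁻¹)` is the inverse of `T_j`: at weights of
pairing `1` the relation reads `T_j x^μ = s_j(x^μ) T_j⁻¹`. Oddness of the pairing makes the two
parameters equal. -/
theorem op_mul_mon_of_one (j : R.Node) {μ : R.Qv} (hm : ⟪R.grad j, (μ : E)⟫ = 1) :
    D.op j * D.mul (mon F μ)
      = D.mul (R.xPowQ q j (-1) * mon F μ) * (D.op j - algebraMap F _ (D.kp j)) := by
  have hk := D.υ_eq_of_odd (j := j) (μ := μ) 0 (by simpa using hm)
  have hw := wAct_eq (q := q) (R := R) j μ 1 (by simpa using hm)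
  -- With equal parameters the cross term is `(κ - κ⁻¹) x^μ (1 - z⁻¹) / (1 - z)` with `z =
  -- x^(α_j^∨)`, which equals `-(κ - κ⁻¹) z⁻¹ x^μ`.
  have := D.op_mul_mon j μ (-(D.kp j • (R.xPowQ q j (-1) * mon F μ))) (by
    rw [hw, hk, Algebra.smul_def, kp]
    linear_combination (-(algebraMap F _ ((D.κ j : F) - (D.κ j : F)⁻¹)) * mon F μ
      - algebraMap F _ ((D.κ j : F) - (D.κ j : F)⁻¹) * mon F μ * R.xSimple q j)
      * (-xPowQ_neg_one_mul (q := q) (R := R) j))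
  rw [this, hw, map_neg, map_smul, end_mul_sub_algebraMap]
  exact (sub_eq_add_neg _ _).symm

/-- In the same spirit: `T_j x^(α_j^∨) = x^(-α_j^∨) T_j⁻¹ - (υ_j - υ_j⁻¹)`. The second parameter
enters the stability arguments only through this additive constant. -/
theorem op_mul_xPowQ_one (j : R.Node) :
    D.op j * D.mul (R.xPowQ q j 1)
      = D.mul (R.xPowQ q j (-1)) * (D.op j - algebraMap F _ (D.kp j))
        - algebraMap F _ (D.up j) := by
  have hm : ⟪R.grad j, (R.cograd j : E)⟫ = ((2 : ℤ) : ℝ) := by simp [R.inner_grad_cograd j]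
  have hw := wAct_eq (q := q) (R := R) j (R.cograd j) 2 hm
  have h1 : R.xPowQ q j (-2) = R.xPowQ q j (-1) * R.xPowQ q j (-1) := by
    rw [← xPowQ_add]; norm_num
  set c : F := ((q ^ R.cst j : Fˣ) : F) with hc
  have hx : R.xSimple q j = algebraMap F _ c * mon F (R.cograd j) := by
    rw [← xPowQ_one, xPowQ_eq_smul, zpow_one, one_smul, Algebra.smul_def]
  have hc0 : algebraMap F (AddMonoidAlgebra F R.Qv) c * algebraMap F _ c⁻¹ = 1 := by
    rw [← map_mul, mul_inv_cancel₀ (Units.ne_zero _), map_one]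
  have h2 := xPowQ_neg_one_mul (q := q) (R := R) j
  -- The scalar `c` compares the bare monomial with `z = x^(α_j^∨)`, which carries a factor `q_φ`
  -- for `j = 0`. The witness is the quotient `(a + b z)(z - z⁻¹) / (1 - z²) = -(a z⁻¹ + b)`,
  -- rescaled by `c⁻¹`.
  have := D.op_mul_mon j (R.cograd j)
    (algebraMap F _ c⁻¹ * -(D.kp j • R.xPowQ q j (-1) + D.up j • 1)) (by
      rw [hw, h1, Algebra.smul_def, Algebra.smul_def, kp, up]
      have h3 : mon F (R.cograd j) = algebraMap F _ c⁻¹ * R.xSimple q j := by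
        rw [hx]; linear_combination -mon F (R.cograd j) * hc0
      rw [h3]
      generalize algebraMap F (AddMonoidAlgebra F R.Qv) ((D.κ j : F) - (D.κ j : F)⁻¹) = a
      generalize algebraMap F (AddMonoidAlgebra F R.Qv) ((D.υ j : F) - (D.υ j : F)⁻¹) = b
      generalize algebraMap F (AddMonoidAlgebra F R.Qv) c⁻¹ = d
      generalize R.xPowQ q j (-1) = w at *
      generalize R.xSimple q j = x at *
      linear_combination (a * d * x + a * d * w + d * b + d * b * x * w) * h2 )
  have hX : R.xPowQ q j 1 = algebraMap F _ c * mon F (R.cograd j) := by rw [xPowQ_one, hx]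
  rw [hX, map_mul, AlgHom.commutes, ← mul_assoc, ← Algebra.commutes, mul_assoc, this, hw, mul_add,
    ← AlgHom.commutes D.mul, ← mul_assoc, ← map_mul, ← map_mul]
  have h4 : algebraMap F (AddMonoidAlgebra F R.Qv) c * (R.xPowQ q j (-2) * mon F (R.cograd j))
      = R.xPowQ q j (-1) := by
    rw [h1]; linear_combination -(R.xPowQ q j (-1))^2 * hx + R.xPowQ q j (-1) * h2
  rw [h4, ← mul_assoc, hc0, one_mul, map_neg, map_add, map_smul, map_smul, map_one,
    end_mul_sub_algebraMap, Algebra.algebraMap_eq_smul_one]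
  abel

theorem op_mul_xPowQ_neg_one (j : R.Node) :
    D.op j * D.mul (R.xPowQ q j (-1))
      = D.mul (R.xPowQ q j 1) * D.op j + D.kp j • D.mul (R.xPowQ q j (-1))
        + algebraMap F _ (D.up j) := by
  have hm : ⟪R.grad j, ((-R.cograd j : R.Qv) : E)⟫ = ((-2 : ℤ) : ℝ) := by
    simp [R.inner_grad_cograd j]
  have hw := wAct_eq (q := q) (R := R) j (-R.cograd j) (-2) hm
  rw [neg_neg] at hw
  have h1 : R.xPowQ q j 2 = R.xPowQ q j 1 * R.xPowQ q j 1 := by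
    rw [← xPowQ_add]; norm_num
  set c : F := ((q ^ R.cst j : Fˣ) : F)⁻¹ with hc
  have hx : R.xPowQ q j (-1) = algebraMap F _ c * mon F (-R.cograd j) := by
    rw [xPowQ_eq_smul, zpow_neg, zpow_one, neg_smul, one_smul, Algebra.smul_def,
      Units.val_inv_eq_inv_val]
  have hc0 : algebraMap F (AddMonoidAlgebra F R.Qv) c * algebraMap F _ c⁻¹ = 1 := by
    rw [← map_mul, mul_inv_cancel₀ (inv_ne_zero (Units.ne_zero _)), map_one]
  have h2 := xPowQ_neg_one_mul (q := q) (R := R) j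
  rw [← xPowQ_one] at h2
  have := D.op_mul_mon j (-R.cograd j)
    (algebraMap F _ c⁻¹ * (D.kp j • R.xPowQ q j (-1) + D.up j • 1)) (by
      rw [hw, h1, Algebra.smul_def, Algebra.smul_def, kp, up]
      have h3 : mon F (-R.cograd j) = algebraMap F _ c⁻¹ * R.xPowQ q j (-1) := by
        rw [hx]; linear_combination -mon F (-R.cograd j) * hc0
      rw [h3, ← xPowQ_one]
      generalize algebraMap F (AddMonoidAlgebra F R.Qv) ((D.κ j : F) - (D.κ j : F)⁻¹) = a
      generalize algebraMap F (AddMonoidAlgebra F R.Qv) ((D.υ j : F) - (D.υ j : F)⁻¹) = b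
      generalize algebraMap F (AddMonoidAlgebra F R.Qv) c⁻¹ = d
      generalize R.xPowQ q j (-1) = w at *
      generalize R.xPowQ q j 1 = x at *
      linear_combination (d * b * x ^ 2 - d * b) * h2 )
  rw [hx, map_mul, AlgHom.commutes, ← mul_assoc, ← Algebra.commutes, mul_assoc, this, hw, mul_add,
    ← AlgHom.commutes D.mul, ← mul_assoc, ← map_mul, ← map_mul, ← map_mul, ← hx]
  have h4 : algebraMap F (AddMonoidAlgebra F R.Qv) c * (R.xPowQ q j 2 * mon F (-R.cograd j))
      = R.xPowQ q j 1 := by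
    rw [h1]; linear_combination -(R.xPowQ q j 1)^2 * hx + R.xPowQ q j 1 * h2
  rw [h4, ← mul_assoc, hc0, one_mul, map_add, map_smul, map_smul, map_one,
     Algebra.algebraMap_eq_smul_one, add_assoc]

end HeckeData
end EuclideanRoots

namespace EuclideanRoots

variable {ι E : Type*} [NormedAddCommGroup E] [InnerProductSpace ℝ E] {R : EuclideanRoots ι E}
variable {F : Type*} [Field F] {q : Fˣ}

namespace HeckeData

variable {O : Set E} (D : R.HeckeData q O)

/-! ### The operators on quasi-monomials near the wall -/

/-- The factor by which `T_j` scales the reflected quasi-monomial at a point where the gradient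
of `α_j` has value `a ∈ [0, 1]`. -/
def wallFactor (j : R.Node) (a : ℝ) : Fˣ :=
  open scoped Classical in if a = 0 then D.κ j else if a = 1 then (D.υ j)⁻¹ else 1

/-- `s_{j,t} x^y` as an element of `F[O]`. -/
def refl (j : R.Node) (y : E) (hy : y ∈ O) : quasiPol F O :=
  (R.twc q D.t (R.s j) y : F) • qmon F ((R.s j).1.linear y) (IsOrbit.linear_mem R D.orbit hy _)

theorem coe_refl (j : R.Node) (y : E) (hy : y ∈ O) :
    (D.refl j y hy : AddMonoidAlgebra F E) = R.twAct q D.t (R.s j) y := by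
  rw [twAct_eq, single_eq_smul_mon]; rfl

variable [Finite ι]

/-- On `[0, 1)` both truncated quotients vanish and only the leading term is left. At the value `1`
the odd quotient contributes `-(υ - υ⁻¹)` times the reflected monomial, turning the factor `υ` into
`υ⁻¹`. -/
theorem op_qmon_of_nonneg (j : R.Node) {y : E} (hy : y ∈ O) (h0 : 0 ≤ ⟪R.grad j, y⟫)
    (h1 : ⟪R.grad j, y⟫ ≤ 1) :
    D.op j (qmon F y hy) = (D.wallFactor j ⟪R.grad j, y⟫ : F) • D.refl j y hy := by
  apply Subtype.ext
  rw [op_qmon, val, dl, Submodule.coe_smul, coe_refl]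
  have hE : R.nablaE q j y = (0 : AddMonoidAlgebra F E) := by
    apply R.cancel_one_sub q (j := j)
    rw [nablaE_spec, floorE_of_mem_Ico h0 (by linarith), neg_zero, xPow_zero, sub_self, zero_mul,
      mul_zero]
  rcases h1.lt_or_eq with h1 | h1
  · have hO : R.nablaO q j y = (0 : AddMonoidAlgebra F E) := by
      apply R.cancel_one_sub q (j := j)
      rw [nablaO_spec, floorO_of_mem_Ico (by linarith) h1, neg_neg, sub_self, zero_mul,
        mul_zero]
    rw [hE, hO, smul_zero, smul_zero, add_zero, add_zero]
    congr 1
    rw [wallFactor]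
    split_ifs with h h'
    · rw [h, chiE_of_even 0 (by simp), chiO_of_even 0 (by simp), pow_one, pow_zero, mul_one]
    · exact absurd h' h1.ne
    · have : ∀ n : ℤ, ⟪R.grad j, y⟫ ≠ n := by
        intro n hn
        have h2 : (0 : ℝ) < n := hn ▸ lt_of_le_of_ne h0 (Ne.symm h)
        have h3 : (n : ℝ) < 1 := hn ▸ h1
        have h4 : 0 < n := by exact_mod_cast h2
        have h5 : n < 1 := by exact_mod_cast h3
        omega
      rw [chiE_of_not_int this, chiO_of_not_int this, pow_zero, pow_zero, mul_one, Units.val_one]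
  · have hS := R.twAct_s_of_int q D.orbit D.mem j hy 1 (by simp [h1])
    -- At the value `1` the odd quotient is `(z - z⁻¹) / (1 - z²) = -z⁻¹`, and `z⁻¹ x^y` is the
    -- twisted reflection because the value is integral.
    have hO : R.nablaO q j y = -R.twAct q D.t (R.s j) y := by
      apply R.cancel_one_sub q (j := j)
      rw [nablaO_spec, h1, floorO_one, hS]
      have : R.xPow q j 1 = R.xPow q j 2 * R.xPow q j (-1) := by rw [← xPow_add]; norm_num
      rw [this]
      ring
    rw [hE, hO, h1, chiE_of_odd 0 (by simp), chiO_of_odd 0 (by simp), wallFactor,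
      if_neg one_ne_zero, if_pos rfl, smul_zero, add_zero, pow_zero, pow_one, one_mul,
      Units.val_inv_eq_inv_val]
    module

omit [Finite ι] in
-- On `[-1, 0)` the even quotient equals `1` and the odd one vanishes. The leading factor is inverse
-- to the one at the reflected point, as `T_j⁻¹ = T_j - (κ_j - κ_j⁻¹)` demands.
theorem op_qmon_of_neg (j : R.Node) {y : E} (hy : y ∈ O) (h0 : ⟪R.grad j, y⟫ < 0)
    (h1 : -1 ≤ ⟪R.grad j, y⟫) :
    D.op j (qmon F y hy) = (((D.wallFactor j (-⟪R.grad j, y⟫))⁻¹ : Fˣ) : F) • D.refl j y hy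
      + D.kp j • qmon F y hy := by
  apply Subtype.ext
  rw [op_qmon, val, dl, Submodule.coe_add, Submodule.coe_smul, Submodule.coe_smul, coe_refl]
  have hE : R.nablaE q j y = mon F y := by
    apply R.cancel_one_sub q (j := j)
    rw [nablaE_spec, floorE_of_neg (by linarith) h0, neg_neg]
  have hO : R.nablaO q j y = (0 : AddMonoidAlgebra F E) := by
    apply R.cancel_one_sub q (j := j)
    rw [nablaO_spec, floorO_of_mem_Ico h1 (by linarith), neg_neg, sub_self, zero_mul, mul_zero]
  rw [hE, hO, smul_zero, add_zero]
  congr 2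
  rw [wallFactor, if_neg (by linarith)]
  split_ifs with h
  · have h2 : ⟪R.grad j, y⟫ = -1 := by linarith
    rw [h2, chiE_of_odd (-1) (by norm_num), chiO_of_odd (-1) (by norm_num)]
    simp
  · have : ∀ n : ℤ, ⟪R.grad j, y⟫ ≠ n := by
      intro n hn
      have h2 : (-1 : ℝ) < n := hn ▸ lt_of_le_of_ne h1 (fun h' => h (by linarith))
      have h3 : (n : ℝ) < 0 := hn ▸ h0
      have h4 : -1 < n := by exact_mod_cast h2
      have h5 : n < 0 := by exact_mod_cast h3
      omega
    rw [chiE_of_not_int this, chiO_of_not_int this]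
    simp

omit [Finite ι] in
/-- Stability under translations by a set of generators. -/
theorem stable_closure {K : Submodule F (quasiPol F O)} {s : Set R.Qv}
    (h : ∀ ν ∈ s, ∀ v ∈ K, D.mul (mon F ν) v ∈ K ∧ D.mul (mon F (-ν)) v ∈ K) {ν : R.Qv}
    (hν : ν ∈ AddSubgroup.closure s) : ∀ v ∈ K, D.mul (mon F ν) v ∈ K := by
  have key : (∀ v ∈ K, D.mul (mon F ν) v ∈ K) ∧ ∀ v ∈ K, D.mul (mon F (-ν)) v ∈ K := by
    induction hν using AddSubgroup.closure_induction with
    | mem x hx => exact ⟨fun v hv => (h x hx v hv).1, fun v hv => (h x hx v hv).2⟩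
    | zero =>
      have : D.mul (mon F 0) = 1 := by
        rw [mon, ← AddMonoidAlgebra.one_def, map_one]
      rw [neg_zero, this]
      exact ⟨fun v hv => hv, fun v hv => hv⟩
    | add x y _ _ hx hy =>
      rw [neg_add, ← mon_mul_mon, ← mon_mul_mon, map_mul, map_mul]
      exact ⟨fun v hv => hx.1 _ (hy.1 v hv), fun v hv => hx.2 _ (hy.2 v hv)⟩
    | neg x _ hx => rw [neg_neg]; exact ⟨hx.2, hx.1⟩
  exact key.1

omit [Finite ι] in
-- The normalising power of `q` is a nonzero scalar, irrelevant for membership in a subspace.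
theorem mul_mon_cograd_mem {K : Submodule F (quasiPol F O)} {j : R.Node} {v : quasiPol F O}
    (h1 : D.mul (R.xPowQ q j 1) v ∈ K) (h2 : D.mul (R.xPowQ q j (-1)) v ∈ K) :
    D.mul (mon F (R.cograd j)) v ∈ K ∧ D.mul (mon F (-R.cograd j)) v ∈ K := by
  rw [xPowQ_eq_smul, map_smul, LinearMap.smul_apply] at h1 h2
  rw [Submodule.smul_mem_iff _ (Units.ne_zero _)] at h1 h2
  rw [one_smul] at h1
  rw [neg_smul, one_smul] at h2
  exact ⟨h1, h2⟩

theorem refl_refl (j : R.Node) {y : E} (hy : y ∈ O) (c : F)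
    (h : ∀ hy', D.op j (qmon F ((R.s j).1.linear y) hy')
      = c • D.refl j ((R.s j).1.linear y) hy' + D.kp j • qmon F ((R.s j).1.linear y) hy') :
    D.op j (D.refl j y hy) = c • qmon F y hy + D.kp j • D.refl j y hy := by
  have hss : (R.s j).1.linear ((R.s j).1.linear y) = y := by
    rw [← W_mul_linear, s_mul_self]; rfl
  have hc := congrArg Units.val (R.twc_s_s q D.orbit D.mem j hy)
  rw [Units.val_mul, Units.val_one] at hc
  rw [refl, map_smul, h, refl]
  simp only [hss, smul_add, smul_smul]
  congr 1
  · rw [mul_left_comm, mul_comm _ (R.twc q D.t (R.s j) ((R.s j).1.linear y) : F), hc, mul_one]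
  · rw [mul_comm]

omit [Finite ι] in
theorem inner_grad_s_linear (j : R.Node) (y : E) :
    ⟪R.grad j, (R.s j).1.linear y⟫ = -⟪R.grad j, y⟫ := by
  rw [s_linear, inner_sub_right, inner_smul_right, inner_grad_cograd]; ring

/-- The vectors on which the quadratic relation holds. -/
def quadKer (j : R.Node) : Submodule F (quasiPol F O) :=
  LinearMap.ker (D.op j * D.op j - (D.kp j • D.op j + 1))

omit [Finite ι] in
theorem mem_quadKer {j : R.Node} {v : quasiPol F O} :
    v ∈ D.quadKer j ↔ D.op j (D.op j v) = D.kp j • D.op j v + v := by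
  rw [quadKer, LinearMap.mem_ker, LinearMap.sub_apply, sub_eq_zero]
  rfl

omit [Finite ι] in
theorem op_mem_quadKer {j : R.Node} {v : quasiPol F O} (hv : v ∈ D.quadKer j) :
    D.op j v ∈ D.quadKer j := by
  rw [mem_quadKer] at hv ⊢
  rw [hv, map_add, map_smul, hv]

theorem op_xPowQ_one_apply (j : R.Node) (w : quasiPol F O) :
    D.op j (D.mul (R.xPowQ q j 1) w)
      = D.mul (R.xPowQ q j (-1)) (D.op j w) - D.kp j • D.mul (R.xPowQ q j (-1)) w - D.up j • w := by
  have := LinearMap.congr_fun (D.op_mul_xPowQ_one j) w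
  rw [end_mul_sub_algebraMap] at this
  exact this

theorem op_xPowQ_neg_one_apply (j : R.Node) (w : quasiPol F O) :
    D.op j (D.mul (R.xPowQ q j (-1)) w)
      = D.mul (R.xPowQ q j 1) (D.op j w) + D.kp j • D.mul (R.xPowQ q j (-1)) w + D.up j • w :=
  LinearMap.congr_fun (D.op_mul_xPowQ_neg_one j) w

/-- The closed forms for `T_j x^(± α_j^∨)` move `T_j²` across the monomial, after which the
quadratic relation at `v` finishes the computation. -/
theorem quadKer_stable (j : R.Node) {v : quasiPol F O} (hv : v ∈ D.quadKer j) :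
    D.mul (mon F (R.cograd j)) v ∈ D.quadKer j ∧ D.mul (mon F (-R.cograd j)) v ∈ D.quadKer j := by
  rw [mem_quadKer] at hv
  apply D.mul_mon_cograd_mem
  · rw [mem_quadKer]
    simp only [op_xPowQ_one_apply, op_xPowQ_neg_one_apply, map_sub, map_smul, hv, map_add]
    module
  · rw [mem_quadKer]
    simp only [op_xPowQ_one_apply, op_xPowQ_neg_one_apply, map_add, map_smul, hv]
    module

/-- On the wall `x^y` is an eigenvector with eigenvalue `κ_j`. Off the wall `T_j` maps `x^y` to `f`
times its reflection, and the reflection to `f⁻¹ x^y` plus `κ_j - κ_j⁻¹` times itself; the scalars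
`f` and `f⁻¹` cancel. -/
theorem quadKer_of_nonneg (j : R.Node) {y : E} (hy : y ∈ O) (ha : 0 ≤ ⟪R.grad j, y⟫)
    (hb : ⟪R.grad j, y⟫ ≤ 1) : qmon F y hy ∈ D.quadKer j := by
  rw [mem_quadKer, D.op_qmon_of_nonneg j hy ha hb, map_smul]
  rcases ha.eq_or_lt with ha | ha
  · have hS : D.refl j y hy = qmon F y hy := Subtype.ext (by
      rw [coe_refl, R.twAct_s_of_int q D.orbit D.mem j hy 0 (by simp [← ha]), neg_zero,
        xPow_zero, one_mul]; rfl)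
    have hop := D.op_qmon_of_nonneg j hy ha.le hb
    rw [hS] at hop ⊢
    rw [hop, ← ha, wallFactor, if_pos rfl, smul_smul, smul_smul]
    have h1 : (D.κ j : F) * D.κ j = D.kp j * D.κ j + 1 := by
      have := (D.κ j).ne_zero
      rw [kp]
      field_simp
      ring
    rw [h1, add_smul, one_smul]
  · have h := D.refl_refl j hy ((D.wallFactor j ⟪R.grad j, y⟫)⁻¹ : Fˣ) fun hy' => by
      have := D.op_qmon_of_neg j hy' (by rw [inner_grad_s_linear]; linarith)
        (by rw [inner_grad_s_linear]; linarith)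
      rw [inner_grad_s_linear, neg_neg] at this
      exact this
    rw [h, smul_add, smul_smul, ← Units.val_mul, mul_inv_cancel, Units.val_one, one_smul,
      smul_comm, add_comm]

theorem quadKer_of_small (j : R.Node) {y : E} (hy : y ∈ O) (hab : |⟪R.grad j, y⟫| ≤ 1) :
    qmon F y hy ∈ D.quadKer j := by
  rw [abs_le] at hab
  rcases le_or_gt 0 ⟪R.grad j, y⟫ with h0 | h0
  · exact D.quadKer_of_nonneg j hy h0 hab.2
  · have hy' := IsOrbit.linear_mem R D.orbit hy (R.s j)
    have h3 := D.quadKer_of_nonneg j hy' (by rw [inner_grad_s_linear]; linarith)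
      (by rw [inner_grad_s_linear]; linarith)
    -- For a negative value, `x^y` is a nonzero multiple of `T_j` applied to the reflected monomial,
    -- and `quadKer` is `T_j`-stable.
    have h4 := D.op_mem_quadKer h3
    rw [D.op_qmon_of_nonneg j hy' (by rw [inner_grad_s_linear]; linarith)
      (by rw [inner_grad_s_linear]; linarith), refl, smul_smul, ← Units.val_mul,
      Submodule.smul_mem_iff _ (Units.ne_zero _)] at h4
    have hss : (R.s j).1.linear ((R.s j).1.linear y) = y := by
      rw [← W_mul_linear, s_mul_self]; rfl
    simpa only [hss] using h4

/-- The quadratic relation. -/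
theorem op_mul_op (j : R.Node) : D.op j * D.op j = D.kp j • D.op j + 1 := by
  suffices hall : ∀ y (hy : y ∈ O), qmon F y hy ∈ D.quadKer j by
    refine LinearMap.ext fun v => ?_
    have h : v ∈ D.quadKer j := qmon_induction hall v
    rwa [quadKer, LinearMap.mem_ker, LinearMap.sub_apply, sub_eq_zero] at h
  intro y hy
  -- Translating `y` by `-n α_j^∨` lowers the gradient value by `2n`, so it can be brought into
  -- `[-1, 1]`.
  obtain ⟨n, hn⟩ : ∃ n : ℤ, |⟪R.grad j, y⟫ - 2 * n| ≤ 1 := by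
    refine ⟨⌊(⟪R.grad j, y⟫ + 1) / 2⌋, ?_⟩
    have h1 := Int.floor_le ((⟪R.grad j, y⟫ + 1) / 2)
    have h2 := Int.lt_floor_add_one ((⟪R.grad j, y⟫ + 1) / 2)
    rw [abs_le]
    constructor <;> linarith
  have hy' := IsOrbit.add_mem R D.orbit hy (-(n • R.cograd j))
  have h3 : qmon F y hy = D.mul (mon F (n • R.cograd j)) (qmon F _ hy') := by
    rw [mul_mon_qmon]
    congr 1
    simp
  have h4 : |⟪R.grad j, y + ((-(n • R.cograd j) : R.Qv) : E)⟫| ≤ 1 := by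
    have : ⟪R.grad j, y + ((-(n • R.cograd j) : R.Qv) : E)⟫ = ⟪R.grad j, y⟫ - 2 * n := by
      rw [AddSubgroup.coe_neg, AddSubgroup.coe_zsmul, ← Int.cast_smul_eq_zsmul ℝ,
        inner_add_right, inner_neg_right, inner_smul_right, inner_grad_cograd]
      ring
    rw [this]; exact hn
  have h5 : n • R.cograd j ∈ AddSubgroup.closure {R.cograd j} :=
    AddSubgroup.zsmul_mem _ (AddSubgroup.subset_closure (Set.mem_singleton _)) n
  have h6 : ∀ ν ∈ ({R.cograd j} : Set R.Qv), ∀ v ∈ D.quadKer j,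
      D.mul (mon F ν) v ∈ D.quadKer j ∧ D.mul (mon F (-ν)) v ∈ D.quadKer j := by
    intro ν hν v hv
    rw [Set.mem_singleton_iff.mp hν]
    exact D.quadKer_stable j hv
  rw [h3]
  exact D.stable_closure h6 h5 _ (D.quadKer_of_small j hy' h4)

end HeckeData
end EuclideanRoots

/-! ### Braid relations in the presence of a rank two lattice of translations -/

/-- Two operators satisfying quadratic relations, together with multiplication operators by the
monomials `x^(a α^∨ + b β^∨)` and the corresponding commutation relations. -/
structure BraidData (F V : Type*) [Field F] [AddCommGroup V] [Module F V] (n m : ℤ) where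
  T₁ : V →ₗ[F] V
  T₂ : V →ₗ[F] V
  M : ℤ → ℤ → V →ₗ[F] V
  c₁ : F
  c₂ : F
  u₁ : F
  u₂ : F
  quad₁ : ∀ v, T₁ (T₁ v) = c₁ • T₁ v + v
  quad₂ : ∀ v, T₂ (T₂ v) = c₂ • T₂ v + v
  M_M : ∀ a b a' b' v, M a b (M a' b' v) = M (a + a') (b + b') v
  zero₁ : ∀ a b, 2 * a + n * b = 0 → ∀ v, T₁ (M a b v) = M a b (T₁ v)
  zero₂ : ∀ a b, m * a + 2 * b = 0 → ∀ v, T₂ (M a b v) = M a b (T₂ v)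
  one₁ : ∀ a b, 2 * a + n * b = 1 → ∀ v, T₁ (M a b v) = M (a - 1) b (T₁ v - c₁ • v)
  one₂ : ∀ a b, m * a + 2 * b = 1 → ∀ v, T₂ (M a b v) = M a (b - 1) (T₂ v - c₂ • v)
  x₁ : ∀ v, T₁ (M 1 0 v) = M (-1) 0 (T₁ v - c₁ • v) - u₁ • v
  x₂ : ∀ v, T₂ (M 0 1 v) = M 0 (-1) (T₂ v - c₂ • v) - u₂ • v

namespace BraidData

variable {F V : Type*} [Field F] [AddCommGroup V] [Module F V] {n m : ℤ}

variable (B : BraidData F V n m)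

/-- The inverse of `T₁`. -/
def S₁ : V →ₗ[F] V := B.T₁ - B.c₁ • LinearMap.id

/-- The inverse of `T₂`. -/
def S₂ : V →ₗ[F] V := B.T₂ - B.c₂ • LinearMap.id

theorem S₁_apply (v : V) : B.S₁ v = B.T₁ v - B.c₁ • v := rfl

theorem S₂_apply (v : V) : B.S₂ v = B.T₂ v - B.c₂ • v := rfl

theorem T₁_S₁ (v : V) : B.T₁ (B.S₁ v) = v := by
  rw [S₁_apply, map_sub, map_smul, quad₁]; abel

theorem T₂_S₂ (v : V) : B.T₂ (B.S₂ v) = v := by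
  rw [S₂_apply, map_sub, map_smul, quad₂]; abel

theorem S₁_T₁ (v : V) : B.S₁ (B.T₁ v) = v := by
  rw [S₁_apply, quad₁]; abel

theorem S₂_T₂ (v : V) : B.S₂ (B.T₂ v) = v := by
  rw [S₂_apply, quad₂]; abel

/-- The vectors on which the braid relation of length `l` holds. -/
def ker (l : ℕ) : Submodule F V :=
  LinearMap.ker (altProd (A := Module.End F V) B.T₁ B.T₂ l -
    altProd (A := Module.End F V) B.T₂ B.T₁ l)

theorem mem_ker_two {v : V} : v ∈ B.ker 2 ↔ B.T₁ (B.T₂ v) = B.T₂ (B.T₁ v) := by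
  rw [ker, LinearMap.mem_ker, LinearMap.sub_apply, sub_eq_zero]; rfl

theorem mem_ker_three {v : V} :
    v ∈ B.ker 3 ↔ B.T₁ (B.T₂ (B.T₁ v)) = B.T₂ (B.T₁ (B.T₂ v)) := by
  rw [ker, LinearMap.mem_ker, LinearMap.sub_apply, sub_eq_zero]; rfl

theorem mem_ker_four {v : V} :
    v ∈ B.ker 4 ↔ B.T₁ (B.T₂ (B.T₁ (B.T₂ v))) = B.T₂ (B.T₁ (B.T₂ (B.T₁ v))) := by
  rw [ker, LinearMap.mem_ker, LinearMap.sub_apply, sub_eq_zero]; rfl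

theorem mem_ker_six {v : V} :
    v ∈ B.ker 6 ↔ B.T₁ (B.T₂ (B.T₁ (B.T₂ (B.T₁ (B.T₂ v)))))
      = B.T₂ (B.T₁ (B.T₂ (B.T₁ (B.T₂ (B.T₁ v))))) := by
  rw [ker, LinearMap.mem_ker, LinearMap.sub_apply, sub_eq_zero]; rfl

/-- Stability of a subspace under the two operators, and under their inverses. -/
theorem S_mem {K : Submodule F V} (h₁ : ∀ v ∈ K, B.T₁ v ∈ K) (h₂ : ∀ v ∈ K, B.T₂ v ∈ K) :
    (∀ v ∈ K, B.S₁ v ∈ K) ∧ ∀ v ∈ K, B.S₂ v ∈ K :=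
  ⟨fun v hv => K.sub_mem (h₁ v hv) (K.smul_mem _ hv),
    fun v hv => K.sub_mem (h₂ v hv) (K.smul_mem _ hv)⟩

/-- Stability under the operators and under multiplication by `x^(± α^∨)` and `x^(± β^∨)`. -/
def Stable (K : Submodule F V) : Prop :=
  (∀ v ∈ K, B.T₁ v ∈ K) ∧ (∀ v ∈ K, B.T₂ v ∈ K) ∧
  ∀ v ∈ K, B.M 1 0 v ∈ K ∧ B.M (-1) 0 v ∈ K ∧ B.M 0 1 v ∈ K ∧ B.M 0 (-1) v ∈ K

/-- If `x^(α^∨ + β^∨)` preserves a subspace preserved by the operators, and `α, β` take the value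
`1` at `α^∨ + β^∨` and `- β^∨` then all monomials preserve the subspace. -/
theorem stable_of_sum (hn : n = -1) {K : Submodule F V} (h₁ : ∀ v ∈ K, B.T₁ v ∈ K)
    (h₂ : ∀ v ∈ K, B.T₂ v ∈ K) (h : ∀ v ∈ K, B.M 1 1 v ∈ K) : B.Stable K := by
  -- As `α` takes the value `1` on `α^∨ + β^∨` and on `-β^∨`, conjugation by the operators produces
  -- every other monomial from `x^(α^∨ + β^∨)`: successively `x^(β^∨)`, `x^(-β^∨)`, `x^(-α^∨ -
  -- β^∨)`, and then `x^(± α^∨)` as products.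
  have e1 : ∀ v, B.M 0 1 v = B.T₁ (B.M 1 1 (B.T₁ v)) := fun v => by
    rw [B.one₁ 1 1 (by omega), ← S₁_apply, S₁_T₁]; rfl
  have e2 : ∀ v, B.M 0 (-1) v = B.T₂ (B.M 0 1 (B.T₂ v)) + B.u₂ • B.T₂ v := fun v => by
    rw [B.x₂, ← S₂_apply, S₂_T₂]; abel
  have e3 : ∀ v, B.M (-1) (-1) v = B.T₁ (B.M 0 (-1) (B.T₁ v)) := fun v => by
    rw [B.one₁ 0 (-1) (by omega), ← S₁_apply, S₁_T₁]; rfl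
  have e4 : ∀ v, B.M 1 0 v = B.M 1 1 (B.M 0 (-1) v) := fun v => by rw [B.M_M]; rfl
  have e5 : ∀ v, B.M (-1) 0 v = B.M (-1) (-1) (B.M 0 1 v) := fun v => by rw [B.M_M]; rfl
  have f1 : ∀ v ∈ K, B.M 0 1 v ∈ K := fun v hv => by
    rw [e1]; exact h₁ _ (h _ (h₁ _ hv))
  have f2 : ∀ v ∈ K, B.M 0 (-1) v ∈ K := fun v hv => by
    rw [e2]; exact K.add_mem (h₂ _ (f1 _ (h₂ _ hv))) (K.smul_mem _ (h₂ _ hv))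
  have f3 : ∀ v ∈ K, B.M (-1) (-1) v ∈ K := fun v hv => by
    rw [e3]; exact h₁ _ (f2 _ (h₁ _ hv))
  exact ⟨h₁, h₂, fun v hv => ⟨by rw [e4]; exact h _ (f2 _ hv), by rw [e5]; exact f3 _ (f1 _ hv),
    f1 v hv, f2 v hv⟩⟩

/-- Each monomial commutes with the other operator and meets its own operator through the closed
form for `T x^(α^∨)`, so commutation at `v` passes to its multiples. -/
theorem stable_ker_two (B : BraidData F V 0 0) : B.Stable (B.ker 2) := by
  have hmem := fun v => B.mem_ker_two (v := v)
  have h₁ : ∀ v ∈ B.ker 2, B.T₁ v ∈ B.ker 2 := fun v hv => by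
    rw [hmem] at *
    rw [quad₁, ← hv, map_add, map_smul, hv, ← hv, quad₁, hv]
  have h₂ : ∀ v ∈ B.ker 2, B.T₂ v ∈ B.ker 2 := fun v hv => by
    rw [hmem] at *
    rw [quad₂, hv, map_add, map_smul, quad₂, hv]
  have e1 : ∀ v ∈ B.ker 2, B.M 1 0 v ∈ B.ker 2 := fun v hv => by
    rw [hmem] at *
    simp only [B.zero₂ 1 0 (by norm_num), B.x₁, B.zero₂ (-1) 0 (by norm_num), map_sub, map_smul, hv]
  have e2 : ∀ v ∈ B.ker 2, B.M 0 1 v ∈ B.ker 2 := fun v hv => by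
    rw [hmem] at *
    simp only [B.zero₁ 0 1 (by norm_num), B.x₂, B.zero₁ 0 (-1) (by norm_num), map_sub, map_smul, hv]
  refine ⟨h₁, h₂, fun v hv => ?_⟩
  have e3 : B.M (-1) 0 v = B.T₁ (B.M 1 0 (B.T₁ v)) + B.u₁ • B.T₁ v := by
    rw [B.x₁, ← S₁_apply, S₁_T₁]; abel
  have e4 : B.M 0 (-1) v = B.T₂ (B.M 0 1 (B.T₂ v)) + B.u₂ • B.T₂ v := by
    rw [B.x₂, ← S₂_apply, S₂_T₂]; abel
  refine ⟨e1 v hv, ?_, e2 v hv, ?_⟩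
  · rw [e3]
    exact Submodule.add_mem _ (h₁ _ (e1 _ (h₁ _ hv))) (Submodule.smul_mem _ _ (h₁ _ hv))
  · rw [e4]
    exact Submodule.add_mem _ (h₂ _ (e2 _ (h₂ _ hv))) (Submodule.smul_mem _ _ (h₂ _ hv))

/-- Pushing `x^(α^∨ + β^∨)` through `T₁ T₂ T₁` gives `x^(-α^∨ - β^∨) S₁ S₂ S₁ - u₂`, and through `T₂
T₁ T₂` it gives `x^(-α^∨ - β^∨) S₂ S₁ S₂ - u₁`, where `S` denotes the inverse of `T`. It remains to
use the braid relation for the inverses on `v` and `u₁ = u₂`. -/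
theorem stable_ker_three (B : BraidData F V (-1) (-1)) (hc : B.c₁ = B.c₂) (hu : B.u₁ = B.u₂) :
    B.Stable (B.ker 3) := by
  have hmem := fun v => B.mem_ker_three (v := v)
  have h₁ : ∀ v ∈ B.ker 3, B.T₁ v ∈ B.ker 3 := fun v hv => by
    rw [hmem] at *
    rw [hv, quad₁, quad₂, map_add, map_smul, map_add, map_smul, hv, hc]
  have h₂ : ∀ v ∈ B.ker 3, B.T₂ v ∈ B.ker 3 := fun v hv => by
    rw [hmem] at *
    rw [← hv, quad₁, quad₂, map_add, map_smul, map_add, map_smul, hv, hc]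
  obtain ⟨g₁, g₂⟩ := B.S_mem h₁ h₂
  refine B.stable_of_sum rfl h₁ h₂ fun v hv => ?_
  have hw := g₁ _ (g₂ _ (g₁ _ hv))
  have hS : B.S₂ (B.S₁ (B.S₂ v)) = B.S₁ (B.S₂ (B.S₁ v)) := by
    rw [hmem, T₁_S₁, T₂_S₂, T₁_S₁] at hw
    conv_lhs => rw [hw, S₂_T₂, S₁_T₁, S₂_T₂]
  have a1 : ∀ w, B.T₁ (B.M 1 1 w) = B.M 0 1 (B.S₁ w) := B.one₁ 1 1 (by norm_num)
  have a2 : ∀ w, B.T₁ (B.M 0 (-1) w) = B.M (-1) (-1) (B.S₁ w) := B.one₁ 0 (-1) (by norm_num)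
  have b1 : ∀ w, B.T₂ (B.M 1 1 w) = B.M 1 0 (B.S₂ w) := B.one₂ 1 1 (by norm_num)
  have b2 : ∀ w, B.T₂ (B.M (-1) 0 w) = B.M (-1) (-1) (B.S₂ w) := B.one₂ (-1) 0 (by norm_num)
  have x₁ : ∀ w, B.T₁ (B.M 1 0 w) = B.M (-1) 0 (B.S₁ w) - B.u₁ • w := B.x₁
  have x₂ : ∀ w, B.T₂ (B.M 0 1 w) = B.M 0 (-1) (B.S₂ w) - B.u₂ • w := B.x₂
  rw [hmem, a1, x₂, map_sub, a2, b1, x₁, map_sub, b2, hS, map_smul, map_smul, T₁_S₁, T₂_S₂, hu]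

/-- Here `x^(α^∨ + β^∨)` commutes with `T₂`. Both words yield the correction `-u₂ T₂ v`, and the
main terms agree because `T₂` commutes with `S₁ S₂ S₁` at `v`. -/
theorem stable_ker_four (B : BraidData F V (-1) (-2)) : B.Stable (B.ker 4) := by
  have hmem := fun v => B.mem_ker_four (v := v)
  have h₁ : ∀ v ∈ B.ker 4, B.T₁ v ∈ B.ker 4 := fun v hv => by
    rw [hmem] at *
    rw [← hv, quad₁, quad₁]
    simp only [map_add, map_smul, hv]
  have h₂ : ∀ v ∈ B.ker 4, B.T₂ v ∈ B.ker 4 := fun v hv => by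
    rw [hmem] at *
    rw [hv, quad₂, quad₂]
    simp only [map_add, map_smul, hv]
  obtain ⟨g₁, g₂⟩ := B.S_mem h₁ h₂
  refine B.stable_of_sum rfl h₁ h₂ fun v hv => ?_
  have hw := g₁ _ (g₂ _ (g₁ _ hv))
  have hS : B.S₁ (B.S₂ (B.S₁ (B.T₂ v))) = B.T₂ (B.S₁ (B.S₂ (B.S₁ v))) := by
    rw [hmem] at hw
    simp only [T₁_S₁, T₂_S₂] at hw
    rw [← hw]
    simp only [S₁_T₁, S₂_T₂]
  have a1 : ∀ w, B.T₁ (B.M 1 1 w) = B.M 0 1 (B.S₁ w) := B.one₁ 1 1 (by norm_num)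
  have a2 : ∀ w, B.T₁ (B.M 0 (-1) w) = B.M (-1) (-1) (B.S₁ w) := B.one₁ 0 (-1) (by norm_num)
  have b1 : ∀ w, B.T₂ (B.M 1 1 w) = B.M 1 1 (B.T₂ w) := B.zero₂ 1 1 (by norm_num)
  have b2 : ∀ w, B.T₂ (B.M (-1) (-1) w) = B.M (-1) (-1) (B.T₂ w) := B.zero₂ (-1) (-1) (by norm_num)
  have x₂ : ∀ w, B.T₂ (B.M 0 1 w) = B.M 0 (-1) (B.S₂ w) - B.u₂ • w := B.x₂
  rw [hmem]
  simp only [a1, a2, b1, b2, x₂, map_sub, map_smul, T₁_S₁, hS]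

/-- The convenient weight is `α^∨ + 2β^∨`, on which `α` vanishes. Its monomial commutes with `T₁`
and passes through five alternating letters to its inverse, with a single correction by `u₂`. Since
`β` takes the value `1` there, `x^(α^∨ + β^∨) = T₂ x^(α^∨ + 2β^∨) T₂`, which brings the case back to
`stable_of_sum`. -/
theorem stable_ker_six (B : BraidData F V (-1) (-3)) : B.Stable (B.ker 6) := by
  have hmem := fun v => B.mem_ker_six (v := v)
  have h₁ : ∀ v ∈ B.ker 6, B.T₁ v ∈ B.ker 6 := fun v hv => by
    rw [hmem] at *
    rw [← hv, quad₁, quad₁]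
    simp only [map_add, map_smul, hv]
  have h₂ : ∀ v ∈ B.ker 6, B.T₂ v ∈ B.ker 6 := fun v hv => by
    rw [hmem] at *
    rw [hv, quad₂, quad₂]
    simp only [map_add, map_smul, hv]
  obtain ⟨g₁, g₂⟩ := B.S_mem h₁ h₂
  have a1 : ∀ w, B.T₁ (B.M 1 2 w) = B.M 1 2 (B.T₁ w) := B.zero₁ 1 2 (by norm_num)
  have a2 : ∀ w, B.T₁ (B.M 1 1 w) = B.M 0 1 (B.S₁ w) := B.one₁ 1 1 (by norm_num)
  have a3 : ∀ w, B.T₁ (B.M 0 (-1) w) = B.M (-1) (-1) (B.S₁ w) := B.one₁ 0 (-1) (by norm_num)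
  have a4 : ∀ w, B.T₁ (B.M (-1) (-2) w) = B.M (-1) (-2) (B.T₁ w) := B.zero₁ (-1) (-2) (by norm_num)
  have b1 : ∀ w, B.T₂ (B.M 1 2 w) = B.M 1 1 (B.S₂ w) := B.one₂ 1 2 (by norm_num)
  have b2 : ∀ w, B.T₂ (B.M (-1) (-1) w) = B.M (-1) (-2) (B.S₂ w) := B.one₂ (-1) (-1) (by norm_num)
  have x₂ : ∀ w, B.T₂ (B.M 0 1 w) = B.M 0 (-1) (B.S₂ w) - B.u₂ • w := B.x₂
  have key : ∀ v ∈ B.ker 6, B.M 1 2 v ∈ B.ker 6 := fun v hv => by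
    have hw := g₂ _ (g₁ _ (g₂ _ (g₁ _ (g₂ _ hv))))
    have hS : B.T₁ (B.S₂ (B.S₁ (B.S₂ (B.S₁ (B.S₂ v)))))
        = B.S₂ (B.S₁ (B.S₂ (B.S₁ (B.S₂ (B.T₁ v))))) := by
      rw [hmem] at hw
      simp only [T₁_S₁, T₂_S₂] at hw
      rw [hw]
      simp only [S₁_T₁, S₂_T₂]
    rw [hmem]
    simp only [a1, a2, a3, a4, b1, b2, x₂, map_sub, map_smul, T₁_S₁, T₂_S₂, hS]
  refine B.stable_of_sum rfl h₁ h₂ fun v hv => ?_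
  have e : B.M 1 1 v = B.T₂ (B.M 1 2 (B.T₂ v)) := by rw [b1, S₂_T₂]
  rw [e]
  exact h₂ _ (key _ (h₂ _ hv))

end BraidData

namespace EuclideanRoots

variable {ι E : Type*} [NormedAddCommGroup E] [InnerProductSpace ℝ E] (R : EuclideanRoots ι E)

/-! ### Rank two relations in the affine Weyl group -/

/-- A root whose root vector is the gradient of the affine simple root. -/
def gradIndex : R.Node → ι
  | none => R.P.reflectionPerm R.highest R.highest
  | some i => i

theorem root_gradIndex (j : R.Node) : R.P.root (R.gradIndex j) = R.grad j := by
  cases j with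
  | none => exact R.root_neg _
  | some i => rfl

theorem coroot_gradIndex (j : R.Node) : R.P.coroot (R.gradIndex j) = (R.cograd j : E) := by
  cases j with
  | none => exact R.coroot_neg _
  | some i => rfl

theorem inner_grad_cograd_eq (i j : R.Node) :
    ⟪R.grad i, (R.cograd j : E)⟫ = (R.P.pairingIn ℤ (R.gradIndex i) (R.gradIndex j) : ℝ) := by
  rw [← inner_coroot_eq_pairingIn, root_gradIndex, coroot_gradIndex]

theorem inner_grad_cograd_nonpos_iff (i j : R.Node) :
    ⟪R.grad i, (R.cograd j : E)⟫ ≤ 0 ↔ ⟪R.grad i, R.grad j⟫ ≤ 0 := by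
  have hp : 0 < ‖R.grad j‖ := norm_pos_iff.mpr (R.grad_ne_zero j)
  have : 0 < 2 / ‖R.grad j‖ ^ 2 := by positivity
  rw [cograd_eq, inner_smul_right]
  constructor
  · intro h; by_contra! h'; exact absurd (mul_pos this h') (not_lt.mpr h)
  · intro h; exact mul_nonpos_of_nonneg_of_nonpos this.le h

variable [Finite ι]

theorem inner_grad_grad_nonpos {i j : R.Node} (hij : i ≠ j) : ⟪R.grad i, R.grad j⟫ ≤ 0 := by
  cases i with
  | none =>
    cases j with
    | none => exact absurd rfl hij
    | some j =>
      rw [real_inner_comm]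
      simp only [grad, inner_neg_right]
      exact neg_nonpos.mpr (R.inner_simple_highest_nonneg j)
  | some i =>
    cases j with
    | none =>
      simp only [grad, inner_neg_right]
      exact neg_nonpos.mpr (R.inner_simple_highest_nonneg i)
    | some j =>
      rw [← inner_grad_cograd_nonpos_iff, inner_grad_cograd_eq]
      exact_mod_cast R.base.pairingIn_le_zero_of_ne
        (fun h => hij (congrArg some (Subtype.ext h))) i.2 j.2

/-- The possible Cartan integers of two affine simple roots. -/
theorem cartan_cases {i j : R.Node} (hij : i ≠ j) :
    (⟪R.grad i, (R.cograd j : E)⟫ = 0 ∧ ⟪R.grad j, (R.cograd i : E)⟫ = 0) ∨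
    (⟪R.grad i, (R.cograd j : E)⟫ = -1 ∧ ⟪R.grad j, (R.cograd i : E)⟫ = -1) ∨
    (⟪R.grad i, (R.cograd j : E)⟫ = -1 ∧ ⟪R.grad j, (R.cograd i : E)⟫ = -2) ∨
    (⟪R.grad i, (R.cograd j : E)⟫ = -2 ∧ ⟪R.grad j, (R.cograd i : E)⟫ = -1) ∨
    (⟪R.grad i, (R.cograd j : E)⟫ = -1 ∧ ⟪R.grad j, (R.cograd i : E)⟫ = -3) ∨
    (⟪R.grad i, (R.cograd j : E)⟫ = -3 ∧ ⟪R.grad j, (R.cograd i : E)⟫ = -1) ∨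
    (⟪R.grad i, (R.cograd j : E)⟫ = -2 ∧ ⟪R.grad j, (R.cograd i : E)⟫ = -2) := by
  have h1 := (R.inner_grad_cograd_nonpos_iff i j).mpr (R.inner_grad_grad_nonpos hij)
  have h2 := (R.inner_grad_cograd_nonpos_iff j i).mpr (R.inner_grad_grad_nonpos hij.symm)
  have h := R.P.pairingIn_pairingIn_mem_set_of_isCrystal_of_isRed (R.gradIndex i) (R.gradIndex j)
  rw [inner_grad_cograd_eq] at *
  rw [inner_grad_cograd_eq] at *
  generalize R.P.pairingIn ℤ (R.gradIndex i) (R.gradIndex j) = n at *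
  generalize R.P.pairingIn ℤ (R.gradIndex j) (R.gradIndex i) = m at *
  have h1' : n ≤ 0 := by exact_mod_cast h1
  have h2' : m ≤ 0 := by exact_mod_cast h2
  simp only [Set.mem_insert_iff, Set.mem_singleton_iff, Prod.mk_zero_zero, Prod.mk_eq_zero,
    Prod.mk_one_one, Prod.mk_eq_one, Prod.mk.injEq] at h
  have : (n = 0 ∧ m = 0) ∨ (n = -1 ∧ m = -1) ∨ (n = -1 ∧ m = -2) ∨ (n = -2 ∧ m = -1) ∨
    (n = -1 ∧ m = -3) ∨ (n = -3 ∧ m = -1) ∨ (n = -2 ∧ m = -2) := by omega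
  rcases this with h | h | h | h | h | h | h <;> obtain ⟨rfl, rfl⟩ := h <;> norm_num

omit [Finite ι]

theorem ev_sub_smul_cograd (i j : R.Node) (y : E) (r : ℝ) :
    ev (R.simpleRoot i) (y - r • (R.cograd j : E))
      = ev (R.simpleRoot i) y - r * ⟪R.grad i, (R.cograd j : E)⟫ := by
  simp only [ev, simpleRoot, inner_sub_right, inner_smul_right]; ring

theorem inner_grad_s_mul_linear (i j : R.Node) (w : R.W) (y : E) :
    ⟪R.grad i, (R.s j * w).1.linear y⟫
      = ⟪R.grad i, w.1.linear y⟫ - ⟪R.grad j, w.1.linear y⟫ * ⟪R.grad i, (R.cograd j : E)⟫ := by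
  rw [W_mul_linear, s_linear, inner_sub_right, inner_smul_right]

section Braid

variable {i j : R.Node}

theorem braid_two (hn : ⟪R.grad i, (R.cograd j : E)⟫ = 0)
    (hm : ⟪R.grad j, (R.cograd i : E)⟫ = 0) :
    altProd (R.s i) (R.s j) 2 = altProd (R.s j) (R.s i) 2 := by
  have hi := R.inner_grad_cograd i
  have hj := R.inner_grad_cograd j
  apply R.W_ext
  intro y
  simp only [altProd, mul_one, W_mul_apply, s_apply, ev_sub_smul_cograd, hn, hm]
  module

theorem braid_three (hn : ⟪R.grad i, (R.cograd j : E)⟫ = -1)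
    (hm : ⟪R.grad j, (R.cograd i : E)⟫ = -1) :
    altProd (R.s i) (R.s j) 3 = altProd (R.s j) (R.s i) 3 := by
  have hi := R.inner_grad_cograd i
  have hj := R.inner_grad_cograd j
  apply R.W_ext
  intro y
  simp only [altProd, mul_one, W_mul_apply, s_apply, ev_sub_smul_cograd, hn, hm, hi, hj]
  module

theorem braid_four (hn : ⟪R.grad i, (R.cograd j : E)⟫ = -1)
    (hm : ⟪R.grad j, (R.cograd i : E)⟫ = -2) :
    altProd (R.s i) (R.s j) 4 = altProd (R.s j) (R.s i) 4 := by
  have hi := R.inner_grad_cograd i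
  have hj := R.inner_grad_cograd j
  apply R.W_ext
  intro y
  simp only [altProd, mul_one, W_mul_apply, s_apply, ev_sub_smul_cograd, hn, hm, hi, hj]
  module

theorem braid_six (hn : ⟪R.grad i, (R.cograd j : E)⟫ = -1)
    (hm : ⟪R.grad j, (R.cograd i : E)⟫ = -3) :
    altProd (R.s i) (R.s j) 6 = altProd (R.s j) (R.s i) 6 := by
  have hi := R.inner_grad_cograd i
  have hj := R.inner_grad_cograd j
  apply R.W_ext
  intro y
  simp only [altProd, mul_one, W_mul_apply, s_apply, ev_sub_smul_cograd, hn, hm, hi, hj]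
  module

/-- Exact orders are certified by one matrix coefficient of the linear part. -/
theorem ne_one_of_inner {g : R.W} {v x : E} (h : ⟪v, g.1.linear x⟫ ≠ ⟪v, x⟫) : g ≠ 1 := by
  rintro rfl; exact h rfl

theorem orderOf_two (hn : ⟪R.grad i, (R.cograd j : E)⟫ = 0)
    (hm : ⟪R.grad j, (R.cograd i : E)⟫ = 0) : orderOf (R.s i * R.s j) = 2 := by
  have : Fact (Nat.Prime 2) := ⟨Nat.prime_two⟩
  apply orderOf_eq_prime
  · apply R.W_ext
    intro y
    simp only [pow_succ, pow_zero, one_mul, W_mul_apply, s_apply, ev_sub_smul_cograd, hn, hm,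
      R.inner_grad_cograd]
    change _ = y
    module
  · apply R.ne_one_of_inner (v := R.grad j) (x := R.cograd j)
    simp only [W_mul_linear, s_linear, inner_sub_right, inner_smul_right, hn, hm,
      R.inner_grad_cograd j]
    norm_num

theorem orderOf_three (hn : ⟪R.grad i, (R.cograd j : E)⟫ = -1)
    (hm : ⟪R.grad j, (R.cograd i : E)⟫ = -1) : orderOf (R.s i * R.s j) = 3 := by
  have : Fact (Nat.Prime 3) := ⟨Nat.prime_three⟩
  have hi := R.inner_grad_cograd i
  have hj := R.inner_grad_cograd j
  apply orderOf_eq_prime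
  · apply R.W_ext
    intro y
    simp only [pow_succ, pow_zero, one_mul, W_mul_apply, s_apply, ev_sub_smul_cograd, hn, hm, hi,
      hj]
    change _ = y
    module
  · apply R.ne_one_of_inner (v := R.grad j) (x := R.cograd j)
    simp only [W_mul_linear, s_linear, inner_sub_right, inner_smul_right, hn, hm, hj]
    norm_num

theorem orderOf_four (hn : ⟪R.grad i, (R.cograd j : E)⟫ = -1)
    (hm : ⟪R.grad j, (R.cograd i : E)⟫ = -2) : orderOf (R.s i * R.s j) = 4 := by
  have : Fact (Nat.Prime 2) := ⟨Nat.prime_two⟩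
  have hi := R.inner_grad_cograd i
  have hj := R.inner_grad_cograd j
  apply orderOf_eq_prime_pow (p := 2) (n := 1)
  · apply R.ne_one_of_inner (v := R.grad j) (x := R.cograd j)
    simp only [pow_succ, pow_zero, one_mul, W_mul_linear, s_linear, inner_sub_right,
      inner_smul_right, hn, hm, hi, hj]
    norm_num
  · apply R.W_ext
    intro y
    norm_num only
    simp only [pow_succ, pow_zero, one_mul, W_mul_apply, s_apply, ev_sub_smul_cograd, hn, hm, hi,
      hj]
    change _ = y
    module

theorem orderOf_six (hn : ⟪R.grad i, (R.cograd j : E)⟫ = -1)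
    (hm : ⟪R.grad j, (R.cograd i : E)⟫ = -3) : orderOf (R.s i * R.s j) = 6 := by
  have hi := R.inner_grad_cograd i
  have hj := R.inner_grad_cograd j
  have h3 : ∀ y, ((R.s i * R.s j) ^ 3).1 y = (altProd (R.s i) (R.s j) 6).1 y := fun y => by
    simp only [pow_succ, pow_zero, one_mul, altProd, mul_one, W_mul_apply]
  apply orderOf_eq_of_pow_and_pow_div_prime (by norm_num)
  · have h6 : (R.s i * R.s j) ^ 3 = altProd (R.s i) (R.s j) 6 := R.W_ext h3
    have : (R.s i * R.s j) ^ 6 = (R.s i * R.s j) ^ 3 * (R.s i * R.s j) ^ 3 := by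
      rw [← pow_add]
    rw [this, h6]
    have hs : ∀ (k : R.Node) (w : R.W), R.s k * (R.s k * w) = w := fun k w => by
      rw [← mul_assoc, s_mul_self, one_mul]
    -- With one of the two six-letter words reversed, adjacent equal letters cancel in succession.
    conv_lhs => enter [2]; rw [R.braid_six hn hm]
    simp only [altProd, mul_one, mul_assoc, hs, s_mul_self]
  · intro p hp hd
    have hp' : p = 2 ∨ p = 3 := by
      have : p ≤ 6 := Nat.le_of_dvd (by norm_num) hd
      interval_cases p <;> revert hp hd <;> decide
    rcases hp' with rfl | rfl
    · apply R.ne_one_of_inner (v := R.grad j) (x := R.cograd j)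
      norm_num only
      simp only [pow_succ, pow_zero, one_mul, W_mul_linear, s_linear, inner_sub_right,
        inner_smul_right, hn, hm, hi, hj]
      norm_num
    · apply R.ne_one_of_inner (v := R.grad j) (x := R.cograd j)
      norm_num only
      simp only [pow_succ, pow_zero, one_mul, W_mul_linear, s_linear, inner_sub_right,
        inner_smul_right, hn, hm, hi, hj]
      norm_num

theorem orderOf_swap : orderOf (R.s j * R.s i) = orderOf (R.s i * R.s j) := by
  have : R.s j * R.s i = (R.s i * R.s j)⁻¹ := by rw [mul_inv_rev, s_inv, s_inv]
  rw [this, orderOf_inv]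

/-- Equality in Cauchy--Schwarz forces opposite gradients, so `s_i s_j` is the translation by
`-α_i^∨`, of infinite order. By the convention for `orderOf` the braid relation is then empty. -/
theorem orderOf_eq_zero (hij : i ≠ j) (hn : ⟪R.grad i, (R.cograd j : E)⟫ = -2)
    (hm : ⟪R.grad j, (R.cograd i : E)⟫ = -2) : orderOf (R.s i * R.s j) = 0 := by
  have hpi : 0 < ‖R.grad i‖ := norm_pos_iff.mpr (R.grad_ne_zero i)
  have hpj : 0 < ‖R.grad j‖ := norm_pos_iff.mpr (R.grad_ne_zero j)
  have hgrad : R.grad j = -R.grad i := by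
    rw [cograd_eq, inner_smul_right] at hn hm
    rw [real_inner_comm] at hm
    have h1 : ⟪R.grad i, R.grad j⟫ = -‖R.grad j‖ ^ 2 := by field_simp at hn; linarith
    have h2 : ⟪R.grad i, R.grad j⟫ = -‖R.grad i‖ ^ 2 := by field_simp at hm; linarith
    rw [← add_eq_zero_iff_eq_neg, ← norm_eq_zero, ← sq_eq_zero_iff, norm_add_sq_real,
      real_inner_comm]
    linarith
  have hco : (R.cograd j : E) = -R.cograd i := by
    rw [cograd_eq, cograd_eq, hgrad, norm_neg, smul_neg]
  -- One of the two nodes must be the affine one, since two members of a base are never opposite.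
  have hcst : R.cst i + R.cst j = 1 := by
    cases i with
    | none =>
      cases j with
      | none => exact absurd rfl hij
      | some j => rfl
    | some i =>
      cases j with
      | none => rfl
      | some j =>
        exfalso
        have h := InCone.eq_zero R (R.inCone_simple i) (by
          have := R.inCone_simple j
          change R.InCone (R.grad (some j)) at this
          rw [hgrad] at this
          exact this)
        exact R.P.ne_zero _ h
  have hstep : ∀ y, (R.s i * R.s j).1 y = y - (R.cograd i : E) := fun y => by
    have hc : (R.cst i : ℝ) + R.cst j = 1 := by exact_mod_cast hcst
    rw [W_mul_apply, s_apply R j, s_apply R i, ev_sub_smul_cograd, hn, hco]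
    have h : ev (R.simpleRoot j) y = 1 - ev (R.simpleRoot i) y := by
      simp only [ev, simpleRoot, hgrad, inner_neg_left]; linarith
    rw [h]
    module
  have hpow : ∀ n : ℕ, ((R.s i * R.s j) ^ n).1 0 = -(n : ℝ) • (R.cograd i : E) := by
    intro n
    induction n with
    | zero => simp only [pow_zero, Nat.cast_zero, neg_zero, zero_smul]; rfl
    | succ n ih =>
      rw [pow_succ', W_mul_apply, ih, hstep]
      push_cast
      module
  rw [orderOf_eq_zero_iff']
  intro n hn h
  have h1 := hpow n
  rw [h] at h1
  have h2 : (0 : E) = -(n : ℝ) • (R.cograd i : E) := h1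
  rcases smul_eq_zero.mp h2.symm with h3 | h3
  · rw [neg_eq_zero, Nat.cast_eq_zero] at h3; omega
  · exact R.cograd_ne_zero i h3

end Braid
end EuclideanRoots

namespace EuclideanRoots

variable {ι E : Type*} [NormedAddCommGroup E] [InnerProductSpace ℝ E] {R : EuclideanRoots ι E}
variable {F : Type*} [Field F] {q : Fˣ}

namespace HeckeData

variable {O : Set E} (D : R.HeckeData q O) [Finite ι]

/-! ### The braid relations -/

theorem op_mul_smul_mon_of_one (j : R.Node) {μ : R.Qv} (c : F) (hm : ⟪R.grad j, (μ : E)⟫ = 1)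
    (v : quasiPol F O) :
    D.op j (D.mul (c • mon F μ) v)
      = D.mul (R.xPowQ q j (-1) * (c • mon F μ)) (D.op j v - D.kp j • v) := by
  have := LinearMap.congr_fun (D.op_mul_mon_of_one j hm) v
  rw [mul_smul_comm, map_smul, map_smul, LinearMap.smul_apply, LinearMap.smul_apply, map_smul]
  exact congrArg (c • ·) this

theorem op_mul_smul_mon_of_zero (j : R.Node) {μ : R.Qv} (c : F) (hm : ⟪R.grad j, (μ : E)⟫ = 0)
    (v : quasiPol F O) :
    D.op j (D.mul (c • mon F μ) v) = D.mul (c • mon F μ) (D.op j v) := by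
  have := LinearMap.congr_fun (D.op_mul_mon_of_zero j hm) v
  rw [map_smul, LinearMap.smul_apply, LinearMap.smul_apply, map_smul]
  exact congrArg (c • ·) this

omit [Finite ι] in
theorem xPowQ_mul_xPowQ (i j : R.Node) (a b : ℤ) : ∃ c : F,
    R.xPowQ q i a * R.xPowQ q j b = c • mon F (a • R.cograd i + b • R.cograd j) := by
  refine ⟨(((q ^ R.cst i) ^ a : Fˣ) : F) * (((q ^ R.cst j) ^ b : Fˣ) : F), ?_⟩
  rw [xPowQ_eq_smul, xPowQ_eq_smul, smul_mul_smul_comm, mon_mul_mon]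

omit [Finite ι] in
theorem inner_combination (k i j : R.Node) (a b : ℤ) :
    ⟪R.grad k, ((a • R.cograd i + b • R.cograd j : R.Qv) : E)⟫
      = a * ⟪R.grad k, (R.cograd i : E)⟫ + b * ⟪R.grad k, (R.cograd j : E)⟫ := by
  rw [AddSubgroup.coe_add, AddSubgroup.coe_zsmul, AddSubgroup.coe_zsmul,
    ← Int.cast_smul_eq_zsmul ℝ, ← Int.cast_smul_eq_zsmul ℝ, inner_add_right, inner_smul_right,
    inner_smul_right]

/-- The operators `T_i`, `T_j` and the multiplication operators by the monomials in the lattice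
spanned by the two coroots. -/
def braidData (i j : R.Node) (n m : ℤ) (hn : ⟪R.grad i, (R.cograd j : E)⟫ = n)
    (hm : ⟪R.grad j, (R.cograd i : E)⟫ = m) : BraidData F (quasiPol F O) n m where
  T₁ := D.op i
  T₂ := D.op j
  M a b := D.mul (R.xPowQ q i a * R.xPowQ q j b)
  c₁ := D.kp i
  c₂ := D.kp j
  u₁ := D.up i
  u₂ := D.up j
  quad₁ v := LinearMap.congr_fun (D.op_mul_op i) v
  quad₂ v := LinearMap.congr_fun (D.op_mul_op j) v
  M_M a b a' b' v := by
    rw [← Module.End.mul_apply, ← map_mul, xPowQ_add, xPowQ_add, mul_mul_mul_comm]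
  zero₁ a b h v := by
    obtain ⟨c, hc⟩ := xPowQ_mul_xPowQ (q := q) i j a b
    rw [hc]
    apply D.op_mul_smul_mon_of_zero
    rw [inner_combination, inner_grad_cograd, hn, mul_comm, mul_comm (b : ℝ)]
    exact_mod_cast h
  zero₂ a b h v := by
    obtain ⟨c, hc⟩ := xPowQ_mul_xPowQ (q := q) i j a b
    rw [hc]
    apply D.op_mul_smul_mon_of_zero
    rw [inner_combination, inner_grad_cograd, hm, mul_comm, mul_comm (b : ℝ)]
    exact_mod_cast h
  one₁ a b h v := by
    obtain ⟨c, hc⟩ := xPowQ_mul_xPowQ (q := q) i j a b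
    rw [sub_eq_neg_add, xPowQ_add, mul_assoc, hc]
    apply D.op_mul_smul_mon_of_one
    rw [inner_combination, inner_grad_cograd, hn, mul_comm, mul_comm (b : ℝ)]
    exact_mod_cast h
  one₂ a b h v := by
    obtain ⟨c, hc⟩ := xPowQ_mul_xPowQ (q := q) i j a b
    rw [sub_eq_neg_add, xPowQ_add, mul_left_comm, hc]
    apply D.op_mul_smul_mon_of_one
    rw [inner_combination, inner_grad_cograd, hm, mul_comm, mul_comm (b : ℝ)]
    exact_mod_cast h
  x₁ v := by
    rw [xPowQ_zero, mul_one, mul_one, op_xPowQ_one_apply, map_sub, map_smul]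
  x₂ v := by
    rw [xPowQ_zero, one_mul, one_mul, op_xPowQ_one_apply, map_sub, map_smul]

/-- `w_t x^y` as an element of `F[O]`. -/
def tw (w : R.W) (y : E) (hy : y ∈ O) : quasiPol F O :=
  (R.twc q D.t w y : F) • qmon F (w.1.linear y) (IsOrbit.linear_mem R D.orbit hy w)

omit [Finite ι] in
theorem tw_one (y : E) (hy : y ∈ O) : D.tw 1 y hy = qmon F y hy := by
  have h0 : -R.trl (1 : R.W) = 0 := by rw [neg_eq_zero]; rfl
  have h1 : R.twc q D.t 1 y = 1 := by rw [twc_eq, h0, ofAdd_zero, map_one]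
  rw [tw, h1, Units.val_one, one_smul]
  rfl

theorem op_tw (j : R.Node) (w : R.W) {y : E} (hy : y ∈ O) (h0 : 0 ≤ ⟪R.grad j, w.1.linear y⟫)
    (h1 : ⟪R.grad j, w.1.linear y⟫ ≤ 1) :
    D.op j (D.tw w y hy)
      = (D.wallFactor j ⟪R.grad j, w.1.linear y⟫ : F) • D.tw (R.s j * w) y hy := by
  rw [tw, map_smul, D.op_qmon_of_nonneg j _ h0 h1, refl, tw, R.twc_mul q D.orbit D.mem _ _ hy,
    Units.val_mul, smul_smul, smul_smul, smul_smul]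
  have : ∀ (h : (R.s j * w).1.linear y ∈ O) (h' : (R.s j).1.linear (w.1.linear y) ∈ O),
    qmon F _ h' = qmon F _ h := fun _ _ => rfl
  rw [this (IsOrbit.linear_mem R D.orbit hy _)]
  congr 1
  ring

/-- `y` lies in the unit strip of every root whose coroot is in the lattice spanned by the coroots
attached to `i` and `j`. -/
def IsSmall (i j : R.Node) (y : E) : Prop :=
  ∀ a, (⟨R.P.coroot a, R.coroot_mem a⟩ : R.Qv) ∈ AddSubgroup.closure {R.cograd i, R.cograd j} →
    |⟪R.P.root a, y⟫| ≤ 1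

omit [Finite ι] in
theorem IsSmall.abs_le {i j k : R.Node} {y : E} (h : IsSmall i j y) (hk : k = i ∨ k = j) :
    |⟪R.grad k, y⟫| ≤ 1 := by
  rw [← root_gradIndex]
  apply h
  have : (⟨R.P.coroot (R.gradIndex k), R.coroot_mem _⟩ : R.Qv) = R.cograd k :=
    Subtype.ext (R.coroot_gradIndex k)
  rw [this]
  apply AddSubgroup.subset_closure
  rcases hk with rfl | rfl <;> simp

omit [Finite ι] in
theorem IsSmall.s_linear {i j k : R.Node} {y : E} (h : IsSmall i j y) (hk : k = i ∨ k = j) :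
    IsSmall i j ((R.s k).1.linear y) := by
  intro a ha
  obtain ⟨b, h1, h2⟩ := R.linear_coroot (R.s k) a
  have h3 := R.inner_linear_eq (R.s k) (R.P.root a) y
  rw [h1] at h3
  have h4 : ⟪R.P.root a, (R.s k).1.linear y⟫ = ⟪R.P.root b, y⟫ := by
    rw [h3, s_inv]
  rw [h4]
  apply h
  have hb : (⟨R.P.coroot b, R.coroot_mem b⟩ : R.Qv)
      = R.lin (R.s k) ⟨R.P.coroot a, R.coroot_mem a⟩ := Subtype.ext h2.symm
  obtain ⟨m, hm⟩ := R.grad_int k ⟨R.P.coroot a, R.coroot_mem a⟩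
  rw [hb, R.lin_s k _ m hm]
  refine AddSubgroup.sub_mem _ ha (AddSubgroup.zsmul_mem _ (AddSubgroup.subset_closure ?_) m)
  rcases hk with rfl | rfl <;> simp

/-- Every point can be translated to a small one. -/
theorem exists_isSmall (i j : R.Node) (y : E) :
    ∃ ν ∈ AddSubgroup.closure {R.cograd i, R.cograd j}, IsSmall i j (y + (ν : E)) := by
  set S := {z : E | (∃ ν ∈ AddSubgroup.closure {R.cograd i, R.cograd j}, z = y + (ν : E)) ∧
    ‖z‖ ≤ ‖y‖} with hS
  have hfin : S.Finite := by
    apply (R.orbit_inter_ball_finite y ‖y‖).subset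
    rintro z ⟨⟨ν, -, rfl⟩, hz⟩
    obtain ⟨g, hg⟩ := R.exists_translation ν
    exact ⟨⟨g, (hg y).symm⟩, hz⟩
  have hne : S.Nonempty := ⟨y, ⟨0, AddSubgroup.zero_mem _, by simp⟩, le_rfl⟩
  -- A shortest vector `z` of the coset works: `‖z ± a^∨‖ ≥ ‖z‖` for both signs says exactly `|⟪a,
  -- z⟫| ≤ 1`.
  obtain ⟨z, ⟨⟨ν, hν, rfl⟩, hz⟩, hmin⟩ := hfin.exists_minimalFor (fun z => ‖z‖) S hne
  refine ⟨ν, hν, fun a ha => ?_⟩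
  have hp := R.norm_root_pos a
  have key : ∀ ε : ℤ, ‖y + (ν : E)‖ ≤ ‖y + (ν : E) + ε • R.P.coroot a‖ := by
    intro ε
    by_contra! hlt
    refine absurd (hmin (j := y + (ν : E) + ε • R.P.coroot a) ⟨⟨ν + ε • ⟨_, R.coroot_mem a⟩,
      AddSubgroup.add_mem _ hν (AddSubgroup.zsmul_mem _ ha ε), ?_⟩, by linarith⟩ hlt.le)
      (not_le.mpr hlt)
    rw [AddSubgroup.coe_add, AddSubgroup.coe_zsmul, add_assoc]
  have h1 := pow_le_pow_left₀ (norm_nonneg _) (key 1) 2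
  have h2 := pow_le_pow_left₀ (norm_nonneg _) (key (-1)) 2
  rw [one_smul, norm_add_sq_real (y + (ν : E))] at h1
  rw [neg_smul, one_smul, ← sub_eq_add_neg, norm_sub_sq_real] at h2
  have h3 : ‖R.P.coroot a‖ ^ 2 = 4 / ‖R.P.root a‖ ^ 2 := by
    rw [R.coroot_eq, norm_smul, mul_pow, Real.norm_eq_abs, sq_abs]; field_simp; norm_num
  have h4 : ⟪y + (ν : E), R.P.coroot a⟫ = 2 / ‖R.P.root a‖ ^ 2 * ⟪R.P.root a, y + (ν : E)⟫ := by
    rw [R.coroot_eq, inner_smul_right, real_inner_comm]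
  rw [h3, h4] at h1 h2
  have h5 : 0 < 4 / ‖R.P.root a‖ ^ 2 := by positivity
  rw [abs_le]
  have e : 2 * (2 / ‖R.P.root a‖ ^ 2 * ⟪R.P.root a, y + (ν : E)⟫)
      = 4 / ‖R.P.root a‖ ^ 2 * ⟪R.P.root a, y + (ν : E)⟫ := by ring
  rw [e] at h1 h2
  constructor
  · by_contra! h
    nlinarith
  · by_contra! h
    nlinarith

/-- Reduction to small dominant quasi-monomials. -/
theorem eq_top_of_stable {i j : R.Node} (K : Submodule F (quasiPol F O))
    (hi : ∀ v ∈ K, D.op i v ∈ K) (hj : ∀ v ∈ K, D.op j v ∈ K)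
    (hX : ∀ ν ∈ AddSubgroup.closure {R.cograd i, R.cograd j}, ∀ v ∈ K, D.mul (mon F ν) v ∈ K)
    (hp : ∃ p : E, 0 < ⟪(R.cograd i : E), p⟫ ∧ 0 < ⟪(R.cograd j : E), p⟫)
    (hdom : ∀ y (hy : y ∈ O), IsSmall i j y → 0 ≤ ⟪R.grad i, y⟫ → 0 ≤ ⟪R.grad j, y⟫ →
      qmon F y hy ∈ K) : K = ⊤ := by
  obtain ⟨p, hpi, hpj⟩ := hp
  have hrefl : ∀ k, (∀ v ∈ K, D.op k v ∈ K) → ∀ y (hy : y ∈ O), |⟪R.grad k, y⟫| ≤ 1 →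
      ⟪R.grad k, y⟫ < 0 → (∀ hy', qmon F ((R.s k).1.linear y) hy' ∈ K) → qmon F y hy ∈ K := by
    intro k hk y hy hab hneg h
    rw [_root_.abs_le] at hab
    have hy' := IsOrbit.linear_mem R D.orbit hy (R.s k)
    have h4 := hk _ (h hy')
    rw [D.op_qmon_of_nonneg k hy' (by rw [inner_grad_s_linear]; linarith)
      (by rw [inner_grad_s_linear]; linarith), refl, smul_smul, ← Units.val_mul,
      Submodule.smul_mem_iff _ (Units.ne_zero _)] at h4
    have hss : (R.s k).1.linear ((R.s k).1.linear y) = y := by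
      rw [← W_mul_linear, s_mul_self]; rfl
    simpa only [hss] using h4
  have hsmall : ∀ y (hy : y ∈ O), IsSmall i j y → qmon F y hy ∈ K := by
    intro y hy hys
    set S := {z : E | ∃ hz : z ∈ O, IsSmall i j z ∧ ‖z‖ ≤ ‖y‖ ∧ qmon F z hz ∉ K} with hS
    have hfin : S.Finite := by
      apply (R.orbit_inter_ball_finite y ‖y‖).subset
      rintro z ⟨hz, -, hn, -⟩
      refine ⟨?_, hn⟩
      obtain ⟨y0, rfl⟩ := D.orbit
      obtain ⟨g, rfl⟩ := hz
      obtain ⟨h, rfl⟩ := hy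
      exact ⟨g * h⁻¹, by
        change g.1 y0 = (g * h⁻¹).1 (h.1 y0)
        rw [W_mul_apply, W_inv_apply_self]⟩
    by_contra hne
    -- Take a counterexample maximising `⟪z, p⟫`; small points of the orbit of bounded norm are
    -- finite in number. If a gradient were negative at `z`, the reflected point would be a
    -- counterexample with a larger value, since `p` is positive on the coroot. Hence `z` is
    -- dominant, which `hdom` excludes.
    obtain ⟨z, ⟨hz, hzs, hzn, hzK⟩, hmax⟩ := hfin.exists_maximalFor (fun z => ⟪z, p⟫) S
      ⟨y, hy, hys, le_rfl, hne⟩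
    have hstep : ∀ k, (k = i ∨ k = j) → (∀ v ∈ K, D.op k v ∈ K) →
        0 < ⟪(R.cograd k : E), p⟫ → 0 ≤ ⟪R.grad k, z⟫ := by
      intro k hk hkK hkp
      by_contra! hneg
      refine hzK (hrefl k hkK z hz (hzs.abs_le hk) hneg fun hy' => ?_)
      by_contra hK
      have hnorm : ‖(R.s k).1.linear z‖ = ‖z‖ := by
        have := R.linear_inner (R.s k) z z
        rw [real_inner_self_eq_norm_sq, real_inner_self_eq_norm_sq] at this
        exact (sq_eq_sq₀ (norm_nonneg _) (norm_nonneg _)).mp this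
      have hlt : ⟪z, p⟫ < ⟪(R.s k).1.linear z, p⟫ := by
        rw [EuclideanRoots.s_linear, inner_sub_left, inner_smul_left, RCLike.conj_to_real]
        nlinarith
      exact absurd (hmax (j := (R.s k).1.linear z) ⟨hy', hzs.s_linear hk, by rw [hnorm]; exact hzn,
        hK⟩ hlt.le) (not_le.mpr hlt)
    exact hzK (hdom z hz hzs (hstep i (Or.inl rfl) hi hpi) (hstep j (Or.inr rfl) hj hpj))
  rw [eq_top_iff]
  rintro v -
  refine qmon_induction (fun y hy => ?_) v
  obtain ⟨ν, hν, hsm⟩ := exists_isSmall i j y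
  have hy' := IsOrbit.add_mem R D.orbit hy ν
  have h1 := hX _ (AddSubgroup.neg_mem _ hν) _ (hsmall _ hy' hsm)
  rw [mul_mon_qmon] at h1
  have h2 : y + (ν : E) + ((-ν : R.Qv) : E) = y := by simp
  simpa only [h2] using h1

end HeckeData
end EuclideanRoots

/-! ### Braid relations at small dominant points, and their propagation. -/

namespace EuclideanRoots

variable {ι E : Type*} [NormedAddCommGroup E] [InnerProductSpace ℝ E] {R : EuclideanRoots ι E}
variable {F : Type*} [Field F] {q : Fˣ}

namespace HeckeData

variable {O : Set E} (D : R.HeckeData q O) [Finite ι] {i j : R.Node}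

/-- The point `w y` is small, and the gradients attached to `i` and `j` take the values `a` and `b`
there. -/
structure SmallAt (i j : R.Node) (y : E) (w : R.W) (a b : ℝ) : Prop where
  small : IsSmall i j (w.1.linear y)
  left : ⟪R.grad i, w.1.linear y⟫ = a
  right : ⟪R.grad j, w.1.linear y⟫ = b

omit [Finite ι] in
theorem SmallAt.step_left {y : E} {w : R.W} {a b n c b' : ℝ} (h : SmallAt i j y w a b)
    (hn : ⟪R.grad j, (R.cograd i : E)⟫ = n) (hc : c = -a) (hb : b' = b - a * n) :
    SmallAt i j y (R.s i * w) c b' := by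
  refine ⟨by rw [W_mul_linear]; exact h.small.s_linear (Or.inl rfl), ?_, ?_⟩
  · rw [inner_grad_s_mul_linear, inner_grad_cograd, h.left, hc]; ring
  · rw [inner_grad_s_mul_linear, hn, h.left, h.right, hb]

omit [Finite ι] in
theorem SmallAt.step_right {y : E} {w : R.W} {a b n c a' : ℝ} (h : SmallAt i j y w a b)
    (hn : ⟪R.grad i, (R.cograd j : E)⟫ = n) (hc : c = -b) (ha : a' = a - b * n) :
    SmallAt i j y (R.s j * w) a' c := by
  refine ⟨by rw [W_mul_linear]; exact h.small.s_linear (Or.inr rfl), ?_, ?_⟩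
  · rw [inner_grad_s_mul_linear, hn, h.left, h.right, ha]
  · rw [inner_grad_s_mul_linear, inner_grad_cograd, h.right, hc]; ring

theorem SmallAt.op_left {y : E} {w : R.W} {a b : ℝ} (h : SmallAt i j y w a b) (hy : y ∈ O)
    (ha : 0 ≤ a) : D.op i (D.tw w y hy) = (D.wallFactor i a : F) • D.tw (R.s i * w) y hy := by
  have h0 := h.left
  subst h0
  exact D.op_tw i w hy ha (_root_.abs_le.mp (h.small.abs_le (Or.inl rfl))).2

theorem SmallAt.op_right {y : E} {w : R.W} {a b : ℝ} (h : SmallAt i j y w a b) (hy : y ∈ O)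
    (hb : 0 ≤ b) : D.op j (D.tw w y hy) = (D.wallFactor j b : F) • D.tw (R.s j * w) y hy := by
  have h0 := h.right
  subst h0
  exact D.op_tw j w hy hb (_root_.abs_le.mp (h.small.abs_le (Or.inr rfl))).2

/-- Stability under `x^(± α_i^∨)` and `x^(± α_j^∨)` extends to the rank two lattice, and
`eq_top_of_stable` leaves only the small dominant quasi-monomials. -/
theorem braid_of_stable {n m : ℤ} (hn : ⟪R.grad i, (R.cograd j : E)⟫ = n)
    (hm : ⟪R.grad j, (R.cograd i : E)⟫ = m) (l : ℕ)
    (hst : (D.braidData i j n m hn hm).Stable ((D.braidData i j n m hn hm).ker l))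
    (hp : ∃ p : E, 0 < ⟪(R.cograd i : E), p⟫ ∧ 0 < ⟪(R.cograd j : E), p⟫)
    (hdom : ∀ y (hy : y ∈ O), IsSmall i j y → 0 ≤ ⟪R.grad i, y⟫ → 0 ≤ ⟪R.grad j, y⟫ →
      qmon F y hy ∈ (D.braidData i j n m hn hm).ker l) :
    altProd (D.op i) (D.op j) l = altProd (D.op j) (D.op i) l := by
  obtain ⟨hi, hj, hM⟩ := hst
  have htop := D.eq_top_of_stable _ hi hj (fun ν hν => D.stable_closure (fun ν hν v hv => by
    obtain ⟨h1, h2, h3, h4⟩ := hM v hv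
    simp only [braidData, xPowQ_zero, mul_one, one_mul] at h1 h2 h3 h4
    rcases hν with rfl | hν
    · exact D.mul_mon_cograd_mem h1 h2
    · rw [Set.mem_singleton_iff.mp hν]
      exact D.mul_mon_cograd_mem h3 h4) hν) hp hdom
  refine LinearMap.ext fun v => ?_
  have hv : v ∈ (D.braidData i j n m hn hm).ker l := htop ▸ Submodule.mem_top
  rwa [BraidData.ker, LinearMap.mem_ker, LinearMap.sub_apply, sub_eq_zero] at hv

omit [Finite ι] in
-- The two inequalities say that the combination of coroots with coefficients `x`, `y` lies in the
-- open dominant chamber.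
theorem exists_dominant (x y : ℝ)
    (h1 : 0 < 2 * x + y * ⟪R.grad i, (R.cograd j : E)⟫)
    (h2 : 0 < x * ⟪R.grad j, (R.cograd i : E)⟫ + 2 * y) :
    ∃ p : E, 0 < ⟪(R.cograd i : E), p⟫ ∧ 0 < ⟪(R.cograd j : E), p⟫ := by
  refine ⟨x • (R.cograd i : E) + y • (R.cograd j : E), ?_, ?_⟩
  · have hp : 0 < ‖R.grad i‖ := norm_pos_iff.mpr (R.grad_ne_zero i)
    have h : 0 < ⟪R.grad i, x • (R.cograd i : E) + y • (R.cograd j : E)⟫ := by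
      rw [inner_add_right, inner_smul_right, inner_smul_right, inner_grad_cograd]; linarith
    rw [R.cograd_eq i] at h ⊢
    rw [inner_smul_left, RCLike.conj_to_real]
    positivity
  · have hp : 0 < ‖R.grad j‖ := norm_pos_iff.mpr (R.grad_ne_zero j)
    have h : 0 < ⟪R.grad j, x • (R.cograd i : E) + y • (R.cograd j : E)⟫ := by
      rw [inner_add_right, inner_smul_right, inner_smul_right, inner_grad_cograd]; linarith
    rw [R.cograd_eq j] at h ⊢
    rw [inner_smul_left, RCLike.conj_to_real]
    positivity

omit [Finite ι] in
theorem wallFactor_eq (h : D.κ i = D.κ j ∧ D.υ i = D.υ j) (a : ℝ) :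
    D.wallFactor i a = D.wallFactor j a := by
  rw [wallFactor, wallFactor, h.1, h.2]

/-- This and the three following results share one argument. Along either word, started at a small
dominant point, the next gradient value is always nonnegative, so each letter only contributes a
wall factor. The values met are those of the positive roots of the rank two system, in opposite
orders for the two words, and the final twisted monomials agree by the braid relation in `W`. -/
theorem op_braid_two (hn : ⟪R.grad i, (R.cograd j : E)⟫ = 0)
    (hm : ⟪R.grad j, (R.cograd i : E)⟫ = 0) :
    altProd (D.op i) (D.op j) 2 = altProd (D.op j) (D.op i) 2 := by
  refine D.braid_of_stable (n := 0) (m := 0) (by simpa using hn) (by simpa using hm) 2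
    (BraidData.stable_ker_two _)
    (exists_dominant 1 1 (by rw [hn]; norm_num) (by rw [hm]; norm_num)) fun y hy hs h1 h2 => ?_
  rw [BraidData.mem_ker_two]
  change D.op i (D.op j _)
    = D.op j (D.op i _)
  rw [← D.tw_one y hy]
  have hW := R.braid_two hn hm
  simp only [altProd] at hW
  obtain ⟨a, ha⟩ : ∃ a, a = ⟪R.grad i, y⟫ := ⟨_, rfl⟩
  obtain ⟨b, hb⟩ : ∃ b, b = ⟪R.grad j, y⟫ := ⟨_, rfl⟩
  rw [← ha] at h1
  rw [← hb] at h2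
  have s0 : SmallAt i j y 1 a b := ⟨hs, ha.symm, hb.symm⟩
  have p1 := s0.step_left (c := -a) (b' := b) hm (by ring) (by ring)
  have r1 := s0.step_right (c := -b) (a' := a) hn (by ring) (by ring)
  conv_rhs =>
    simp only [map_smul, s0.op_left D hy (by linarith), p1.op_right D hy (by linarith)]
  conv_lhs =>
    simp only [map_smul, s0.op_right D hy (by linarith), r1.op_left D hy (by linarith)]
  simp only [hW, smul_smul]
  congr 1
  ring

/-- The values `a`, `a + b`, `b` are met at alternate nodes in the two words, so the scalars agree
only because both nodes carry the same parameters. For lengths four and six each value is met at the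
same node in both words. -/
theorem op_braid_three (hn : ⟪R.grad i, (R.cograd j : E)⟫ = -1)
    (hm : ⟪R.grad j, (R.cograd i : E)⟫ = -1) :
    altProd (D.op i) (D.op j) 3 = altProd (D.op j) (D.op i) 3 := by
  have hc := D.conj i j hn hm
  refine D.braid_of_stable (n := -1) (m := -1) (by simpa using hn) (by simpa using hm) 3
    (BraidData.stable_ker_three _ (by simp only [braidData, kp, hc.1])
      (by simp only [braidData, up, hc.2]))
    (exists_dominant 1 1 (by rw [hn]; norm_num) (by rw [hm]; norm_num)) fun y hy hs h1 h2 => ?_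
  rw [BraidData.mem_ker_three]
  change D.op i (D.op j (D.op i _))
    = D.op j (D.op i (D.op j _))
  rw [← D.tw_one y hy]
  have hW := R.braid_three hn hm
  simp only [altProd] at hW
  obtain ⟨a, ha⟩ : ∃ a, a = ⟪R.grad i, y⟫ := ⟨_, rfl⟩
  obtain ⟨b, hb⟩ : ∃ b, b = ⟪R.grad j, y⟫ := ⟨_, rfl⟩
  rw [← ha] at h1
  rw [← hb] at h2
  have s0 : SmallAt i j y 1 a b := ⟨hs, ha.symm, hb.symm⟩
  have p1 := s0.step_left (c := -a) (b' := a + b) hm (by ring) (by ring)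
  have p2 := p1.step_right (c := -a - b) (a' := b) hn (by ring) (by ring)
  have r1 := s0.step_right (c := -b) (a' := a + b) hn (by ring) (by ring)
  have r2 := r1.step_left (c := -a - b) (b' := a) hm (by ring) (by ring)
  conv_lhs =>
    simp only [map_smul, s0.op_left D hy (by linarith), p1.op_right D hy (by linarith),
      p2.op_left D hy (by linarith)]
  conv_rhs =>
    simp only [map_smul, s0.op_right D hy (by linarith), r1.op_left D hy (by linarith),
      r2.op_right D hy (by linarith)]
  simp only [hW, smul_smul, D.wallFactor_eq hc]
  congr 1
  ring

theorem op_braid_four (hn : ⟪R.grad i, (R.cograd j : E)⟫ = -1)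
    (hm : ⟪R.grad j, (R.cograd i : E)⟫ = -2) :
    altProd (D.op i) (D.op j) 4 = altProd (D.op j) (D.op i) 4 := by
  refine D.braid_of_stable (n := -1) (m := -2) (by simpa using hn) (by simpa using hm) 4
    (BraidData.stable_ker_four _)
    -- With Cartan integers `-1` and `-2` the coefficients `2` and `3` give the positive values `1`
    -- and `2`; equal coefficients would not do.
    (exists_dominant 2 3 (by rw [hn]; norm_num) (by rw [hm]; norm_num)) fun y hy hs h1 h2 => ?_
  rw [BraidData.mem_ker_four]
  change D.op i (D.op j (D.op i (D.op j _)))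
    = D.op j (D.op i (D.op j (D.op i _)))
  rw [← D.tw_one y hy]
  have hW := R.braid_four hn hm
  simp only [altProd] at hW
  obtain ⟨a, ha⟩ : ∃ a, a = ⟪R.grad i, y⟫ := ⟨_, rfl⟩
  obtain ⟨b, hb⟩ : ∃ b, b = ⟪R.grad j, y⟫ := ⟨_, rfl⟩
  rw [← ha] at h1
  rw [← hb] at h2
  have s0 : SmallAt i j y 1 a b := ⟨hs, ha.symm, hb.symm⟩
  have p1 := s0.step_left (c := -a) (b' := 2 * a + b) hm (by ring) (by ring)
  have p2 := p1.step_right (c := -2 * a - b) (a' := a + b) hn (by ring) (by ring)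
  have p3 := p2.step_left (c := -a - b) (b' := b) hm (by ring) (by ring)
  have r1 := s0.step_right (c := -b) (a' := a + b) hn (by ring) (by ring)
  have r2 := r1.step_left (c := -a - b) (b' := 2 * a + b) hm (by ring) (by ring)
  have r3 := r2.step_right (c := -2 * a - b) (a' := a) hn (by ring) (by ring)
  conv_rhs =>
    simp only [map_smul, s0.op_left D hy (by linarith), p1.op_right D hy (by linarith),
      p2.op_left D hy (by linarith), p3.op_right D hy (by linarith)]
  conv_lhs =>
    simp only [map_smul, s0.op_right D hy (by linarith), r1.op_left D hy (by linarith),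
      r2.op_right D hy (by linarith), r3.op_left D hy (by linarith)]
  simp only [hW, smul_smul]
  congr 1
  ring

theorem op_braid_six (hn : ⟪R.grad i, (R.cograd j : E)⟫ = -1)
    (hm : ⟪R.grad j, (R.cograd i : E)⟫ = -3) :
    altProd (D.op i) (D.op j) 6 = altProd (D.op j) (D.op i) 6 := by
  refine D.braid_of_stable (n := -1) (m := -3) (by simpa using hn) (by simpa using hm) 6
    (BraidData.stable_ker_six _)
    -- With Cartan integers `-1` and `-3` the values are again `8 - 7 = 1` and `14 - 12 = 2`.
    (exists_dominant 4 7 (by rw [hn]; norm_num) (by rw [hm]; norm_num)) fun y hy hs h1 h2 => ?_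
  rw [BraidData.mem_ker_six]
  change D.op i (D.op j (D.op i (D.op j (D.op i (D.op j _)))))
    = D.op j (D.op i (D.op j (D.op i (D.op j (D.op i _)))))
  rw [← D.tw_one y hy]
  have hW := R.braid_six hn hm
  simp only [altProd] at hW
  obtain ⟨a, ha⟩ : ∃ a, a = ⟪R.grad i, y⟫ := ⟨_, rfl⟩
  obtain ⟨b, hb⟩ : ∃ b, b = ⟪R.grad j, y⟫ := ⟨_, rfl⟩
  rw [← ha] at h1
  rw [← hb] at h2
  have s0 : SmallAt i j y 1 a b := ⟨hs, ha.symm, hb.symm⟩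
  have p1 := s0.step_left (c := -a) (b' := 3 * a + b) hm (by ring) (by ring)
  have p2 := p1.step_right (c := -3 * a - b) (a' := 2 * a + b) hn (by ring) (by ring)
  have p3 := p2.step_left (c := -2 * a - b) (b' := 3 * a + 2 * b) hm (by ring) (by ring)
  have p4 := p3.step_right (c := -3 * a - 2 * b) (a' := a + b) hn (by ring) (by ring)
  have p5 := p4.step_left (c := -a - b) (b' := b) hm (by ring) (by ring)
  have r1 := s0.step_right (c := -b) (a' := a + b) hn (by ring) (by ring)
  have r2 := r1.step_left (c := -a - b) (b' := 3 * a + 2 * b) hm (by ring) (by ring)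
  have r3 := r2.step_right (c := -3 * a - 2 * b) (a' := 2 * a + b) hn (by ring) (by ring)
  have r4 := r3.step_left (c := -2 * a - b) (b' := 3 * a + b) hm (by ring) (by ring)
  have r5 := r4.step_right (c := -3 * a - b) (a' := a) hn (by ring) (by ring)
  conv_rhs =>
    simp only [map_smul, s0.op_left D hy (by linarith), p1.op_right D hy (by linarith),
      p2.op_left D hy (by linarith), p3.op_right D hy (by linarith),
      p4.op_left D hy (by linarith), p5.op_right D hy (by linarith)]
  conv_lhs =>
    simp only [map_smul, s0.op_right D hy (by linarith), r1.op_left D hy (by linarith),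
      r2.op_right D hy (by linarith), r3.op_left D hy (by linarith),
      r4.op_right D hy (by linarith), r5.op_left D hy (by linarith)]
  simp only [hW, smul_smul]
  congr 1
  ring

/-- The braid relation. -/
theorem op_braid (hij : i ≠ j) :
    altProd (D.op i) (D.op j) (orderOf (R.s i * R.s j))
      = altProd (D.op j) (D.op i) (orderOf (R.s i * R.s j)) := by
  rcases R.cartan_cases hij with h | h | h | h | h | h | h
  · rw [R.orderOf_two h.1 h.2, D.op_braid_two h.1 h.2]
  · rw [R.orderOf_three h.1 h.2, D.op_braid_three h.1 h.2]
  · rw [R.orderOf_four h.1 h.2, D.op_braid_four h.1 h.2]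
  · rw [← R.orderOf_swap, R.orderOf_four h.2 h.1, D.op_braid_four h.2 h.1]
  · rw [R.orderOf_six h.1 h.2, D.op_braid_six h.1 h.2]
  · rw [← R.orderOf_swap, R.orderOf_six h.2 h.1, D.op_braid_six h.2 h.1]
  · rw [R.orderOf_eq_zero hij h.1 h.2, altProd, altProd]

end HeckeData
end EuclideanRoots

/-! ### Algebras given by generators and relations -/

theorem map_altProd {A B G : Type*} [Monoid A] [Monoid B] [FunLike G A B] [MonoidHomClass G A B]
    (f : G) (a b : A) (n : ℕ) : f (altProd a b n) = altProd (f a) (f b) n := by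
  induction n generalizing a b with
  | zero => exact map_one f
  | succ n ih => rw [altProd, altProd, map_mul, ih]

theorem coeff_sum_smul {F G A : Type*} [Field F] [AddCommMonoid A] [Module F A]
    (f : AddMonoidAlgebra F G →ₗ[F] A) (p : AddMonoidAlgebra F G) :
    (p.coeff.sum fun μ d => d • f (mon F μ)) = f p := by
  induction p using AddMonoidAlgebra.induction_linear with
  | zero => simp
  | add p p' hp hp' =>
    rw [map_add, ← hp, ← hp', AddMonoidAlgebra.coeff_add]
    exact Finsupp.sum_add_index' (fun _ => zero_smul _ _) fun _ _ _ => add_smul _ _ _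
  | single μ c =>
    rw [AddMonoidAlgebra.coeff_single, single_eq_smul_mon, map_smul]
    exact Finsupp.sum_single_index (zero_smul _ _)

theorem map_quadratic {F A B : Type*} [Field F] [Ring A] [Ring B] [Algebra F A] [Algebra F B]
    (f : A →ₐ[F] B) (x : A) (c : Fˣ)
    (h : f x * f x = ((c : F) - (c : F)⁻¹) • f x + 1) :
    f ((x - algebraMap F A c) * (x + algebraMap F A (c : F)⁻¹)) = f 0 := by
  rw [map_mul, map_sub, map_add, AlgHom.commutes, AlgHom.commutes, map_zero, sub_mul, mul_add, h,
    mul_add, ← Algebra.commutes, ← Algebra.smul_def, ← Algebra.smul_def, ← map_mul,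
    mul_inv_cancel₀ (Units.ne_zero c), map_one, sub_smul]
  abel

/-- The formal sums in the cross relations are linear in the Laurent polynomial, so a map given by
`m` on monomials sends each of them to `m` of that polynomial. -/
theorem map_cross {F A B G : Type*} [Field F] [AddMonoid G] [Ring A] [Ring B]
    [Algebra F A] [Algebra F B] (f : A →ₐ[F] B) (m : AddMonoidAlgebra F G →ₗ[F] B) (X : G → A)
    (hX : ∀ μ, f (X μ) = m (mon F μ)) (x : A) (μ : G) (a p : AddMonoidAlgebra F G)
    (h : f x * m (mon F μ) = m a * f x + m p) :
    f (x * X μ - (a.coeff.sum fun μ d => d • X μ) * x) = f (p.coeff.sum fun μ d => d • X μ) := by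
  have hs : ∀ p : AddMonoidAlgebra F G, f (p.coeff.sum fun μ d => d • X μ) = m p := fun p => by
    rw [map_finsuppSum, ← coeff_sum_smul m p]
    simp only [map_smul, hX]
  rw [map_sub, map_mul, map_mul, hs, hs, hX, h, add_sub_cancel_left]

namespace EuclideanRoots

variable {ι E : Type*} [NormedAddCommGroup E] [InnerProductSpace ℝ E] (R : EuclideanRoots ι E)
variable {F : Type*} [Field F] (q : Fˣ) (k : R.Multiplicity F)

/-! ### The Hecke parameters attached to a multiplicity function -/

/-- If `α_j / 2` is not in `Φ^nr`, equality holds by convention. If it is, then, `Φ₀` being reduced,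
it is not itself an affine root and must come from the part of `Φ^nr` on which the gradient is even.
-/
theorem ups_eq_or_even (j : R.Node) : R.ups k j = R.kap k j ∨
    ∀ μ : R.Qv, ∃ n : ℤ, ⟪R.grad j, (μ : E)⟫ = ((2 * n : ℤ) : ℝ) := by
  by_cases h : (1 / 2 : ℝ) • R.simpleRoot j ∈ R.affRootsNr
  · refine Or.inr fun μ => ?_
    rcases h with ⟨i, l, h⟩ | ⟨i, l, hE, h⟩
    · exfalso
      have := R.isReduced
      have hg : (1 / 2 : ℝ) • R.grad j = R.P.root i := congrArg Prod.fst h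
      have hh : R.P.root (R.gradIndex j) = (2 : ℝ) • R.P.root i := by
        rw [root_gradIndex, ← hg, smul_smul]; norm_num
      have hd : ¬ LinearIndependent ℝ ![R.P.root (R.gradIndex j), R.P.root i] := fun hl => by
        have := LinearIndependent.pair_iff.mp hl 1 (-2) (by rw [hh]; module)
        norm_num at this
      have hn : ‖R.P.root (R.gradIndex j)‖ = 2 * ‖R.P.root i‖ := by rw [hh, norm_smul]; norm_num
      have hp := R.norm_root_pos i
      rcases RootPairing.IsReduced.eq_or_eq_neg (P := R.P) _ i hd with h4 | h4
      · rw [h4] at hn; linarith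
      · rw [h4, norm_neg] at hn; linarith
    · have hg : (1 / 2 : ℝ) • R.grad j = (1 / 2 : ℝ) • R.P.root i := congrArg Prod.fst h
      have hg' : R.grad j = R.P.root i := smul_right_injective E (by norm_num) hg
      obtain ⟨n, hn⟩ : ⟪R.P.root i, (μ : E)⟫ ∈ Set.range fun m : ℤ => (2 * m : ℝ) :=
        hE ▸ ⟨μ, μ.2, rfl⟩
      refine ⟨n, ?_⟩
      rw [hg', ← hn]
      push_cast
      rfl
  · exact Or.inl (by rw [ups, dif_neg h])

theorem crossTerm_spec_inv (j : R.Node) (μ : R.Qv) :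
    (1 - R.xSimple q j ^ 2) * R.crossTerm q k j μ =
      (algebraMap F _ ((R.kap k j : F) - (R.kap k j : F)⁻¹)
        + algebraMap F _ ((R.ups k j : F) - (R.ups k j : F)⁻¹) * R.xSimple q j)
      * (mon F μ - R.wAct q (R.s j) μ) := by
  simpa only [Units.val_inv_eq_inv_val] using R.crossTerm_spec q k j μ

/-- In a rank two system of type `A₂`, `s_i s_j` carries `α_i` to `α_j`; here this holds for the
affine functionals, so invariance applies. -/
theorem kap_eq_of_cartan {i j : R.Node} (hij : ⟪R.grad i, (R.cograd j : E)⟫ = -1)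
    (hji : ⟪R.grad j, (R.cograd i : E)⟫ = -1) : R.kap k i = R.kap k j := by
  refine k.invariant (R.s i * R.s j) _ _ fun y => ?_
  change ev (R.simpleRoot j) ((R.s i * R.s j).1 y) = ev (R.simpleRoot i) y
  rw [W_mul_apply, R.s_apply i, ev_sub_smul_cograd, hji, ev_s, R.s_apply j, ev_sub_smul_cograd, hij]
  ring

variable {R}

theorem ups_eq_of_cartan {i j : R.Node} (hij : ⟪R.grad i, (R.cograd j : E)⟫ = -1) :
    R.ups k i = R.kap k i := by
  rcases R.ups_eq_or_even k i with h | h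
  · exact h
  · obtain ⟨n, hn⟩ := h (R.cograd j)
    rw [hij] at hn
    have : -1 = 2 * n := by exact_mod_cast hn
    omega

variable {q} {O : Set E} {t : R.Torus F}

/-- The Hecke parameters `k_j`, `u_j`. -/
def Multiplicity.heckeData (hO : R.IsOrbit O) (ht : t ∈ R.torusOf q O) : R.HeckeData q O where
  κ := R.kap k
  υ := R.ups k
  t := t
  orbit := hO
  mem := ht
  even := R.ups_eq_or_even k
  conj i j hij hji := by
    have h := R.kap_eq_of_cartan k hij hji
    exact ⟨h, by rw [ups_eq_of_cartan k hij, ups_eq_of_cartan k hji, h]⟩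

/-! ### The representations of the double affine Hecke algebra -/

theorem DAHA.hom_ext {A : Type*} [Semiring A] [Algebra F A] {f g : R.DAHA q k →ₐ[F] A}
    (hT : ∀ j, f (R.T q k j) = g (R.T q k j)) (hX : ∀ μ, f (R.X q k μ) = g (R.X q k μ)) :
    f = g := by
  refine RingQuot.ringQuot_ext' _ _ _ (FreeAlgebra.hom_ext (funext fun x => ?_))
  cases x with
  | T j => exact hT j
  | X μ => exact hX μ

theorem HX.hom_ext {A : Type*} [Semiring A] [Algebra F A] {f g : R.HX q k →ₐ[F] A}
    (hT : ∀ i, f ⟨_, R.T_mem_HX q k i⟩ = g ⟨_, R.T_mem_HX q k i⟩)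
    (hX : ∀ μ, f ⟨_, R.X_mem_HX q k μ⟩ = g ⟨_, R.X_mem_HX q k μ⟩) : f = g := by
  refine AlgHom.adjoin_ext fun x hx => ?_
  rcases hx with ⟨μ, rfl⟩ | ⟨i, rfl⟩
  · exact hX μ
  · exact hT i

theorem IsQuasiPolRep.unique {ρ ρ' : R.DAHA q k →ₐ[F] Module.End F (quasiPol F O)}
    (h : R.IsQuasiPolRep q k O t ρ) (h' : R.IsQuasiPolRep q k O t ρ') : ρ = ρ' :=
  DAHA.hom_ext k
    (fun j => end_ext fun y hy => Subtype.ext ((h.2 j y hy).trans (h'.2 j y hy).symm))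
    fun μ => end_ext fun y hy => Subtype.ext ((h.1 μ y hy).trans (h'.1 μ y hy).symm)

theorem IsHXRep.unique {π π' : R.HX q k →ₐ[F] Module.End F (quasiPol F O)}
    (h : R.IsHXRep q k O π) (h' : R.IsHXRep q k O π') : π = π' :=
  HX.hom_ext k
    (fun i => end_ext fun y hy => Subtype.ext ((h.2 i y hy).trans (h'.2 i y hy).symm))
    fun μ => end_ext fun y hy => Subtype.ext ((h.1 μ y hy).trans (h'.1 μ y hy).symm)

variable [Finite ι] (hO : R.IsOrbit O) (ht : t ∈ R.torusOf q O)

/-- The action of the free algebra on `F[O]`. -/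
def HeckeData.freeHom (D : R.HeckeData q O) :
    FreeAlgebra F R.Gen →ₐ[F] Module.End F (quasiPol F O) :=
  FreeAlgebra.lift F fun
    | .T j => D.op j
    | .X μ => D.mul (mon F μ)

omit [Finite ι] in
theorem HeckeData.freeHom_T (D : R.HeckeData q O) (j : R.Node) :
    D.freeHom (FreeAlgebra.ι F (Gen.T j)) = D.op j := FreeAlgebra.lift_ι_apply _ _

omit [Finite ι] in
theorem HeckeData.freeHom_X (D : R.HeckeData q O) (μ : R.Qv) :
    D.freeHom (FreeAlgebra.ι F (Gen.X μ)) = D.mul (mon F μ) := FreeAlgebra.lift_ι_apply _ _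

theorem freeHom_rel {x y : FreeAlgebra F R.Gen} (h : R.Rel q k x y) :
    (k.heckeData hO ht).freeHom x = (k.heckeData hO ht).freeHom y := by
  set D := k.heckeData hO ht
  induction h with
  | braid i j hij =>
    rw [map_altProd, map_altProd, D.freeHom_T, D.freeHom_T]
    exact D.op_braid hij
  | quadratic j =>
    refine map_quadratic (A := FreeAlgebra F R.Gen) (B := Module.End F (quasiPol F O)) D.freeHom _
      (R.kap k j) ?_
    rw [D.freeHom_T]
    exact D.op_mul_op j
  | X_add μ ν => rw [map_mul, D.freeHom_X, D.freeHom_X, D.freeHom_X, ← map_mul, mon_mul_mon]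
  | X_zero => rw [D.freeHom_X, map_one, mon, ← AddMonoidAlgebra.one_def, map_one]
  | cross j μ =>
    refine map_cross (A := FreeAlgebra F R.Gen) (B := Module.End F (quasiPol F O)) D.freeHom
      D.mul.toLinearMap (fun μ => FreeAlgebra.ι F (Gen.X μ)) D.freeHom_X
      _ μ _ _ ?_
    rw [D.freeHom_T]
    exact D.op_mul_mon j μ _ (R.crossTerm_spec_inv q k j μ)

/-- The quasi-polynomial representation. -/
def quasiPolRep : R.DAHA q k →ₐ[F] Module.End F (quasiPol F O) :=
  RingQuot.liftAlgHom F ⟨(k.heckeData hO ht).freeHom, fun _ _ => freeHom_rel k hO ht⟩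

theorem isQuasiPolRep : R.IsQuasiPolRep q k O t (quasiPolRep k hO ht) := by
  constructor
  · intro μ y hy
    rw [quasiPolRep, X, RingQuot.liftAlgHom_mkAlgHom_apply, HeckeData.freeHom_X,
      HeckeData.mul_mon_qmon]
    rfl
  · intro j y hy
    rw [quasiPolRep, T, RingQuot.liftAlgHom_mkAlgHom_apply, HeckeData.freeHom_T,
      HeckeData.op_qmon]
    rfl

omit [Finite ι] in
-- The reflections `s_1, …, s_r` have no translation part, so no value of `t` enters; this is why
-- the `H^X`-action is independent of `t`.
theorem twAct_some (i : R.base.support) (y : E) :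
    R.twAct q t (R.s (some i)) y = mon F ((R.s (some i)).1 y) := by
  have h0 : (R.s (some i)).1 0 = 0 := by
    rw [s_apply]; simp [ev, simpleRoot, cst]
  have h1 : -R.trl (R.s (some i)) = 0 := neg_eq_zero.mpr (Subtype.ext h0)
  have h2 : (R.s (some i)).1 y = (R.s (some i)).1.linear y := by
    have := R.W_apply (R.s (some i)) y
    rwa [h0, add_zero] at this
  rw [twAct_eq, twc_eq, h1, ofAdd_zero, map_one, h2]
  rfl

theorem isHXRep : R.IsHXRep q k O ((quasiPolRep k hO ht).comp (R.HX q k).val) := by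
  have h := isQuasiPolRep k hO ht
  refine ⟨h.1, fun i y hy => ?_⟩
  rw [← twAct_some (q := q) (t := t)]
  exact h.2 (some i) y hy

/-! ### The polynomial representation -/

/-- At the origin both truncated terms vanish and `T_j x^0 = κ_j x^0`. Since `x^μ` is multiplication
by `x^μ` applied to `x^0`, the cross relation computes `T_j x^μ`. -/
theorem HeckeData.op_qmon_lattice (D : R.HeckeData q (R.Qv : Set E)) (j : R.Node) (μ : R.Qv)
    (p : AddMonoidAlgebra F R.Qv)
    (hp : (1 - R.xSimple q j ^ 2) * p
      = (algebraMap F _ ((D.κ j : F) - (D.κ j : F)⁻¹)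
        + algebraMap F _ ((D.υ j : F) - (D.υ j : F)⁻¹) * R.xSimple q j)
        * (mon F μ - R.wAct q (R.s j) μ)) :
    (D.op j (qmon F (μ : E) μ.2) : AddMonoidAlgebra F E)
      = R.inclHom ((D.κ j : F) • R.wAct q (R.s j) μ + p) := by
  have h0 : ⟪R.grad j, (0 : E)⟫ = ((0 : ℤ) : ℝ) := by simp
  have hz : (0 : E) ∈ (R.Qv : Set E) := R.Qv.zero_mem
  have hv : D.val j 0 = (D.κ j : F) • (1 : AddMonoidAlgebra F E) := by
    have hE : R.nablaE q j 0 = (0 : AddMonoidAlgebra F E) := by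
      apply R.cancel_one_sub q (j := j)
      rw [nablaE_spec, inner_zero_right, floorE_of_mem_Ico le_rfl (by norm_num)]
      simp [xPow_zero]
    have hO : R.nablaO q j 0 = (0 : AddMonoidAlgebra F E) := by
      apply R.cancel_one_sub q (j := j)
      rw [nablaO_spec, inner_zero_right, floorO_of_mem_Ico (by norm_num) (by norm_num)]
      simp
    rw [val, dl, hE, hO, R.twAct_s_of_int q D.orbit D.mem j hz 0 h0, h0, chiE_of_even 0 (by simp),
      chiO_of_even 0 (by simp), neg_zero, xPow_zero]
    simp [mon, AddMonoidAlgebra.one_def]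
  have hμ : qmon F (μ : E) μ.2 = D.mul (mon F μ) (qmon F 0 hz) := by
    rw [mul_mon_qmon]
    exact Subtype.ext (congrArg (mon F) (zero_add _).symm)
  have h1 : mon F (0 : E) = 1 := rfl
  have h := congrArg Subtype.val (LinearMap.congr_fun (D.op_mul_mon j μ p hp) (qmon F 0 hz))
  rw [hμ]
  refine h.trans ?_
  change R.inclHom _ * (D.op j (qmon F 0 hz) : AddMonoidAlgebra F E) + R.inclHom p * mon F 0 = _
  rw [op_qmon, hv, h1, mul_smul_comm, mul_one, mul_one, map_add, map_smul]

theorem IsQuasiPolRep.isPolRep {ρ : R.DAHA q k →ₐ[F] Module.End F (quasiPol F (R.Qv : Set E))}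
    (h : R.IsQuasiPolRep q k (R.Qv : Set E) 1 ρ) : R.IsPolRep q k ρ := by
  constructor
  · intro μ ν
    rw [h.1, ← inclHom_apply, inclHom_mon]
    rfl
  · intro j μ
    have ht : (1 : R.Torus F) ∈ R.torusOf q (R.Qv : Set E) := by
      rw [torusOf_Qv]; rfl
    have := (k.heckeData R.Qv_isOrbit ht).op_qmon_lattice j μ _
      (R.crossTerm_spec_inv q k j μ)
    rw [HeckeData.op_qmon] at this
    rw [h.2]
    exact this

end EuclideanRoots

/-! ### Coordinates in type `C` -/

namespace TypeC

section Tuples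

variable {n : ℕ} {M : Type*} [CommRing M]

/-- The values of the gradients `-2 ε_1`, `ε_i - ε_{i+1}`, `2 ε_r` of the affine simple roots. -/
def pair (j : Node n) (v : Fin (n + 1) → M) : M :=
  match j with
  | .zero => -(2 * v 0)
  | .mid i => v i.castSucc - v i.succ
  | .last => 2 * v (Fin.last n)

/-- The coordinates of the coroots `-ε_1`, `ε_i - ε_{i+1}`, `ε_r`. -/
def covec : Node n → Fin (n + 1) → ℤ
  | .zero => -Pi.single 0 1
  | .mid i => Pi.single i.castSucc 1 - Pi.single i.succ 1
  | .last => Pi.single (Fin.last n) 1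

theorem reflTuple_eq (j : Node n) (v : Fin (n + 1) → M) :
    reflTuple j v = v - pair j v • fun i => (covec j i : M) := by
  funext m
  cases j with
  | zero =>
    simp only [reflTuple, pair, covec, Function.update_apply, Pi.sub_apply, Pi.smul_apply,
      Pi.neg_apply, Pi.single_apply, smul_eq_mul]
    split_ifs with h
    · subst h; push_cast; ring
    · push_cast; ring
  | last =>
    simp only [reflTuple, pair, covec, Function.update_apply, Pi.sub_apply, Pi.smul_apply,
      Pi.single_apply, smul_eq_mul]
    split_ifs with h
    · subst h; push_cast; ring
    · push_cast; ring
  | mid i =>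
    have hi : i.castSucc ≠ i.succ := i.castSucc_lt_succ.ne
    simp only [reflTuple, pair, covec, Function.comp_apply, Pi.sub_apply, Pi.smul_apply,
      Pi.single_apply, smul_eq_mul, Equiv.swap_apply_def]
    split_ifs with h h' h'
    · exact absurd (h.symm.trans h') hi
    · subst h; push_cast; ring
    · subst h'; push_cast; ring
    · push_cast; ring

end Tuples

variable {ι E : Type*} [NormedAddCommGroup E] [InnerProductSpace ℝ E] {n : ℕ}
variable {R : EuclideanRoots ι E} (ε : OrthonormalBasis (Fin (n + 1)) ℝ E)

theorem vec_coord (y : E) : vec ε (coord ε y) = y := ε.sum_repr' y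

theorem coord_vec (v : Fin (n + 1) → ℝ) : coord ε (vec ε v) = v := by
  funext i
  simp [coord, vec, inner_sum, inner_smul_right, ε.inner_eq_ite]

theorem vec_sub (v w : Fin (n + 1) → ℝ) : vec ε (v - w) = vec ε v - vec ε w := by
  simp [vec, sub_smul, Finset.sum_sub_distrib]

theorem vec_smul (c : ℝ) (v : Fin (n + 1) → ℝ) : vec ε (c • v) = c • vec ε v := by
  simp [vec, Finset.smul_sum, smul_smul]

theorem latt_add (μ ν : Fin (n + 1) → ℤ) : latt ε (μ + ν) = latt ε μ + latt ε ν := by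
  simp [latt, vec, add_smul, Finset.sum_add_distrib]

theorem latt_zero : latt ε 0 = 0 := by simp [latt, vec]

theorem latt_neg (μ : Fin (n + 1) → ℤ) : latt ε (-μ) = -latt ε μ :=
  eq_neg_of_add_eq_zero_left (by rw [← latt_add, neg_add_cancel, latt_zero])

theorem latt_single (i : Fin (n + 1)) : latt ε (Pi.single i 1) = ε i := by
  simp [latt, vec, Pi.single_apply]

theorem coord_latt (μ : Fin (n + 1) → ℤ) (i : Fin (n + 1)) : coord ε (latt ε μ) i = μ i := by
  rw [latt, coord_vec]

variable {ε}

/-! ### The affine simple roots of type `C` -/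

namespace IsRealisation

variable (h : IsRealisation R ε)

include h

theorem exists_node (v : E) (hv : v ∈ simpleRoots ε) :
    ∃ i : R.base.support, R.P.root i = v := by
  rw [← h.simple_eq] at hv
  obtain ⟨i, hi, rfl⟩ := hv
  exact ⟨⟨i, hi⟩, rfl⟩

/-- The affine simple root attached to a label. -/
def node : Node n → R.Node
  | .zero => none
  | .mid i => some (h.exists_node (ε i.castSucc - ε i.succ) (Or.inl ⟨i, rfl⟩)).choose
  | .last => some (h.exists_node ((2 : ℝ) • ε (Fin.last n)) (Or.inr rfl)).choose

/-- Every simple root pairs nonnegatively with `ε_1`, so `φ - 2ε_1` does too. Thus `⟪φ, ε_1⟫ ≥ 2`,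
and `2ε_1` is the only root with this property. -/
theorem root_highest : R.P.root R.highest = (2 : ℝ) • ε 0 := by
  obtain ⟨a, ha⟩ : (2 : ℝ) • ε 0 ∈ Set.range R.P.root := by
    rw [h.roots_eq]; exact Or.inr ⟨0, Or.inl rfl⟩
  have hc := (R.inCone_highest_sub a).inner_nonneg (R := R) (c := ε 0) fun i => by
    have hi : R.P.root i ∈ simpleRoots ε := by
      rw [← h.simple_eq]; exact ⟨i, i.2, rfl⟩
    rcases hi with ⟨j, hj⟩ | hj
    · rw [hj, inner_sub_left, ε.inner_eq_ite, ε.inner_eq_ite, if_neg (Fin.succ_ne_zero j)]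
      split_ifs <;> norm_num
    · rw [hj, inner_smul_left, ε.inner_eq_ite, RCLike.conj_to_real]
      split_ifs <;> norm_num
  rw [ha, inner_sub_left, inner_smul_left, ε.inner_eq_one, RCLike.conj_to_real, mul_one] at hc
  have hr : R.P.root R.highest ∈ roots ε := by rw [← h.roots_eq]; exact ⟨_, rfl⟩
  have hle' : ∀ i j, i < j → |⟪ε i, ε 0⟫| + |⟪ε j, ε 0⟫| ≤ 1 := fun i j hij => by
    rw [ε.inner_eq_ite, ε.inner_eq_ite, if_neg (fun h0 : j = 0 => by
      rw [h0] at hij; exact absurd hij (Fin.not_lt_zero _))]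
    split_ifs <;> norm_num
  rcases hr with ⟨i, j, hij, hr⟩ | ⟨i, hr⟩
  · exfalso
    have h1 := hle' i j hij
    have h2 := abs_le.mp (le_refl |⟪ε i, ε 0⟫|)
    have h3 := abs_le.mp (le_refl |⟪ε j, ε 0⟫|)
    rcases hr with hr | hr | hr | hr <;> rw [hr] at hc <;>
      simp only [inner_add_left, inner_sub_left, inner_neg_left] at hc <;> linarith
  · rcases hr with hr | hr <;> rw [hr] at hc
    · rw [inner_smul_left, RCLike.conj_to_real, ε.inner_eq_ite] at hc
      split_ifs at hc with h0
      · rw [hr, h0]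
      · norm_num at hc
    · rw [inner_neg_left, inner_smul_left, RCLike.conj_to_real, ε.inner_eq_ite] at hc
      split_ifs at hc <;> norm_num at hc

theorem grad_node (j : Node n) : R.grad (h.node j) =
    match j with
    | .zero => -((2 : ℝ) • ε 0)
    | .mid i => ε i.castSucc - ε i.succ
    | .last => (2 : ℝ) • ε (Fin.last n) := by
  cases j with
  | zero => exact congrArg Neg.neg h.root_highest
  | mid i => exact (h.exists_node (ε i.castSucc - ε i.succ) (Or.inl ⟨i, rfl⟩)).choose_spec
  | last => exact (h.exists_node ((2 : ℝ) • ε (Fin.last n)) (Or.inr rfl)).choose_spec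

theorem inner_grad_node (j : Node n) (y : E) :
    ⟪R.grad (h.node j), y⟫ = pair j (coord ε y) := by
  rw [h.grad_node]
  cases j <;> simp [pair, coord, inner_sub_left, inner_smul_left]

theorem cograd_node (j : Node n) : (R.cograd (h.node j) : E) = latt ε (covec j) := by
  rw [EuclideanRoots.cograd_eq, h.grad_node]
  cases j with
  | zero =>
    rw [covec, latt_neg, latt_single, norm_neg, norm_smul, ε.norm_eq_one]
    norm_num [smul_smul]
  | mid i =>
    have hi : i.castSucc ≠ i.succ := i.castSucc_lt_succ.ne
    have h2 : ‖ε i.castSucc - ε i.succ‖ ^ 2 = 2 := by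
      rw [norm_sub_sq_real, ε.norm_eq_one, ε.norm_eq_one, ε.inner_eq_zero hi]; norm_num
    rw [covec, sub_eq_add_neg, latt_add, latt_neg, latt_single, latt_single]
    simp only [h2]
    rw [div_self two_ne_zero, one_smul, sub_eq_add_neg]
  | last =>
    rw [covec, latt_single, norm_smul, ε.norm_eq_one]
    norm_num [smul_smul]

theorem inner_grad_cograd_node (i j : Node n) :
    ⟪R.grad (h.node i), (R.cograd (h.node j) : E)⟫ = (pair i (covec j) : ℤ) := by
  rw [h.inner_grad_node, h.cograd_node]
  cases i <;> simp [pair, coord_latt]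

theorem inner_grad_latt (j : Node n) (μ : Fin (n + 1) → ℤ) :
    ⟪R.grad (h.node j), latt ε μ⟫ = (pair j μ : ℤ) := by
  rw [h.inner_grad_node]
  cases j <;> simp [pair, coord_latt]

/-- Labels of the same node would have the same column of Cartan integers; the affine node is
separated by being `none`. -/
theorem node_injective : Function.Injective h.node := by
  intro i j hij
  have h1 := h.inner_grad_cograd_node
  have hc : ∀ l, (pair l (covec i) : ℤ) = pair l (covec j) := fun l => by
    have := h1 l i
    rw [hij, h1] at this
    exact_mod_cast this.symm
  have hne : ∀ l : Node n, l ≠ .zero → h.node .zero ≠ h.node l := by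
    rintro (_ | l | _) hl
    · exact absurd rfl hl
    · exact (Option.some_ne_none _).symm
    · exact (Option.some_ne_none _).symm
  have hm : ∀ a : Fin n, h.node (.mid a) ≠ h.node .last := fun a ha => by
    have h2 : (pair (n := n) .last (covec .last) : ℤ) = pair .last (covec (.mid a)) := by
      have h2 := h1 .last (.mid a)
      rw [ha, h1] at h2
      exact_mod_cast h2
    simp only [pair, covec, Pi.sub_apply, Pi.single_apply, Fin.ext_iff, Fin.val_last,
      Fin.val_castSucc, Fin.val_succ] at h2
    have := a.2
    split_ifs at h2 <;> omega
  cases i with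
  | zero => exact (by_contra fun hj => hne j (Ne.symm hj) hij)
  | mid a =>
    cases j with
    | zero => exact absurd hij.symm (hne _ (by simp))
    | mid b =>
      have h2 := hc (.mid a)
      simp only [pair, covec, Pi.sub_apply, Pi.single_apply, Fin.ext_iff,
        Fin.val_castSucc, Fin.val_succ] at h2
      congr 1
      apply Fin.ext
      by_contra hab
      split_ifs at h2 <;> omega
    | last => exact absurd hij (hm a)
  | last =>
    cases j with
    | zero => exact absurd hij.symm (hne _ (by simp))
    | mid b => exact absurd hij.symm (hm b)
    | last => rfl

theorem node_surjective : Function.Surjective h.node := by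
  rintro (_ | i)
  · exact ⟨.zero, rfl⟩
  · have hi : R.P.root i ∈ simpleRoots ε := by
      rw [← h.simple_eq]; exact ⟨i, i.2, rfl⟩
    have key : ∀ l : Node n, R.grad (h.node l) = R.P.root i → l ≠ .zero → h.node l = some i := by
      intro l hl hl0
      cases l with
      | zero => exact absurd rfl hl0
      | mid j => exact congrArg some (Subtype.ext (R.P.root.injective hl))
      | last => exact congrArg some (Subtype.ext (R.P.root.injective hl))
    rcases hi with ⟨j, hj⟩ | hj
    · exact ⟨.mid j, key _ ((h.grad_node _).trans hj.symm) (by simp)⟩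
    · exact ⟨.last, key _ ((h.grad_node _).trans hj.symm) (by simp)⟩

theorem reflVec_eq (j : Node n) (y : E) : reflVec ε j y = (R.s (h.node j)).1.linear y := by
  rw [R.s_linear, h.inner_grad_node, h.cograd_node, reflVec, reflTuple_eq, vec_sub, vec_smul,
    vec_coord]
  rfl

/-- The coroots of type `C` have integral coordinates. Consequently the gradients `-2ε_1` and `2ε_r`
are even on `Q^∨`, which is what leaves `u_0` and `u_r` free. -/
theorem exists_inner_eq (i : Fin (n + 1)) {v : E} (hv : v ∈ R.Qv) : ∃ m : ℤ, ⟪ε i, v⟫ = m := by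
  induction hv using AddSubgroup.closure_induction with
  | mem x hx =>
    obtain ⟨a, rfl⟩ := hx
    have hr : R.P.root a ∈ roots ε := by rw [← h.roots_eq]; exact ⟨_, rfl⟩
    have hε : ∀ j, ∃ m : ℤ, ⟪ε i, ε j⟫ = m := fun j => by
      rw [ε.inner_eq_ite]
      split_ifs
      · exact ⟨1, by simp⟩
      · exact ⟨0, by simp⟩
    rw [R.coroot_eq]
    rcases hr with ⟨j, l, hjl, hr⟩ | ⟨j, hr⟩
    · obtain ⟨m, hm⟩ := hε j
      obtain ⟨m', hm'⟩ := hε l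
      have h0 := ε.inner_eq_zero hjl.ne
      have h1 : ‖ε j + ε l‖ ^ 2 = 2 := by
        rw [norm_add_sq_real, ε.norm_eq_one, ε.norm_eq_one, h0]; norm_num
      have h2 : ‖ε j - ε l‖ ^ 2 = 2 := by
        rw [norm_sub_sq_real, ε.norm_eq_one, ε.norm_eq_one, h0]; norm_num
      rcases hr with hr | hr | hr | hr <;> rw [hr]
      · exact ⟨m + m', by rw [h1, inner_smul_right, inner_add_right, hm, hm']; push_cast; ring⟩
      · exact ⟨m - m', by rw [h2, inner_smul_right, inner_sub_right, hm, hm']; push_cast; ring⟩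
      · exact ⟨-(m + m'), by
          rw [norm_neg, h1, inner_smul_right, inner_neg_right, inner_add_right, hm, hm']
          push_cast; ring⟩
      · exact ⟨-(m - m'), by
          rw [norm_neg, h2, inner_smul_right, inner_neg_right, inner_sub_right, hm, hm']
          push_cast; ring⟩
    · obtain ⟨m, hm⟩ := hε j
      rcases hr with hr | hr <;> rw [hr]
      · exact ⟨m, by
          rw [norm_smul, ε.norm_eq_one, inner_smul_right, inner_smul_right, hm]
          norm_num
          ring⟩
      · exact ⟨-m, by
          rw [norm_neg, norm_smul, ε.norm_eq_one, inner_smul_right, inner_neg_right,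
            inner_smul_right, hm]
          norm_num
          ring⟩
  | zero => exact ⟨0, by simp⟩
  | add x y _ _ hx hy =>
    obtain ⟨a, ha⟩ := hx
    obtain ⟨b, hb⟩ := hy
    exact ⟨a + b, by rw [inner_add_right, ha, hb]; push_cast; rfl⟩
  | neg x _ hx =>
    obtain ⟨a, ha⟩ := hx
    exact ⟨-a, by rw [inner_neg_right, ha]; push_cast; rfl⟩

theorem even_or (j : Node n) : (∃ i, j = .mid i) ∨
    ∀ μ : R.Qv, ∃ m : ℤ, ⟪R.grad (h.node j), (μ : E)⟫ = ((2 * m : ℤ) : ℝ) := by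
  cases j with
  | zero =>
    refine Or.inr fun μ => ?_
    obtain ⟨m, hm⟩ := h.exists_inner_eq 0 μ.2
    exact ⟨-m, by rw [h.inner_grad_node]; simp [pair, coord, hm]⟩
  | mid i => exact Or.inl ⟨i, rfl⟩
  | last =>
    refine Or.inr fun μ => ?_
    obtain ⟨m, hm⟩ := h.exists_inner_eq (Fin.last n) μ.2
    exact ⟨m, by rw [h.inner_grad_node]; simp [pair, coord, hm]⟩

/-- A Cartan integer `-1` is odd, which rules out the end nodes. Hence the requirement of equal
parameters in `HeckeData` concerns only the middle nodes, which all carry `k`. -/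
theorem exists_mid_of_cartan {i j : Node n}
    (hij : ⟪R.grad (h.node i), (R.cograd (h.node j) : E)⟫ = -1) : ∃ l, i = .mid l := by
  rcases h.even_or i with hi | hi
  · exact hi
  · obtain ⟨m, hm⟩ := hi (R.cograd (h.node j))
    rw [hij] at hm
    have : -1 = 2 * m := by exact_mod_cast hm
    omega

end IsRealisation
end TypeC

/-! ### Merging the even and odd truncations, and the scalar at the affine node. -/

theorem floorE_floorO_cases (s : ℝ) : (floorE s = ⌊s⌋ ∧ floorO s = ⌊s⌋ - 1) ∨
    (floorE s = ⌊s⌋ - 1 ∧ floorO s = ⌊s⌋) := by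
  have h1 := Int.floor_le s
  have h2 := Int.lt_floor_add_one s
  rcases Int.even_or_odd' ⌊s⌋ with ⟨n, hn | hn⟩
  · left
    rw [hn] at h1 h2 ⊢
    push_cast at h1 h2
    have e1 : ⌊s / 2⌋ = n := by rw [Int.floor_eq_iff]; constructor <;> linarith
    have e2 : ⌊(s + 1) / 2⌋ = n := by rw [Int.floor_eq_iff]; constructor <;> linarith
    rw [floorE, floorO, e1, e2]
    exact ⟨rfl, rfl⟩
  · right
    rw [hn] at h1 h2 ⊢
    push_cast at h1 h2
    have e1 : ⌊s / 2⌋ = n := by rw [Int.floor_eq_iff]; constructor <;> linarith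
    have e2 : ⌊(s + 1) / 2⌋ = n + 1 := by
      rw [Int.floor_eq_iff]; push_cast; constructor <;> linarith
    rw [floorE, floorO, e1, e2]
    constructor <;> ring

theorem chiE_add_chiO (s : ℝ) : chiE s + chiO s = chiZ s := by
  by_cases h : ∃ n : ℤ, s = n
  · rw [chiZ, if_pos h]
    obtain ⟨n, rfl⟩ := h
    rcases Int.even_or_odd' n with ⟨m, rfl | rfl⟩
    · rw [chiE_of_even m (by push_cast; rfl), chiO_of_even m (by push_cast; rfl)]
    · rw [chiE_of_odd m (by push_cast; rfl), chiO_of_odd m (by push_cast; rfl)]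
  · rw [chiZ, if_neg h]
    push Not at h
    rw [chiE_of_not_int h, chiO_of_not_int h]

theorem chiE_neg (s : ℝ) : chiE (-s) = chiE s := by
  have : (∃ m : ℤ, -s = 2 * m) ↔ ∃ m : ℤ, s = 2 * m :=
    ⟨fun ⟨m, h⟩ => ⟨-m, by push_cast; linarith⟩, fun ⟨m, h⟩ => ⟨-m, by push_cast; linarith⟩⟩
  classical exact if_congr this rfl rfl

theorem chiO_neg (s : ℝ) : chiO (-s) = chiO s := by
  have : (∃ m : ℤ, -s = 2 * m + 1) ↔ ∃ m : ℤ, s = 2 * m + 1 :=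
    ⟨fun ⟨m, h⟩ => ⟨-m - 1, by push_cast; linarith⟩,
      fun ⟨m, h⟩ => ⟨-m - 1, by push_cast; linarith⟩⟩
  classical exact if_congr this rfl rfl

namespace EuclideanRoots

variable {ι E : Type*} [NormedAddCommGroup E] [InnerProductSpace ℝ E] (R : EuclideanRoots ι E)
variable {F : Type*} [Field F] (q : Fˣ)

/-- The two parity floors are `⌊s⌋` and `⌊s⌋ - 1` in some order, so with `z = x^(α_j^∨)` the
numerators add up to `(1 + z)(1 - z^(-⌊s⌋))`, and `1 + z` cancels against `1 - z²`. -/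
theorem nablaE_add_nablaO (j : R.Node) (y : E) :
    R.nablaE q j y + R.nablaO q j y
      = exactQuot (1 - R.xPow q j (-⌊⟪R.grad j, y⟫⌋)) (1 - R.xPow q j 1) * mon F y := by
  apply R.cancel_one_sub q (j := j)
  have hd := one_sub_dvd (R.xPow (F := F) q j) (R.xPow_zero q j) (R.xPow_add q j) 1
    (-⌊⟪R.grad j, y⟫⌋)
  rw [one_mul] at hd
  have h := exactQuot_spec hd
  rw [mul_add, nablaE_spec, nablaO_spec]
  have h1 : R.xPow q j (-(⌊⟪R.grad j, y⟫⌋ - 1))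
      = R.xPow q j 1 * R.xPow q j (-⌊⟪R.grad j, y⟫⌋) := by
    rw [← xPow_add]; congr 1; ring
  rcases floorE_floorO_cases ⟪R.grad j, y⟫ with ⟨hE, hO⟩ | ⟨hE, hO⟩ <;>
    rw [hE, hO, h1, xPow_two] <;>
    linear_combination -(1 + R.xPow q j 1) * mon F y * h

/-- By definition the scalar is the value of `𝐠_(s_φ y) t` at `-φ^∨ = s_φ(φ^∨)`; equivariance
rewrites it at `y`. -/
theorem twc_s_none [Finite ι] {O : Set E} (hO : R.IsOrbit O) {t : R.Torus F}
    (ht : t ∈ R.torusOf q O) {y : E} (hy : y ∈ O) :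
    R.twc q t (R.s none) y
      = R.torusAct q (R.gmin y) t ⟨R.P.coroot R.highest, R.coroot_mem _⟩ := by
  have h := R.tpt_linear q hO ht hy (R.s none) ⟨R.P.coroot R.highest, R.coroot_mem _⟩
  rw [twc_eq]
  refine Eq.trans ?_ h
  congr 2
  apply Subtype.ext
  change -(R.s none).1 0 = (R.s none).1.linear (R.P.coroot R.highest)
  have h2 := R.inner_root_coroot_self R.highest
  rw [s_apply, s_linear]
  simp only [ev, simpleRoot, grad, cst, cograd, inner_zero_right, inner_neg_left, h2,
    AddSubgroup.coe_neg]
  push_cast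
  module

end EuclideanRoots

/-! ### Laurent polynomials inside `F[Q^∨]`, and the operators of type `C` in coordinates. -/

namespace TypeC

section Laurent

variable {n : ℕ} {F : Type*} [Field F] (q : Fˣ)

/-- The scalar occurring in the monomial attached to a label. -/
def scal (j : Node n) : Fˣ :=
  match j with
  | .zero => q
  | _ => 1

/-- The powers of the monomial attached to a label. -/
def zpowSimple (j : Node n) (m : ℤ) : AddMonoidAlgebra F (Fin (n + 1) → ℤ) :=
  AddMonoidAlgebra.single (m • covec j) ((scal q j ^ m : Fˣ) : F)

theorem zpowSimple_zero (j : Node n) : zpowSimple q j 0 = 1 := by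
  simp [zpowSimple, AddMonoidAlgebra.one_def]

theorem zpowSimple_add (j : Node n) (a b : ℤ) :
    zpowSimple q j (a + b) = zpowSimple q j a * zpowSimple q j b := by
  simp only [zpowSimple, AddMonoidAlgebra.single_mul_single, add_smul, zpow_add, Units.val_mul]

theorem xSimple_eq (j : Node n) : xSimple q j = zpowSimple q j 1 := by
  cases j <;> simp [xSimple, zpowSimple, covec, scal]

theorem sMon_eq (j : Node n) (μ : Fin (n + 1) → ℤ) :
    sMon q j μ = zpowSimple q j (-pair j μ) * mon F μ := by
  have h : reflTuple j μ = -pair j μ • covec j + μ := by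
    rw [reflTuple_eq, neg_smul, neg_add_eq_sub]
    rfl
  rw [zpowSimple, mon, AddMonoidAlgebra.single_mul_single, mul_one, ← h]
  cases j with
  | zero => simp only [sMon, pair, scal, neg_neg, zpow_mul, zpow_ofNat]
  | mid i => simp [sMon, scal]
  | last => simp [sMon, scal]

/-- At the end nodes the pairing with an integral weight is even, so `1 - z²` divides the difference
of monomials. At the middle nodes equal parameters supply a factor `1 + z`, and divisibility by `1 -
z` is enough. -/
theorem crossTerm_spec (k0 u0 k kr ur : Fˣ) (j : Node n) (μ : Fin (n + 1) → ℤ) :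
    (1 - xSimple q j ^ 2) * crossTerm q k0 u0 k kr ur j μ =
      (algebraMap F _ ((param k0 k kr j : F) - (param k0 k kr j : F)⁻¹)
        + algebraMap F _ ((param u0 k ur j : F) - (param u0 k ur j : F)⁻¹) * xSimple q j)
      * (mon F μ - sMon q j μ) := by
  have hz : xSimple q j ^ 2 = zpowSimple q j 2 := by
    rw [xSimple_eq, sq, ← zpowSimple_add]; rfl
  have hm : mon F μ - sMon q j μ = mon F μ * (1 - zpowSimple q j (-pair j μ)) := by
    rw [sMon_eq]; ring
  have hd : ∀ d m, 1 - zpowSimple q j d ∣ 1 - zpowSimple q j (d * m) :=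
    EuclideanRoots.one_sub_dvd (zpowSimple q j) (zpowSimple_zero q j) (zpowSimple_add q j)
  have hall : ∀ a, (∃ m, pair j μ = 2 * m) → 1 - xSimple q j ^ 2 ∣
      a * (mon F μ - sMon q j μ) := by
    rintro a ⟨m, h⟩
    rw [hz, hm, h, ← mul_neg]
    exact dvd_mul_of_dvd_right (dvd_mul_of_dvd_right (hd 2 (-m)) _) _
  rw [crossTerm, EuclideanRoots.exactQuot_spec]
  · simp only [Units.val_inv_eq_inv_val]
  · cases j with
    | zero => exact hall _ ⟨-μ 0, by simp [pair]⟩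
    | last => exact hall _ ⟨μ (Fin.last n), rfl⟩
    | mid i =>
      obtain ⟨c, hc⟩ := hd 1 (-pair (.mid i) μ)
      rw [one_mul] at hc
      rw [hm, hc, ← xSimple_eq]
      exact ⟨algebraMap F _ (k - (k⁻¹ : Fˣ)) * mon F μ * c, by simp only [param]; ring⟩

end Laurent

variable {ι E : Type*} [NormedAddCommGroup E] [InnerProductSpace ℝ E] {n : ℕ}
variable {R : EuclideanRoots ι E} {ε : OrthonormalBasis (Fin (n + 1)) ℝ E}
variable {F : Type*} [Field F] {q : Fˣ} {O : Set E} {t : R.Torus F}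

namespace IsRealisation

/-- The label of an affine simple root. -/
def label (h : IsRealisation R ε) : R.Node → Node n := Function.surjInv h.node_surjective

theorem label_node (h : IsRealisation R ε) (j : Node n) : h.label (h.node j) = j :=
  Function.leftInverse_surjInv ⟨h.node_injective, h.node_surjective⟩ j

/-- The Hecke parameters of Sahi's algebra. -/
def heckeData (h : IsRealisation R ε) (k0 u0 k kr ur : Fˣ) (hO : R.IsOrbit O)
    (ht : t ∈ R.torusOf q O) : R.HeckeData q O where
  κ j := param k0 k kr (h.label j)
  υ j := param u0 k ur (h.label j)
  t := t
  orbit := hO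
  mem := ht
  even j := by
    obtain ⟨j, rfl⟩ := h.node_surjective j
    rw [h.label_node]
    rcases h.even_or j with ⟨i, rfl⟩ | hj
    · exact Or.inl rfl
    · exact Or.inr hj
  conj i j hij hji := by
    obtain ⟨i, rfl⟩ := h.node_surjective i
    obtain ⟨j, rfl⟩ := h.node_surjective j
    rw [h.label_node, h.label_node]
    obtain ⟨l, rfl⟩ := h.exists_mid_of_cartan hij
    obtain ⟨m, rfl⟩ := h.exists_mid_of_cartan hji
    exact ⟨rfl, rfl⟩

variable (h : IsRealisation R ε) (k0 u0 k kr ur : Fˣ) (hO : R.IsOrbit O) (ht : t ∈ R.torusOf q O)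

theorem κ_node (j : Node n) :
    (h.heckeData k0 u0 k kr ur hO ht).κ (h.node j) = param k0 k kr j :=
  congrArg (param k0 k kr) (h.label_node j)

theorem υ_node (j : Node n) :
    (h.heckeData k0 u0 k kr ur hO ht).υ (h.node j) = param u0 k ur j :=
  congrArg (param u0 k ur) (h.label_node j)

theorem xPow_node (j : Node n) (m : ℤ) :
    R.xPow q (h.node j) m = cmon (scal q j) (latt ε (covec j)) m := by
  rw [EuclideanRoots.xPow, cmon, h.cograd_node]
  cases j <;> simp [node, EuclideanRoots.cst, scal]

/-- The embedding of `ℤ^r` in the coroot lattice. -/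
def lattHom : (Fin (n + 1) → ℤ) →+ R.Qv where
  toFun μ := ⟨latt ε μ, h.latt_mem μ⟩
  map_zero' := Subtype.ext (latt_zero ε)
  map_add' μ ν := Subtype.ext (latt_add ε μ ν)

/-- Laurent polynomials as elements of `F[Q^∨]`. -/
def laurentHom : AddMonoidAlgebra F (Fin (n + 1) → ℤ) →ₐ[F] AddMonoidAlgebra F R.Qv :=
  AddMonoidAlgebra.mapDomainAlgHom F F h.lattHom

theorem laurentHom_single (μ : Fin (n + 1) → ℤ) (c : F) :
    h.laurentHom (AddMonoidAlgebra.single μ c) = AddMonoidAlgebra.single (h.lattHom μ) c :=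
  AddMonoidAlgebra.mapDomain_single

theorem laurentHom_mon (μ : Fin (n + 1) → ℤ) :
    h.laurentHom (mon F μ) = mon F (h.lattHom μ) := h.laurentHom_single μ 1

theorem laurentHom_zpowSimple (j : Node n) (m : ℤ) :
    h.laurentHom (zpowSimple q j m) = R.xPowQ q (h.node j) m := by
  have h1 : h.lattHom (covec j) = R.cograd (h.node j) := Subtype.ext (h.cograd_node j).symm
  rw [zpowSimple, laurentHom_single, map_zsmul, h1, EuclideanRoots.xPowQ]
  cases j <;> simp [node, EuclideanRoots.cst, scal]

theorem laurentHom_xSimple (j : Node n) :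
    h.laurentHom (xSimple q j) = R.xSimple q (h.node j) := by
  rw [xSimple_eq, laurentHom_zpowSimple, EuclideanRoots.xPowQ_one]

theorem laurentHom_sMon (j : Node n) (μ : Fin (n + 1) → ℤ) :
    h.laurentHom (sMon q j μ) = R.wAct q (R.s (h.node j)) (h.lattHom μ) := by
  rw [sMon_eq, map_mul, laurentHom_zpowSimple, laurentHom_mon,
    EuclideanRoots.HeckeData.wAct_eq _ _ _ (h.inner_grad_latt j μ)]

theorem inclHom_laurentHom (p : AddMonoidAlgebra F (Fin (n + 1) → ℤ)) :
    R.inclHom (h.laurentHom p) = AddMonoidAlgebra.mapDomain (latt ε) p := by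
  induction p using AddMonoidAlgebra.induction_linear with
  | zero => simp
  | add p p' hp hp' => rw [map_add, map_add, hp, hp', AddMonoidAlgebra.mapDomain_add]
  | single μ c =>
    rw [laurentHom_single, EuclideanRoots.inclHom_single, AddMonoidAlgebra.mapDomain_single]
    rfl

theorem laurentHom_crossTerm (j : Node n) (μ : Fin (n + 1) → ℤ) :
    (1 - R.xSimple q (h.node j) ^ 2) * h.laurentHom (crossTerm q k0 u0 k kr ur j μ)
      = (algebraMap F _ (((h.heckeData k0 u0 k kr ur hO ht).κ (h.node j) : F)
          - ((h.heckeData k0 u0 k kr ur hO ht).κ (h.node j) : F)⁻¹)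
        + algebraMap F _ (((h.heckeData k0 u0 k kr ur hO ht).υ (h.node j) : F)
          - ((h.heckeData k0 u0 k kr ur hO ht).υ (h.node j) : F)⁻¹) * R.xSimple q (h.node j))
        * (mon F (h.lattHom μ) - R.wAct q (R.s (h.node j)) (h.lattHom μ)) := by
  have := congrArg h.laurentHom (crossTerm_spec q k0 u0 k kr ur j μ)
  simpa only [map_mul, map_sub, map_add, map_one, map_pow, AlgHom.commutes, laurentHom_xSimple,
    laurentHom_sMon, laurentHom_mon, κ_node, υ_node] using this

variable [Finite ι]

theorem val_zero {y : E} (hy : y ∈ O) :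
    (h.heckeData k0 u0 k kr ur hO ht).val (h.node .zero) y
      = opZero ε q k0 u0 (R.torusAct q (R.gmin y) t ⟨ε 0, h.basis_mem 0⟩) y := by
  have hν : (⟨R.P.coroot R.highest, R.coroot_mem _⟩ : R.Qv) = ⟨ε 0, h.basis_mem 0⟩ := by
    apply Subtype.ext
    change R.P.coroot R.highest = ε 0
    rw [R.coroot_eq, h.root_highest, norm_smul, ε.norm_eq_one]
    norm_num [smul_smul]
  have hc : R.twc q t (R.s (h.node .zero)) y
      = R.torusAct q (R.gmin y) t ⟨ε 0, h.basis_mem 0⟩ := by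
    rw [← hν]; exact R.twc_s_none q hO ht hy
  have hx : ∀ m, R.xPow q (h.node .zero) m = cmon q (-ε 0) m := fun m => by
    rw [h.xPow_node, covec, latt_neg, latt_single]; rfl
  -- Negative powers of `q^(1/2) x_1⁻¹` are powers of `q^(-1/2) x_1`, the form in which they appear
  -- in the formula for `T_0`.
  have hx' : ∀ m, R.xPow q (h.node .zero) (-m) = cmon q⁻¹ (ε 0) m := fun m => by
    rw [hx, cmon, cmon, neg_smul_neg, inv_zpow']
  have ha : ⟪R.grad (h.node .zero), y⟫ = -(2 * coord ε y 0) := h.inner_grad_node .zero y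
  rw [EuclideanRoots.HeckeData.val, EuclideanRoots.dl, κ_node, υ_node, EuclideanRoots.nablaE,
    EuclideanRoots.nablaO, EuclideanRoots.twAct_eq]
  change _ • AddMonoidAlgebra.single _ (R.twc q t (R.s (h.node .zero)) y : F) + _ + _ = _
  rw [hc, ha, chiE_neg, chiO_neg, hx', hx', hx, hx, ← h.reflVec_eq, single_eq_smul_mon, smul_smul]
  rfl

omit [Finite ι] in
theorem twAct_node (j : Node n) (hj : j ≠ .zero) (y : E) :
    R.twAct q t (R.s (h.node j)) y = mon F (reflVec ε j y) := by
  have key : ∀ i : R.base.support,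
      R.twAct q t (R.s (some i)) y = mon F ((R.s (some i)).1.linear y) := fun i => by
    have h0 : (R.s (some i)).1 0 = 0 := by
      rw [R.s_apply]; simp [ev, EuclideanRoots.simpleRoot, EuclideanRoots.cst]
    rw [EuclideanRoots.twAct_some, R.W_apply, h0, add_zero]
  rw [h.reflVec_eq]
  cases j with
  | zero => exact absurd rfl hj
  | mid i => exact key _
  | last => exact key _

omit [Finite ι] in
theorem val_last (y : E) :
    (h.heckeData k0 u0 k kr ur hO ht).val (h.node .last) y = opLast ε kr ur y := by
  have hx : ∀ m, R.xPow q (h.node .last) m = cmon 1 (ε (Fin.last n)) m := fun m => by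
    rw [h.xPow_node, covec, latt_single]; rfl
  have ha : ⟪R.grad (h.node .last), y⟫ = 2 * coord ε y (Fin.last n) := h.inner_grad_node .last y
  rw [EuclideanRoots.HeckeData.val, EuclideanRoots.dl, κ_node, υ_node, EuclideanRoots.nablaE,
    EuclideanRoots.nablaO, ha, hx, hx, hx, hx]
  change _ • R.twAct q t (R.s (h.node .last)) y + _ + _ = _
  rw [h.twAct_node .last (by simp)]
  rfl

omit [Finite ι] in
theorem val_mid (i : Fin n) (y : E) :
    (h.heckeData k0 u0 k kr ur hO ht).val (h.node (.mid i)) y = opMid ε k i y := by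
  have hx : ∀ m, R.xPow q (h.node (.mid i)) m = cmon 1 (ε i.castSucc - ε i.succ) m := fun m => by
    rw [h.xPow_node, covec, sub_eq_add_neg, latt_add, latt_neg, latt_single, latt_single,
      ← sub_eq_add_neg]
    rfl
  have hx' : ∀ m, R.xPow q (h.node (.mid i)) (-m) = cmon 1 (ε i.succ - ε i.castSucc) m :=
    fun m => by rw [hx, cmon, cmon, neg_smul, ← smul_neg, neg_sub, one_zpow, one_zpow]
  have ha : ⟪R.grad (h.node (.mid i)), y⟫ = coord ε y i.castSucc - coord ε y i.succ :=
    h.inner_grad_node (.mid i) y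
  have hn := R.nablaE_add_nablaO (F := F) q (h.node (.mid i)) y
  rw [EuclideanRoots.HeckeData.val, EuclideanRoots.dl, κ_node, υ_node]
  change _ • R.twAct q t (R.s (h.node (.mid i))) y + ((k : F) - (k : F)⁻¹) • _
    + ((k : F) - (k : F)⁻¹) • _ = _
  rw [h.twAct_node (.mid i) (by simp), add_assoc, ← smul_add, hn, ha, hx', hx]
  change ((k : F) ^ _ * (k : F) ^ _) • _ + _ = _
  rw [← pow_add, chiE_add_chiO]
  rfl

end IsRealisation
end TypeC

namespace TypeC

/-! ### The representations of Sahi's algebra -/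

variable {ι E : Type*} [NormedAddCommGroup E] [InnerProductSpace ℝ E] {n : ℕ}
variable {R : EuclideanRoots ι E} {ε : OrthonormalBasis (Fin (n + 1)) ℝ E}
variable {F : Type*} [Field F] {q : Fˣ} {O : Set E} {t : R.Torus F}

theorem SahiDAHA.hom_ext {k0 u0 k kr ur : Fˣ} {A : Type*} [Semiring A] [Algebra F A]
    {f g : SahiDAHA n q k0 u0 k kr ur →ₐ[F] A}
    (hT : ∀ j, f (T q k0 u0 k kr ur j) = g (T q k0 u0 k kr ur j))
    (hX : ∀ μ, f (X q k0 u0 k kr ur μ) = g (X q k0 u0 k kr ur μ)) : f = g := by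
  refine RingQuot.ringQuot_ext' _ _ _ (FreeAlgebra.hom_ext (funext fun x => ?_))
  cases x with
  | T j => exact hT j
  | X μ => exact hX μ

theorem altProd_two {A : Type*} [Monoid A] (a b : A) : altProd a b 2 = a * b := by
  rw [altProd, altProd, altProd, mul_one]

namespace IsRealisation

variable (h : IsRealisation R ε) (k0 u0 k kr ur : Fˣ) (hO : R.IsOrbit O) (ht : t ∈ R.torusOf q O)

/-- The action of the free algebra on `F[O]`. -/
def freeHom (D : R.HeckeData q O) : FreeAlgebra F (Gen n) →ₐ[F] Module.End F (quasiPol F O) :=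
  FreeAlgebra.lift F fun
    | .T j => D.op (h.node j)
    | .X μ => D.mul (mon F (h.lattHom μ))

theorem freeHom_T (D : R.HeckeData q O) (j : Node n) :
    h.freeHom D (FreeAlgebra.ι F (Gen.T j)) = D.op (h.node j) := FreeAlgebra.lift_ι_apply _ _

theorem freeHom_X (D : R.HeckeData q O) (μ : Fin (n + 1) → ℤ) :
    h.freeHom D (FreeAlgebra.ι F (Gen.X μ)) = D.mul (mon F (h.lattHom μ)) :=
  FreeAlgebra.lift_ι_apply _ _

theorem cartan_node {i j : Node n} {c : ℤ} (hc : pair i (covec j) = c) :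
    ⟪R.grad (h.node i), (R.cograd (h.node j) : E)⟫ = (c : ℝ) := by
  rw [h.inner_grad_cograd_node, hc]

theorem pair_mid_covec_mid (i j : Fin n) : pair (.mid i) (covec (.mid j))
    = (if (i : ℕ) = j then 2 else 0) - (if (i : ℕ) + 1 = j then 1 else 0)
      - if (j : ℕ) + 1 = i then 1 else 0 := by
  simp only [pair, covec, Pi.sub_apply, Pi.single_apply, Fin.ext_iff, Fin.val_castSucc,
    Fin.val_succ]
  split_ifs <;> omega

theorem pair_zero_covec_mid (i : Fin n) :
    pair .zero (covec (.mid i)) = if (i : ℕ) = 0 then -2 else 0 := by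
  simp only [pair, covec, Pi.sub_apply, Pi.single_apply, Fin.ext_iff, Fin.val_castSucc,
    Fin.val_succ, Fin.coe_ofNat_eq_mod, Nat.zero_mod]
  split_ifs <;> first | contradiction | omega

theorem pair_mid_covec_zero (i : Fin n) :
    pair (.mid i) (covec .zero) = if (i : ℕ) = 0 then -1 else 0 := by
  simp only [pair, covec, Pi.neg_apply, Pi.single_apply, Fin.ext_iff, Fin.val_castSucc,
    Fin.val_succ, Fin.coe_ofNat_eq_mod, Nat.zero_mod]
  split_ifs <;> first | contradiction | omega

theorem pair_last_covec_mid (i : Fin n) :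
    pair .last (covec (.mid i)) = if (i : ℕ) + 1 = n then -2 else 0 := by
  have := i.2
  simp only [pair, covec, Pi.sub_apply, Pi.single_apply, Fin.ext_iff, Fin.val_castSucc,
    Fin.val_succ, Fin.val_last]
  split_ifs <;> omega

theorem pair_mid_covec_last (i : Fin n) :
    pair (.mid i) (covec .last) = if (i : ℕ) + 1 = n then -1 else 0 := by
  have := i.2
  simp only [pair, covec, Pi.single_apply, Fin.ext_iff, Fin.val_castSucc,
    Fin.val_succ, Fin.val_last]
  split_ifs <;> omega

theorem pair_zero_covec_last (hn : n ≠ 0) : pair (.zero : Node n) (covec .last) = 0 := by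
  simp [pair, covec, Fin.ext_iff, hn.symm]

theorem pair_last_covec_zero (hn : n ≠ 0) : pair (.last : Node n) (covec .zero) = 0 := by
  simp [pair, covec, Fin.ext_iff, hn]

variable [Finite ι]

theorem op_comm (D : R.HeckeData q O) {i j : Node n} (hij : pair i (covec j) = 0)
    (hji : pair j (covec i) = 0) :
    D.op (h.node i) * D.op (h.node j) = D.op (h.node j) * D.op (h.node i) := by
  have := D.op_braid_two (by simpa using h.cartan_node hij) (by simpa using h.cartan_node hji)
  rwa [altProd_two, altProd_two] at this

theorem op_braid_four (D : R.HeckeData q O) {i j : Node n} (hij : pair i (covec j) = -1)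
    (hji : pair j (covec i) = -2) :
    altProd (D.op (h.node i)) (D.op (h.node j)) 4 = altProd (D.op (h.node j)) (D.op (h.node i)) 4 :=
  D.op_braid_four (by simpa using h.cartan_node hij) (by simpa using h.cartan_node hji)

theorem freeHom_rel {x y : FreeAlgebra F (Gen n)} (hxy : Rel q k0 u0 k kr ur x y) :
    h.freeHom (h.heckeData k0 u0 k kr ur hO ht) x
      = h.freeHom (h.heckeData k0 u0 k kr ur hO ht) y := by
  have hκ := h.κ_node k0 u0 k kr ur hO ht
  have hcross := h.laurentHom_crossTerm k0 u0 k kr ur hO ht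
  generalize h.heckeData k0 u0 k kr ur hO ht = D at *
  induction hxy with
  | braid3 i j hij =>
    rw [map_altProd, map_altProd, freeHom_T, freeHom_T]
    refine D.op_braid_three ?_ ?_
    · have := h.cartan_node (pair_mid_covec_mid i j)
      rw [this, if_neg (by omega), if_pos hij, if_neg (by omega)]
      norm_num
    · have := h.cartan_node (pair_mid_covec_mid j i)
      rw [this, if_neg (by omega), if_neg (by omega), if_pos hij]
      norm_num
  | braid_zero i hi =>
    rw [map_altProd, map_altProd, freeHom_T, freeHom_T]
    exact (h.op_braid_four D (by rw [pair_mid_covec_zero, if_pos hi])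
      (by rw [pair_zero_covec_mid, if_pos hi])).symm
  | braid_last i hi =>
    rw [map_altProd, map_altProd, freeHom_T, freeHom_T]
    exact h.op_braid_four D (by rw [pair_mid_covec_last, if_pos hi])
      (by rw [pair_last_covec_mid, if_pos hi])
  | comm_mid i j hij =>
    rw [map_mul, map_mul, freeHom_T, freeHom_T]
    refine h.op_comm D ?_ ?_
    · rw [pair_mid_covec_mid, if_neg (by omega), if_neg (by omega), if_neg (by omega)]; rfl
    · rw [pair_mid_covec_mid, if_neg (by omega), if_neg (by omega), if_neg (by omega)]; rfl
  | comm_zero i hi =>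
    rw [map_mul, map_mul, freeHom_T, freeHom_T]
    exact h.op_comm D (by rw [pair_zero_covec_mid, if_neg hi])
      (by rw [pair_mid_covec_zero, if_neg hi])
  | comm_last i hi =>
    rw [map_mul, map_mul, freeHom_T, freeHom_T]
    exact h.op_comm D (by rw [pair_last_covec_mid, if_neg hi])
      (by rw [pair_mid_covec_last, if_neg hi])
  | comm_zero_last hn =>
    rw [map_mul, map_mul, freeHom_T, freeHom_T]
    exact h.op_comm D (pair_zero_covec_last hn) (pair_last_covec_zero hn)
  | quadratic j =>
    refine map_quadratic (A := FreeAlgebra F (Gen n)) (B := Module.End F (quasiPol F O))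
      (h.freeHom D) _ (param k0 k kr j) ?_
    rw [freeHom_T, ← hκ]
    exact D.op_mul_op (h.node j)
  | X_add μ ν =>
    rw [map_mul, freeHom_X, freeHom_X, freeHom_X, ← map_mul, mon_mul_mon, ← map_add]
  | X_zero =>
    rw [freeHom_X, map_one, map_zero, mon, ← AddMonoidAlgebra.one_def, map_one]
  | cross j μ =>
    refine map_cross (A := FreeAlgebra F (Gen n)) (B := Module.End F (quasiPol F O)) (h.freeHom D)
      (D.mul.comp h.laurentHom).toLinearMap (fun μ => FreeAlgebra.ι F (Gen.X μ))
      (fun μ => ?_) _ μ _ _ ?_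
    · rw [freeHom_X, ← laurentHom_mon]
      rfl
    · change h.freeHom D _ * D.mul (h.laurentHom _)
        = D.mul (h.laurentHom _) * h.freeHom D _ + D.mul (h.laurentHom _)
      rw [freeHom_T, laurentHom_mon, laurentHom_sMon]
      exact D.op_mul_mon (h.node j) (h.lattHom μ) _ (hcross j μ)

/-- The quasi-polynomial representation of Sahi's algebra. -/
def quasiPolRep : SahiDAHA n q k0 u0 k kr ur →ₐ[F] Module.End F (quasiPol F O) :=
  RingQuot.liftAlgHom F ⟨h.freeHom (h.heckeData k0 u0 k kr ur hO ht),
    fun _ _ => h.freeHom_rel k0 u0 k kr ur hO ht⟩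

/-- Once the coordinate formulas are recognised as the operators of `heckeData`, the conditions
become equations for the images of the generators, which yields both existence and uniqueness. -/
theorem isQuasiPolRep_iff
    (ρ : SahiDAHA n q k0 u0 k kr ur →ₐ[F] Module.End F (quasiPol F O)) :
    IsQuasiPolRep h q k0 u0 k kr ur O t ρ ↔
      (∀ μ, ρ (X q k0 u0 k kr ur μ)
        = (h.heckeData k0 u0 k kr ur hO ht).mul (mon F (h.lattHom μ))) ∧
      ∀ j, ρ (T q k0 u0 k kr ur j) = (h.heckeData k0 u0 k kr ur hO ht).op (h.node j) := by
  set D := h.heckeData k0 u0 k kr ur hO ht with hD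
  have hX : ∀ μ y (hy : y ∈ O),
      (D.mul (mon F (h.lattHom μ)) (qmon F y hy) : AddMonoidAlgebra F E)
        = mon F (y + latt ε μ) := fun μ y hy => by
    rw [EuclideanRoots.HeckeData.mul_mon_qmon]; rfl
  constructor
  · rintro ⟨h1, h2, h3, h4⟩
    refine ⟨fun μ => end_ext fun y hy => Subtype.ext ((h1 μ y hy).trans (hX μ y hy).symm),
      fun j => end_ext fun y hy => Subtype.ext ?_⟩
    rw [EuclideanRoots.HeckeData.op_qmon]
    cases j with
    | zero => rw [h2 y hy, hD, h.val_zero _ _ _ _ _ _ _ hy]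
    | mid i => rw [h3 i y hy, hD, h.val_mid]
    | last => rw [h4 y hy, hD, h.val_last]
  · rintro ⟨h1, h2⟩
    refine ⟨fun μ y hy => by rw [h1, hX], fun y hy => ?_, fun i y hy => ?_, fun y hy => ?_⟩
    · rw [h2, EuclideanRoots.HeckeData.op_qmon, hD, h.val_zero _ _ _ _ _ _ _ hy]
    · rw [h2, EuclideanRoots.HeckeData.op_qmon, hD, h.val_mid]
    · rw [h2, EuclideanRoots.HeckeData.op_qmon, hD, h.val_last]

theorem isQuasiPolRep :
    IsQuasiPolRep h q k0 u0 k kr ur O t (h.quasiPolRep k0 u0 k kr ur hO ht) := by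
  rw [h.isQuasiPolRep_iff k0 u0 k kr ur hO ht]
  constructor
  · intro μ
    rw [quasiPolRep, X, RingQuot.liftAlgHom_mkAlgHom_apply, freeHom_X]
  · intro j
    rw [quasiPolRep, T, RingQuot.liftAlgHom_mkAlgHom_apply, freeHom_T]

include hO ht in
theorem existsUnique_isQuasiPolRep :
    ∃! ρ : SahiDAHA n q k0 u0 k kr ur →ₐ[F] Module.End F (quasiPol F O),
      IsQuasiPolRep h q k0 u0 k kr ur O t ρ := by
  have h0 := h.isQuasiPolRep k0 u0 k kr ur hO ht
  refine ⟨_, h0, fun ρ hρ => ?_⟩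
  rw [h.isQuasiPolRep_iff k0 u0 k kr ur hO ht] at h0 hρ
  exact SahiDAHA.hom_ext (fun j => (hρ.2 j).trans (h0.2 j).symm)
    fun μ => (hρ.1 μ).trans (h0.1 μ).symm

theorem isPolRep
    {ρ : SahiDAHA n q k0 u0 k kr ur →ₐ[F] Module.End F (quasiPol F (R.Qv : Set E))}
    (hρ : IsQuasiPolRep h q k0 u0 k kr ur (R.Qv : Set E) 1 ρ) :
    IsPolRep h q k0 u0 k kr ur ρ := by
  have ht : (1 : R.Torus F) ∈ R.torusOf q (R.Qv : Set E) := by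
    rw [EuclideanRoots.torusOf_Qv]; rfl
  constructor
  · intro μ ν
    rw [hρ.1, ← latt_add]
    exact AddMonoidAlgebra.mapDomain_single.symm
  · intro j μ
    have h2 := ((h.isQuasiPolRep_iff k0 u0 k kr ur R.Qv_isOrbit ht ρ).mp hρ).2 j
    have := (h.heckeData k0 u0 k kr ur R.Qv_isOrbit ht).op_qmon_lattice (h.node j) (h.lattHom μ) _
      (h.laurentHom_crossTerm k0 u0 k kr ur R.Qv_isOrbit ht j μ)
    rw [h2]
    refine this.trans ?_
    rw [← laurentHom_sMon, κ_node, ← map_smul, ← map_add, inclHom_laurentHom]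

end IsRealisation
end TypeC
end QuasiPoly

end

open QuasiPoly
theorem theorem3p12 {ι E F : Type*} [Finite ι] [NormedAddCommGroup E] [InnerProductSpace ℝ E]
    [FiniteDimensional ℝ E] [Field F] [CharZero F]
    (R : EuclideanRoots ι E) (q : Fˣ) (k : R.Multiplicity F) :
    -- for every orbit `O` and `t ∈ 𝐓_O`: the action of `H^X` on `F[O]` and its extension `π_t^O`
    (∀ O : Set E, R.IsOrbit O → ∀ t ∈ R.torusOf q O,
      ∃ (π : R.HX q k →ₐ[F] Module.End F (quasiPol F O))
        (ρ : R.DAHA q k →ₐ[F] Module.End F (quasiPol F O)),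
        R.IsHXRep q k O π ∧ (∀ π', R.IsHXRep q k O π' → π' = π) ∧
        R.IsQuasiPolRep q k O t ρ ∧ (∀ ρ', R.IsQuasiPolRep q k O t ρ' → ρ' = ρ) ∧
        ρ.comp (R.HX q k).val = π) ∧
    -- the orbit `O = Q^∨` gives the polynomial representation
    (R.IsOrbit (R.Qv : Set E) ∧ R.torusOf (F := F) q (R.Qv : Set E) = {1} ∧
      ∀ ρ, R.IsQuasiPolRep q k (R.Qv : Set E) 1 ρ → R.IsPolRep q k ρ) ∧
    -- type `C_r`, `r = n + 1`: representations of Sahi's five parameter algebra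
    (∀ (n : ℕ) (ε : OrthonormalBasis (Fin (n + 1)) ℝ E) (hε : TypeC.IsRealisation R ε)
      (k0 u0 kk kr ur : Fˣ),
      (∀ O : Set E, R.IsOrbit O → ∀ t ∈ R.torusOf q O,
        ∃! ρ : TypeC.SahiDAHA n q k0 u0 kk kr ur →ₐ[F] Module.End F (quasiPol F O),
          TypeC.IsQuasiPolRep hε q k0 u0 kk kr ur O t ρ) ∧
      (∀ ρ, TypeC.IsQuasiPolRep hε q k0 u0 kk kr ur (R.Qv : Set E) 1 ρ →
        TypeC.IsPolRep hε q k0 u0 kk kr ur ρ)) := by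
  refine ⟨fun O hO t ht => ?_, ⟨R.Qv_isOrbit, R.torusOf_Qv q, fun ρ hρ => hρ.isPolRep⟩,
    fun n ε hε k0 u0 kk kr ur => ⟨fun O hO t ht =>
      hε.existsUnique_isQuasiPolRep k0 u0 kk kr ur hO ht, fun ρ hρ =>
      hε.isPolRep k0 u0 kk kr ur hρ⟩⟩
  have hρ := EuclideanRoots.isQuasiPolRep k hO ht
  have hπ := EuclideanRoots.isHXRep k hO ht
  -- The `H^X`-action is taken to be the restriction of `π_t^O`, so the extension property holds by
  -- definition; uniqueness of `π` shows that this restriction does not depend on `t`.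
  exact ⟨_, _, hπ, fun π' hπ' => hπ'.unique k hπ, hρ, fun ρ' hρ' => hρ'.unique k hρ, rfl⟩
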